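/- Let a closed connected oriented surface of genus $g$ (a torus for $g=1$) carry a trivalent tiling whose plaquettes are properly coloured with three colours $r,g,b$. An edge has the colour that the two plaquettes beside it do not have. Let $n_\triangle$ be the number of vertices. In the associated ruby lattice every vertex $v$ is replaced by a triangle of three qubits $(v,c)$, where $(v,c)$ is the corner of the triangle in the plaquette of colour $c$ at $v$; there are $n=3n_\triangle$ qubits. The checks are $ZZ$ on the sides of the triangles, and, on the sides $\{(v,d),(w,d)\}$ of each plaquette of colour $d$ (one for each edge $vw$ of the tiling around it), alternately $XX$ and $YY$: in red, blue and green plaquettes the $XX$ checks lie along the blue, green and red edges respectively, and the $YY$ checks lie along the others. (For hexagonal plaquettes on a torus this is the usual ruby lattice.) The period-3 XYZ ruby code measures $ZZ,XX,YY$ periodically; the rewinding period-6 schedule measures $ZZ,XX,YY,ZZ,YY,XX$ periodically. Both start at $t=-4$ from the trivial stabilizer group (an arbitrary state), each round advancing $t$ by $1$. If $\mathcal S$ is the stabilizer group before a round with check set $\mathcal M$, the group after it is generated by the checks with the signs of their measurement outcomes and the elements of $\mathcal S$ that commute with all of $\mathcal M$. Let $\mathcal S_t$ be the resulting instantaneous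 stabilizer groups, for any sequence of outcomes that can occur (no $\mathcal S_t$ contains $-\mathbb 1$). Stabilizer groups $(\mathcal S,\mathcal S')$ form a reversible pair if every element of $\mathcal S$ commuting with $\mathcal S'$ lies in $\mathcal S'$ and every element of $\mathcal S'$ commuting with $\mathcal S$ lies in $\mathcal S$. Let $\mathcal N(\mathcal S)$ be the group of Pauli operators commuting with $\mathcal S$. Let $L_t$ be the logical Pauli group $\mathcal N(\mathcal S_t)/\mathcal S_t$ modulo phases. The anyons of the colour code are $A_{CC}=A_{TC}\times A_{TC}$, with $A_{TC}=\{1,e,m,f\}\cong\mathbb Z_2^2$, $f=em$, and with topological spin the product of the toric-code spins ($\theta_f=-1$, $\theta_1=\theta_e=\theta_m=1$). Its nine bosons $cp$ ($c\in\{r,g,b\}$, $p\in\{x,y,z\}$) are $$\begin{array}{ccc} rx=(e,1)& gx=(e,e)& bx=(1,e)\\ ry=(e,m)& gy=(f,f)& by=(m,e)\\ rz=(1,m)& gz=(m,m)& bz=(m,1).\end{array}$$ For a closed $\mathbb Z_2$-chain $\gamma$ of edges of the tiling, the $cp$ string operator $W_\gamma(cp)$ acts with $P^{\otimes 3}$ ($P$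 the Pauli matrix with label $p$) on the triangles at both ends of every edge of $\gamma$ of colour $c$. **Claim.** There is an automorphism $\varphi$ of the group $A_{CC}$ that preserves the spin, has order $3$, and acts on the bosons by the cycles $rx\to bz\to gy\to rx$, $gz\to ry\to bx\to gz$, $gx\to rz\to by\to gx$, such that the following holds. 1. For the period-3 schedule: * For all $t\ge 0$, $\mathcal S_t$ encodes exactly $4g$ logical qubits, that is, $\operatorname{rank}\mathcal S_t=n-4g$ (so four logical qubits on a torus). Up to signs, $\mathcal S_0$ is the colour code of the tiling with every qubit encoded in the three-qubit repetition code on its triangle. * For all $t\ge 0$, $(\mathcal S_t,\mathcal S_{t+1})$ is a reversible pair, and $\mathcal S_{t+3}=\mathcal S_t$ up to signs. Hence $\mathcal S_0\to\mathcal S_1\to\mathcal S_2\to\mathcal S_0$. * For all $t\ge 0$, every class of $\mathcal N(\mathcal S_t)/\mathcal S_t$ has a representative in $\mathcal N(\mathcal S_{t+1})$, and sending its class to the class of this representative defines an isomorphism $\mathcal N(\mathcal S_t)/\mathcal S_t\to\mathcal N(\mathcal S_{t+1})/\mathcal S_{t+1}$. The same holds for $L_t\to L_{t+1}$. * $[\gamma]\otimes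 cp\mapsto[W_\gamma(cp)]$ defines an isomorphism $\Phi:H_1(\Sigma;\mathbb Z_2)\otimes A_{CC}\to L_0$, where $\Sigma$ is the surface. * Let $\mathfrak a_t$ be the automorphism of $L_t$ that one period implements, that is, the composite $L_t\to L_{t+1}\to L_{t+2}\to L_{t+3}=L_t$. It preserves the commutation relations of logical operators. It satisfies $\mathfrak a_0\circ\Phi=\Phi\circ(\mathrm{id}\otimes\varphi)$, and $\mathfrak a_t$ has order $3$ for every $t\ge 0$ if $g\ge1$. 2. For the rewinding schedule: for all $t\ge 0$, $\mathcal S_t$ has rank $n-4g$, $(\mathcal S_t,\mathcal S_{t+1})$ is a reversible pair inducing isomorphisms of the logical groups as above, and $\mathcal S_{t+6}=\mathcal S_t$ up to signs. The automorphism of $L_t$ implemented by one period is the identity. -/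

import Mathlib

namespace XYZRuby

/-! ## The Pauli group -/

/-- The additive embedding of `ZMod 2` in `ZMod 4`, `1 ↦ 2`, so that `i ^ double a = (-1) ^ a`. -/
def double : ZMod 2 →+ ZMod 4 :=
  AddMonoidHom.mk' (fun a => if a = 0 then 0 else 2) (by decide)

/-- The Pauli group on the qubits `Q`: the element `⟨k, x, z⟩` is the operator
`i ^ k * (∏ q, X_q ^ x q) * (∏ q, Z_q ^ z q)`. -/
@[ext]
structure Pauli (Q : Type*) where
  phase : ZMod 4
  x : Q → ZMod 2
  z : Q → ZMod 2

namespace Pauli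

variable {Q : Type*}

/-- Moving `Z ^ z` past `X ^ x` costs the sign `(-1) ^ (∑ q, z q * x q)`. -/
instance [Fintype Q] : Mul (Pauli Q) where
  mul P R := ⟨P.phase + R.phase + double (∑ q, P.z q * R.x q), P.x + R.x, P.z + R.z⟩

instance : One (Pauli Q) where
  one := ⟨0, 0, 0⟩

instance [Fintype Q] : Inv (Pauli Q) where
  inv P := ⟨-P.phase + double (∑ q, P.z q * P.x q), P.x, P.z⟩

theorem mul_def [Fintype Q] (P R : Pauli Q) : P * R =
    ⟨P.phase + R.phase + double (∑ q, P.z q * R.x q), P.x + R.x, P.z + R.z⟩ := rfl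

theorem one_def : (1 : Pauli Q) = ⟨0, 0, 0⟩ := rfl

theorem inv_def [Fintype Q] (P : Pauli Q) :
    P⁻¹ = ⟨-P.phase + double (∑ q, P.z q * P.x q), P.x, P.z⟩ := rfl

instance [Fintype Q] : Group (Pauli Q) :=
  Group.ofLeftAxioms
    (by
      intro A B C
      ext1
      · simp only [mul_def, Pi.add_apply, add_mul, mul_add, Finset.sum_add_distrib, map_add]
        abel
      · simp only [mul_def, add_assoc]
      · simp only [mul_def, add_assoc])
    (by
      intro A
      ext1 <;> simp [mul_def, one_def])
    (by
      intro A
      have h2 : ∀ a : ZMod 2, double a + double a = 0 := by decide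
      ext1
      · simp only [mul_def, inv_def, one_def]
        linear_combination h2 (∑ q, A.z q * A.x q)
      · funext q
        exact CharTwo.add_self_eq_zero _
      · funext q
        exact CharTwo.add_self_eq_zero _)

instance [Finite Q] : Finite (Pauli Q) :=
  Finite.of_injective (fun P : Pauli Q => (P.phase, P.x, P.z)) (by
    intro P R h
    simp only [Prod.mk.injEq] at h
    exact Pauli.ext h.1 h.2.1 h.2.2)

/-- The operator `-1`. -/
def neg : Pauli Q := ⟨2, 0, 0⟩

/-- The subgroup `{1, i, -1, -i}` of phases. -/
def phases (Q : Type*) [Fintype Q] : Subgroup (Pauli Q) where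
  carrier := {P | P.x = 0 ∧ P.z = 0}
  one_mem' := ⟨rfl, rfl⟩
  mul_mem' := by
    rintro P R ⟨h1, h2⟩ ⟨h3, h4⟩
    exact ⟨by simp [mul_def, h1, h3], by simp [mul_def, h2, h4]⟩
  inv_mem' := by
    rintro P ⟨h1, h2⟩
    exact ⟨h1, h2⟩

end Pauli

/-- The three non-trivial Pauli labels. -/
inductive PauliLabel
  | x
  | y
  | z

/-- The cyclic shift `x → z → y → x`. -/
def PauliLabel.next : PauliLabel → PauliLabel
  | .x => .z
  | .z => .y
  | .y => .x

/-- The product over all qubits in `A` of the Pauli matrix with the given label (`Y = i X Z`). -/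
noncomputable def Pauli.on {Q : Type*} (A : Set Q) : PauliLabel → Pauli Q
  | .x => ⟨0, A.indicator 1, 0⟩
  | .y => ⟨(A.ncard : ZMod 4), A.indicator 1, A.indicator 1⟩
  | .z => ⟨0, 0, A.indicator 1⟩

/-! ## Stabilizer groups, measurements and logical operators -/

section Stabilizers

variable {Q : Type*} [Fintype Q]

/-- The stabilizer group after measuring the checks in `M` on a system with stabilizer group `S`;
`o P = true` means that the check `P` had outcome `-1`. -/
def measure (M : Set (Pauli Q)) (o : Pauli Q → Bool) (S : Subgroup (Pauli Q)) :
    Subgroup (Pauli Q) :=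
  Subgroup.closure
    ((fun P => (if o P then Pauli.neg else 1) * P) '' M ∪ {s | s ∈ S ∧ ∀ P ∈ M, Commute s P})

/-- The instantaneous stabilizer groups of a measurement schedule `M` with outcomes `o`, started
in an arbitrary state: `isg M o t` is the group after the first `t` rounds. -/
def isg (M : ℕ → Set (Pauli Q)) (o : ℕ → Pauli Q → Bool) : ℕ → Subgroup (Pauli Q)
  | 0 => ⊥
  | t + 1 => measure (M t) (o t) (isg M o t)

/-- The outcomes `o` can occur: no instantaneous stabilizer group contains `-1`, so
none of the stabilized subspaces is zero. -/
def Possible (M : ℕ → Set (Pauli Q)) (o : ℕ → Pauli Q → Bool) : Prop :=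
  ∀ t, Pauli.neg ∉ isg M o t

/-- The stabilizer group at time `t`, when time is counted so that the first round takes the system
from time `-4` to time `-3`, and hence time `0` is reached after four rounds. -/
abbrev groupAt (M : ℕ → Set (Pauli Q)) (o : ℕ → Pauli Q → Bool) (t : ℕ) : Subgroup (Pauli Q) :=
  isg M o (t + 4)

/-- `(S, S')` is a reversible pair of stabilizer groups. -/
def IsReversiblePair (S S' : Subgroup (Pauli Q)) : Prop :=
  (∀ s ∈ S, (∀ s' ∈ S', Commute s s') → s ∈ S') ∧ (∀ s' ∈ S', (∀ s ∈ S, Commute s s') → s' ∈ S)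

/-- The Pauli operators that commute with `S`. For a stabilizer group `S` without `-1` this is its
normalizer in the Pauli group, and it does not change when phases are added to `S`. -/
abbrev commutant (S : Subgroup (Pauli Q)) : Subgroup (Pauli Q) :=
  Subgroup.centralizer (S : Set (Pauli Q))

instance (S : Subgroup (Pauli Q)) : (S.subgroupOf (commutant S)).Normal where
  conj_mem := by
    intro n hn h
    have h1 : (n : Pauli Q) * h = h * n := Subgroup.mem_centralizer_iff.1 h.2 n hn
    have h2 : h * n * h⁻¹ = n := by
      apply Subtype.ext
      simp [← h1]
    rw [h2]
    exact hn

/-- The group of classes of logical operators of `S`: operators that commute with `S`, modulo those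
in `S`. For a stabilizer group `S` this is `N(S) / S`, and for `withPhases S` it is `N(S) / S`
modulo phases. -/
abbrev Logical (S : Subgroup (Pauli Q)) : Type _ :=
  commutant S ⧸ S.subgroupOf (commutant S)

/-- A stabilizer group together with all phases, that is, the group with its signs forgotten. -/
def withPhases (S : Subgroup (Pauli Q)) : Subgroup (Pauli Q) := S ⊔ Pauli.phases Q

/-- The stabilizer group at time `t` with its signs forgotten. -/
abbrev signlessAt (M : ℕ → Set (Pauli Q)) (o : ℕ → Pauli Q → Bool) (t : ℕ) :
    Subgroup (Pauli Q) :=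
  withPhases (groupAt M o t)

/-- The operator `P` is a logical operator of `S` in the class `a`. -/
def Represents (S : Subgroup (Pauli Q)) (P : Pauli Q) (a : Logical S) : Prop :=
  ∃ h : P ∈ commutant S, (QuotientGroup.mk (⟨P, h⟩ : commutant S) : Logical S) = a

/-- `m` is the map of logical operators that a measurement taking `S` to `S'` induces: every class
of `S` has a representative that is a logical operator of `S'` as well, and `m` sends the class of
any such shared representative in `S` to its class in `S'`. -/
def IsTransfer {S S' : Subgroup (Pauli Q)} (m : Logical S ≃* Logical S') : Prop :=
  (∀ a, ∃ P, Represents S P a ∧ P ∈ commutant S') ∧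
    ∀ a P, Represents S P a → P ∈ commutant S' → Represents S' P (m a)

/-- The composite of `s` successive maps of a sequence, starting at time `t`. -/
def evolve {K : ℕ → Subgroup (Pauli Q)} (m : ∀ t, Logical (K t) ≃* Logical (K (t + 1))) :
    ∀ s t, Logical (K t) ≃* Logical (K (t + s))
  | 0, _ => MulEquiv.refl _
  | s + 1, t => (evolve m s t).trans (m (t + s))

/-- The identification of logical groups of equal groups. -/
def identify {S S' : Subgroup (Pauli Q)} (h : S = S') : Logical S ≃* Logical S' := by
  subst h
  exact MulEquiv.refl _

/-- The automorphism of the logical group at time `t` that one period `p` implements, when the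
groups `K` have period `p`. -/
def periodAut {K : ℕ → Subgroup (Pauli Q)} (m : ∀ t, Logical (K t) ≃* Logical (K (t + 1)))
    (p : ℕ) (h : ∀ t, K (t + p) = K t) (t : ℕ) : MulAut (Logical (K t)) :=
  (evolve m p t).trans (identify (h t))

end Stabilizers

/-! ## Three-coloured tilings and the ruby code -/

/-- The three colours. -/
inductive Color
  | r
  | g
  | b
  deriving DecidableEq

instance : Fintype Color where
  elems := {.r, .g, .b}
  complete := by rintro (_ | _ | _) <;> decide

/-- The cyclic shift `r → b → g → r`. -/
def Color.next : Color → Color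
  | .r => .b
  | .b => .g
  | .g => .r

/-- A trivalent tiling with three-coloured plaquettes of a closed connected oriented surface, with
vertex set `V`. An edge has the colour that the two plaquettes beside it do not have, so every
vertex has one edge of each colour, and the edge of colour `c` at `v` ends in `v` and `σ c v`. The
plaquettes of colour `c` are the cycles formed by the edges of the other two colours. The surface
(one disc glued to each of these cycles) is orientable exactly if the graph is bipartite. -/
structure Tiling (V : Type*) where
  σ : Color → Equiv.Perm V
  invol : ∀ c v, σ c (σ c v) = v
  orientable : ∃ ε : V → Bool, ∀ c v, ε (σ c v) = !(ε v)
  nonempty : Nonempty V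
  connected : ∀ v w, ∃ f ∈ Subgroup.closure (Set.range σ), f v = w

namespace Tiling

variable {V : Type*} (T : Tiling V)

/-- The permutations generated by moves along edges whose colours lie in `C`. -/
def moves (C : Set Color) : Subgroup (Equiv.Perm V) := Subgroup.closure (T.σ '' C)

/-- The number of components of the graph formed by the edges with colours in `C`. -/
noncomputable def numComponents (C : Set Color) : ℕ :=
  Nat.card (MulAction.orbitRel.Quotient (T.moves C) V)

/-- Vertices minus edges plus plaquettes. -/
noncomputable def eulerChar : ℤ :=
  Nat.card V
    - (T.numComponents {Color.r} + T.numComponents {Color.g} + T.numComponents {Color.b} : ℤ)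
    + (T.numComponents {Color.r}ᶜ + T.numComponents {Color.g}ᶜ + T.numComponents {Color.b}ᶜ : ℤ)

/-- The vertices of the plaquette of colour `c` at the vertex `v`. -/
def plaquette (c : Color) (v : V) : Set V := {w | ∃ f ∈ T.moves {c}ᶜ, f v = w}

/-- The closed `ZMod 2`-chains of edges: `γ v c = 1` if the edge of colour `c` at `v` belongs to
the chain, and every vertex has an even number of edges in the chain. -/
def cycles : Submodule (ZMod 2) (V → Color → ZMod 2) where
  carrier := {γ | (∀ v c, γ (T.σ c v) c = γ v c) ∧
    ∀ v, γ v Color.r + γ v Color.g + γ v Color.b = 0}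
  zero_mem' := by simp
  add_mem' := by
    rintro γ δ ⟨h1, h2⟩ ⟨h3, h4⟩
    refine ⟨fun v c => by simp [h1, h3], fun v => ?_⟩
    simp only [Pi.add_apply]
    linear_combination h2 v + h4 v
  smul_mem' := by
    rintro a γ ⟨h1, h2⟩
    refine ⟨fun v c => by simp [h1], fun v => ?_⟩
    simp only [Pi.smul_apply, smul_eq_mul]
    linear_combination a * h2 v

open Classical in
/-- The closed chain of the edges around the plaquette of colour `c` at `v`. -/
noncomputable def plaquetteBoundary (c : Color) (v : V) : V → Color → ZMod 2 :=
  fun w d => if w ∈ T.plaquette c v ∧ d ≠ c then 1 else 0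

/-- The chains spanned by the boundaries of the plaquettes. -/
noncomputable def boundaries : Submodule (ZMod 2) (V → Color → ZMod 2) :=
  Submodule.span (ZMod 2) {γ | ∃ c v, γ = T.plaquetteBoundary c v}

/-- The first homology of the surface over `ZMod 2`. -/
abbrev Homology : Type _ := T.cycles ⧸ T.boundaries.submoduleOf T.cycles

/-- The homology class of a closed chain. -/
noncomputable def homologyClass (γ : T.cycles) : T.Homology := Submodule.Quotient.mk γ

/-! The ruby lattice of the tiling: every vertex `v` is replaced by a triangle, and the qubit
`(v, c)` is the corner of this triangle that lies in the plaquette of colour `c` at `v`. -/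

/-- The `ZZ` checks, on the sides of the triangles. -/
def checksZ : Set (Pauli (V × Color)) :=
  {P | ∃ v c d, c ≠ d ∧ P = Pauli.on {(v, c), (v, d)} .z}

/-- The `XX` checks: in a plaquette of colour `d` they lie along the edges of colour `d.next`. -/
def checksX : Set (Pauli (V × Color)) :=
  {P | ∃ v d, P = Pauli.on {(v, d), (T.σ d.next v, d)} .x}

/-- The `YY` checks: in a plaquette of colour `d` they lie along the edges of colour
`d.next.next`, so they alternate with the `XX` checks around the plaquette. -/
def checksY : Set (Pauli (V × Color)) :=
  {P | ∃ v d, P = Pauli.on {(v, d), (T.σ d.next.next v, d)} .y}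

/-- The period-3 schedule `ZZ, XX, YY`. -/
def schedule (t : ℕ) : Set (Pauli (V × Color)) :=
  match t % 3 with
  | 0 => checksZ
  | 1 => T.checksX
  | _ => T.checksY

/-- The rewinding period-6 schedule `ZZ, XX, YY, ZZ, YY, XX`. -/
def rewindingSchedule (t : ℕ) : Set (Pauli (V × Color)) :=
  match t % 6 with
  | 0 => checksZ
  | 1 => T.checksX
  | 2 => T.checksY
  | 3 => checksZ
  | 4 => T.checksY
  | _ => T.checksX

/-- Generators (up to signs) of the colour code of the tiling with every qubit encoded in the
three-qubit repetition code on its triangle: the `ZZ` checks of the triangles and, for every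
plaquette, its encoded `X` and `Z` stabilizers. Encoded `X` is `XXX` on the triangle, and encoded
`Z` is `Z` on any one corner. -/
def colorCodeGenerators : Set (Pauli (V × Color)) :=
  checksZ ∪ {P | ∃ c v, P = Pauli.on {q | q.1 ∈ T.plaquette c v} .x}
    ∪ {P | ∃ c v, P = Pauli.on {q | q.1 ∈ T.plaquette c v ∧ q.2 = c} .z}

/-- The string operator along the closed chain `γ` of the colour code boson with colour `c` and
Pauli label `p`: the encoded Pauli operator `p` on the two ends of every edge of colour `c` of `γ`,
where encoded `X`, `Y`, `Z` are represented by `XXX`, `YYY`, `ZZZ` on the triangle. -/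
noncomputable def stringOp (γ : T.cycles) (c : Color) (p : PauliLabel) : Pauli (V × Color) :=
  Pauli.on {q | γ.1 q.1 c = 1} p

end Tiling

/-! ## The colour code anyon model -/

/-- The anyons of one toric code under fusion: `(1, 0)` is `e`, `(0, 1)` is `m`, `(1, 1)` is `f`. -/
abbrev ToricAnyon : Type := ZMod 2 × ZMod 2

/-- The topological spin of the toric code: `-1` on `f` and `1` otherwise. -/
def ToricAnyon.spin (a : ToricAnyon) : ℤ := if a = (1, 1) then -1 else 1

/-- The anyons of the colour code under fusion: two layers of the toric code. -/
abbrev Anyon : Type := ToricAnyon × ToricAnyon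

/-- The topological spin of the colour code anyons. -/
def Anyon.spin (a : Anyon) : ℤ := ToricAnyon.spin a.1 * ToricAnyon.spin a.2

/-- The table of the nine bosons of the colour code. -/
def boson : Color → PauliLabel → Anyon
  | .r, .x => ((1, 0), (0, 0))
  | .g, .x => ((1, 0), (1, 0))
  | .b, .x => ((0, 0), (1, 0))
  | .r, .y => ((1, 0), (0, 1))
  | .g, .y => ((1, 1), (1, 1))
  | .b, .y => ((0, 1), (1, 0))
  | .r, .z => ((0, 0), (0, 1))
  | .g, .z => ((0, 1), (0, 1))
  | .b, .z => ((0, 1), (0, 0))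

end XYZRuby

open XYZRuby

open scoped TensorProduct

/-! Modulo phases, Pauli operators are vectors of a symplectic space over F₂, a stabilizer group is
an isotropic subspace W, and measuring mutually commuting checks with span M replaces W by M + (W ∩
M^⊥) (`meas`). If M ∩ W^⊥ ≤ W, so that no nontrivial logical operator is measured, the round is
reversible: it preserves the rank, every logical class has a representative commuting with both
groups, and such representatives identify the two logical groups (`exists_shared`,
`exists_isTransfer`). Signs enter only through the absence of -1.

All checks are described by binary functions on the qubits: even functions on triangles for ZZ, and
for XX and YY the spaces `edgeInv k`, each equal to its own orthogonal complement. A layout `(n, A,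
B)` treats the orders XX, YY and YY, XX at once; let C be the effect of measuring A, B, Z in turn.
Starting from the colour code, reversibility of the first two rounds is a local argument. In the
third, a product of ZZ checks that commutes with the current group is a closed chain having
intersection number zero with every closed chain; by Poincaré duality (`exists_bd_eq`) it bounds
plaquettes, and is then exhibited as a stabilizer. Hence C(code) has the rank of the code. On the
other hand the ZZ checks alone already generate the code after one cycle (`code_le_cycle`).
Therefore code ≤ C(ZZ) ≤ C(code), and equality of ranks makes all three equal. This gives both the
group at time 0 and periodicity.

The logical group has dimension 8g by Euler characteristic (`finrank_code`). Four homology classes,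
carried by rx, bz, bx and rz strings, embed in it because commutators of strings are intersection
numbers (`stringMap_injective`). Since homology has dimension at least 2g (`le_finrank_cyc`), the
embedding is onto. Following explicit representatives through one cycle shows that labels change as
A to Z and Z to B while the colour shifts by `n` (`loop_left`, `loop_z`). For XX, YY, ZZ this is the
order-3 automorphism of the anyons; the layout `(n², y, x)` undoes it, whence the rewinding schedule
acts trivially. Uniqueness of transfers carries both results from time 0 to all times. -/

namespace XYZRuby

/-! ## Pauli operators as binary symplectic vectors -/

section Symplectic

variable {Q : Type*}

/-- The binary vectors `(x, z)` of Pauli operators modulo phases. -/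
abbrev PVec (Q : Type*) : Type _ := (Q → ZMod 2) × (Q → ZMod 2)

/-- The binary vector of a Pauli operator. -/
def Pauli.vec (P : Pauli Q) : PVec Q := (P.x, P.z)

/-- A Pauli operator with a given binary vector. -/
def Pauli.ofVec (u : PVec Q) : Pauli Q := ⟨0, u.1, u.2⟩

@[simp] theorem Pauli.vec_ofVec (u : PVec Q) : (Pauli.ofVec u).vec = u := rfl

@[simp] theorem Pauli.vec_one : (1 : Pauli Q).vec = 0 := rfl

@[simp] theorem Pauli.vec_neg : (Pauli.neg : Pauli Q).vec = 0 := rfl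

theorem PVec.add_self (u : PVec Q) : u + u = 0 := by
  ext q <;> exact CharTwo.add_self_eq_zero _

variable [Fintype Q]

@[simp] theorem Pauli.vec_mul (P R : Pauli Q) : (P * R).vec = P.vec + R.vec := rfl

@[simp] theorem Pauli.vec_inv (P : Pauli Q) : P⁻¹.vec = P.vec := rfl

/-- The symplectic form. -/
def symp (Q : Type*) [Fintype Q] : LinearMap.BilinForm (ZMod 2) (PVec Q) :=
  LinearMap.mk₂ (ZMod 2) (fun u v => u.1 ⬝ᵥ v.2 + u.2 ⬝ᵥ v.1)
    (by intro a b c; simp [add_dotProduct]; ring)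
    (by intro r a b; simp [mul_add])
    (by intro a b c; simp [dotProduct_add]; ring)
    (by intro r a b; simp [mul_add])

theorem symp_apply (u v : PVec Q) : symp Q u v = u.1 ⬝ᵥ v.2 + u.2 ⬝ᵥ v.1 := rfl

theorem symp_comm (u v : PVec Q) : symp Q u v = symp Q v u := by
  rw [symp_apply, symp_apply, dotProduct_comm u.1, dotProduct_comm u.2, add_comm]

theorem symp_isRefl : (symp Q).IsRefl := fun u v h => by rw [symp_comm, h]

theorem symp_nondegenerate : (symp Q).Nondegenerate := by
  classical
  refine (LinearMap.IsRefl.nondegenerate_iff_separatingLeft symp_isRefl).2 ?_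
  intro u hu
  ext q
  · simpa [symp_apply] using hu (0, Pi.single q 1)
  · simpa [symp_apply] using hu (Pi.single q 1, 0)

theorem Pauli.commute_iff (P R : Pauli Q) : Commute P R ↔ symp Q P.vec R.vec = 0 := by
  have hd : ∀ a b : ZMod 2, double a = double b ↔ b + a = 0 := by decide
  have h1 : symp Q P.vec R.vec = (∑ q, R.z q * P.x q) + ∑ q, P.z q * R.x q := by
    simp only [symp_apply, dotProduct, Pauli.vec]
    congr 1
    exact Finset.sum_congr rfl fun q _ => mul_comm _ _
  rw [h1, ← hd]
  constructor
  · intro h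
    have := congrArg Pauli.phase h.eq
    simp only [Pauli.mul_def] at this
    linear_combination this
  · intro h
    refine Pauli.ext ?_ (add_comm _ _) (add_comm _ _)
    simp only [Pauli.mul_def]
    rw [h]; ring

/-- The vectors that are symplectically orthogonal to `W`. -/
abbrev perp (W : Submodule (ZMod 2) (PVec Q)) : Submodule (ZMod 2) (PVec Q) :=
  (symp Q).orthogonal W

theorem mem_perp {W : Submodule (ZMod 2) (PVec Q)} {u : PVec Q} :
    u ∈ perp W ↔ ∀ w ∈ W, symp Q w u = 0 := Iff.rfl

theorem perp_perp (W : Submodule (ZMod 2) (PVec Q)) : perp (perp W) = W :=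
  LinearMap.BilinForm.orthogonal_orthogonal symp_nondegenerate symp_isRefl W

theorem perp_anti {W W' : Submodule (ZMod 2) (PVec Q)} (h : W ≤ W') : perp W' ≤ perp W :=
  LinearMap.BilinForm.orthogonal_le h

theorem perp_sup (W W' : Submodule (ZMod 2) (PVec Q)) : perp (W ⊔ W') = perp W ⊓ perp W' := by
  refine le_antisymm (le_inf (perp_anti le_sup_left) (perp_anti le_sup_right)) ?_
  rintro u ⟨h1, h2⟩ w hw
  obtain ⟨a, ha, b, hb, rfl⟩ := Submodule.mem_sup.1 hw
  rw [map_add, LinearMap.add_apply]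
  simp [mem_perp.1 h1 a ha, mem_perp.1 h2 b hb]

theorem perp_inf (W W' : Submodule (ZMod 2) (PVec Q)) : perp (W ⊓ W') = perp W ⊔ perp W' := by
  rw [← perp_perp (perp W ⊔ perp W'), perp_sup, perp_perp, perp_perp]

theorem perp_span_iff {s : Set (PVec Q)} {u : PVec Q} :
    u ∈ perp (Submodule.span (ZMod 2) s) ↔ ∀ w ∈ s, symp Q w u = 0 := by
  refine ⟨fun h w hw => h w (Submodule.subset_span hw), fun h w hw => ?_⟩
  induction hw using Submodule.span_induction with
  | mem x hx => exact h x hx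
  | zero => simp
  | add x y _ _ hx hy =>
    rw [map_add, LinearMap.add_apply, hx, hy, add_zero]
  | smul a x _ hx =>
    rw [map_smul, LinearMap.smul_apply, hx, smul_zero]

theorem finrank_perp (W : Submodule (ZMod 2) (PVec Q)) :
    Module.finrank (ZMod 2) (perp W) + Module.finrank (ZMod 2) W = 2 * Fintype.card Q := by
  have h := LinearMap.BilinForm.finrank_orthogonal (symp_nondegenerate (Q := Q)) W
  have h2 : Module.finrank (ZMod 2) (PVec Q) = 2 * Fintype.card Q := by
    simp [Module.finrank_prod]; ring
  have := Submodule.finrank_le W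
  lia

/-! ## Measurements on the level of binary vectors -/

/-- The effect of measuring the span `M` of the checks on the vectors of a stabilizer group. -/
def meas (M W : Submodule (ZMod 2) (PVec Q)) : Submodule (ZMod 2) (PVec Q) := M ⊔ (W ⊓ perp M)

theorem meas_mono (M : Submodule (ZMod 2) (PVec Q)) {W W' : Submodule (ZMod 2) (PVec Q)}
    (h : W ≤ W') : meas M W ≤ meas M W' := sup_le_sup_left (inf_le_inf_right _ h) _

theorem le_meas (M W : Submodule (ZMod 2) (PVec Q)) : M ≤ meas M W := le_sup_left

theorem mem_meas {M W : Submodule (ZMod 2) (PVec Q)} {u : PVec Q} (h : u ∈ W) (h' : u ∈ perp M) :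
    u ∈ meas M W := Submodule.mem_sup_right ⟨h, h'⟩

theorem meas_isotropic {M W : Submodule (ZMod 2) (PVec Q)} (hM : M ≤ perp M) (hW : W ≤ perp W) :
    meas M W ≤ perp (meas M W) := by
  rw [meas, perp_sup, perp_inf, perp_perp]
  refine sup_le (le_inf hM le_sup_right) (le_inf inf_le_right ?_)
  exact (inf_le_left.trans hW).trans le_sup_left

theorem perp_le_perp_meas {M W : Submodule (ZMod 2) (PVec Q)} {u : PVec Q} (hu : u ∈ perp W)
    (hM : u ∈ perp M) : u ∈ perp (meas M W) := by
  rw [meas, perp_sup, perp_inf]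
  exact ⟨hM, Submodule.mem_sup_left hu⟩

/-- This half of reversibility needs no hypothesis on the checks: what commutes with the new group
commutes with the checks and so survives. -/
theorem inf_perp_meas_le {M W : Submodule (ZMod 2) (PVec Q)} : W ⊓ perp (meas M W) ≤ meas M W :=
  fun _ h => mem_meas h.1 (perp_anti (le_meas M W) h.2)

/-- A new element is a check plus a surviving old element. If it commutes with the old isotropic
group, so does its check part, to which the hypothesis applies. -/
theorem meas_inf_perp_le {M W : Submodule (ZMod 2) (PVec Q)} (hW : W ≤ perp W)
    (h : M ⊓ perp W ≤ W) : meas M W ⊓ perp W ≤ W := by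
  rintro u ⟨h1, h2⟩
  obtain ⟨a, ha, b, hb, rfl⟩ := Submodule.mem_sup.1 h1
  have ha' : a ∈ perp W := by simpa using sub_mem h2 (hW hb.1)
  exact add_mem (h ⟨ha, ha'⟩) hb.1

/-- Both intersections are the same space I, and I^⊥ = W^⊥ + W'. Comparing its dimension computed
from I with that of the sum gives equality of the two ranks. -/
theorem finrank_le_of_reversible {W W' : Submodule (ZMod 2) (PVec Q)} (hW : W ≤ perp W)
    (hW' : W' ≤ perp W') (h1 : W ⊓ perp W' ≤ W') (h2 : W' ⊓ perp W ≤ W) :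
    Module.finrank (ZMod 2) W = Module.finrank (ZMod 2) W' := by
  have e : W ⊓ perp W' = W' ⊓ perp W :=
    le_antisymm (le_inf h1 (inf_le_left.trans hW)) (le_inf h2 (inf_le_left.trans hW'))
  have d1 := finrank_perp (W ⊓ perp W')
  have d2 := Submodule.finrank_sup_add_finrank_inf_eq (perp W) W'
  rw [perp_inf, perp_perp, e] at d1
  rw [inf_comm] at d2
  have d3 := finrank_perp W
  lia

/-- By duality, W^⊥ ≤ W + (W^⊥ ∩ W'^⊥) amounts to W^⊥ ∩ (W + W') ≤ W, which is the reversibility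
hypothesis together with isotropy of W. -/
theorem exists_shared {W W' : Submodule (ZMod 2) (PVec Q)} (hW : W ≤ perp W)
    (h2 : W' ⊓ perp W ≤ W) {u : PVec Q} (hu : u ∈ perp W) : ∃ w ∈ W, w + u ∈ perp W' := by
  have : perp W ≤ W ⊔ (perp W ⊓ perp W') := by
    rw [← perp_perp (W ⊔ (perp W ⊓ perp W'))]
    refine perp_anti ?_
    rw [perp_sup, perp_inf, perp_perp, perp_perp]
    rintro x ⟨hx1, hx2⟩
    obtain ⟨a, ha, b, hb, rfl⟩ := Submodule.mem_sup.1 hx2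
    have hb' : b ∈ perp W := by simpa using sub_mem hx1 (hW ha)
    exact add_mem ha (h2 ⟨hb, hb'⟩)
  obtain ⟨w, hw, x, hx, rfl⟩ := Submodule.mem_sup.1 (this hu)
  exact ⟨w, hw, by rw [← add_assoc, PVec.add_self, zero_add]; exact hx.2⟩

/-! ## The vectors of a stabilizer group -/

/-- The vectors of the elements of a subgroup of the Pauli group. -/
def vecs (S : Subgroup (Pauli Q)) : Submodule (ZMod 2) (PVec Q) where
  carrier := {u | ∃ P ∈ S, P.vec = u}
  zero_mem' := ⟨1, S.one_mem, rfl⟩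
  add_mem' := by
    rintro _ _ ⟨P, hP, rfl⟩ ⟨R, hR, rfl⟩
    exact ⟨P * R, S.mul_mem hP hR, rfl⟩
  smul_mem' := by
    rintro a _ ⟨P, hP, rfl⟩
    have : a = 0 ∨ a = 1 := by revert a; decide
    rcases this with rfl | rfl
    · exact ⟨1, S.one_mem, by simp⟩
    · exact ⟨P, hP, by simp⟩

theorem vec_mem_vecs {S : Subgroup (Pauli Q)} {P : Pauli Q} (h : P ∈ S) : P.vec ∈ vecs S :=
  ⟨P, h, rfl⟩

theorem vecs_mono {S S' : Subgroup (Pauli Q)} (h : S ≤ S') : vecs S ≤ vecs S' := by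
  rintro _ ⟨P, hP, rfl⟩
  exact ⟨P, h hP, rfl⟩

theorem vecs_closure (s : Set (Pauli Q)) :
    vecs (Subgroup.closure s) = Submodule.span (ZMod 2) (Pauli.vec '' s) := by
  apply le_antisymm
  · rintro _ ⟨P, hP, rfl⟩
    induction hP using Subgroup.closure_induction with
    | mem x hx => exact Submodule.subset_span ⟨x, hx, rfl⟩
    | one => exact zero_mem _
    | mul x y _ _ hx hy => exact add_mem hx hy
    | inv x _ hx => exact hx
  · rw [Submodule.span_le]
    rintro _ ⟨P, hP, rfl⟩
    exact vec_mem_vecs (Subgroup.subset_closure hP)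

theorem mem_phases_iff {P : Pauli Q} : P ∈ Pauli.phases Q ↔ P.vec = 0 :=
  (Prod.ext_iff (x := P.vec) (y := 0)).symm

theorem mem_withPhases {S : Subgroup (Pauli Q)} {P : Pauli Q} :
    P ∈ withPhases S ↔ P.vec ∈ vecs S := by
  constructor
  · intro h
    have hle : withPhases S ≤ (vecs S).toAddSubgroup.toSubgroup.comap
        (MonoidHom.mk' (fun P : Pauli Q => Multiplicative.ofAdd P.vec) fun _ _ => rfl) := by
      refine sup_le (fun P hP => vec_mem_vecs hP) fun P hP => ?_
      change P.vec ∈ vecs S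
      rw [mem_phases_iff.1 hP]
      exact zero_mem _
    exact hle h
  · rintro ⟨R, hR, e⟩
    have h : R⁻¹ * P ∈ Pauli.phases Q := by
      rw [mem_phases_iff]
      simp [e, PVec.add_self]
    rw [← mul_inv_cancel_left R P]
    exact mul_mem (Subgroup.mem_sup_left hR) (Subgroup.mem_sup_right h)

theorem withPhases_eq_iff {S S' : Subgroup (Pauli Q)} :
    withPhases S = withPhases S' ↔ vecs S = vecs S' := by
  constructor
  · intro h
    ext u
    rw [← Pauli.vec_ofVec u, ← mem_withPhases, ← mem_withPhases, h]
  · intro h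
    ext P
    rw [mem_withPhases, mem_withPhases, h]

theorem vecs_withPhases (S : Subgroup (Pauli Q)) : vecs (withPhases S) = vecs S := by
  apply le_antisymm
  · rintro _ ⟨P, hP, rfl⟩
    exact mem_withPhases.1 hP
  · exact vecs_mono le_sup_left

theorem mem_commutant {S : Subgroup (Pauli Q)} {P : Pauli Q} :
    P ∈ commutant S ↔ P.vec ∈ perp (vecs S) := by
  rw [Subgroup.mem_centralizer_iff, mem_perp]
  constructor
  · rintro h _ ⟨R, hR, rfl⟩
    exact (Pauli.commute_iff R P).1 (h R hR)
  · intro h R hR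
    exact (Pauli.commute_iff R P).2 (h _ (vec_mem_vecs hR))

theorem forall_commute_iff {s : Set (Pauli Q)} {P : Pauli Q} :
    (∀ R ∈ s, Commute P R) ↔ P.vec ∈ perp (Submodule.span (ZMod 2) (Pauli.vec '' s)) := by
  rw [perp_span_iff]
  simp only [Set.forall_mem_image, Pauli.commute_iff, symp_comm P.vec]

/-- Outcomes change only the signs of the generators, so the vectors evolve deterministically. -/
theorem vecs_measure (M : Set (Pauli Q)) (o : Pauli Q → Bool) (S : Subgroup (Pauli Q)) :
    vecs (measure M o S) = meas (Submodule.span (ZMod 2) (Pauli.vec '' M)) (vecs S) := by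
  rw [measure, vecs_closure, Set.image_union, Submodule.span_union, meas]
  congr 1
  · congr 1
    ext u
    constructor
    · rintro ⟨_, ⟨P, hP, rfl⟩, rfl⟩
      refine ⟨P, hP, ?_⟩
      dsimp only
      split_ifs <;> simp
    · rintro ⟨P, hP, rfl⟩
      refine ⟨_, ⟨P, hP, rfl⟩, ?_⟩
      dsimp only
      split_ifs <;> simp
  · apply le_antisymm
    · rw [Submodule.span_le]
      rintro _ ⟨P, ⟨hP, hc⟩, rfl⟩
      exact ⟨vec_mem_vecs hP, forall_commute_iff.1 hc⟩
    · rintro _ ⟨⟨P, hP, rfl⟩, hc⟩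
      exact Submodule.subset_span ⟨P, ⟨hP, forall_commute_iff.2 hc⟩, rfl⟩

theorem vecs_bot : vecs (⊥ : Subgroup (Pauli Q)) = ⊥ := by
  rw [eq_bot_iff]
  rintro _ ⟨P, hP, rfl⟩
  rw [Subgroup.mem_bot.1 hP]
  exact zero_mem _

/-! ## Stabilizer groups without `-1` -/

/-- A phase in the group is ruled out unless it is 1, since the squares of i and -i are -1. -/
theorem eq_one_of_vec_eq_zero {S : Subgroup (Pauli Q)} (h : Pauli.neg ∉ S) {P : Pauli Q}
    (hP : P ∈ S) (h0 : P.vec = 0) : P = 1 := by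
  obtain ⟨k, x, z⟩ := P
  obtain ⟨rfl, rfl⟩ := Prod.ext_iff.1 h0
  have hsq : (⟨k, 0, 0⟩ : Pauli Q) * ⟨k, 0, 0⟩ = ⟨k + k, 0, 0⟩ := by
    simp [Pauli.mul_def]
  have hk4 : ∀ k : ZMod 4, k = 0 ∨ k = 2 ∨ k + k = 2 := by decide
  have hk := hk4 k
  rcases hk with rfl | rfl | hk
  · rfl
  · exact absurd hP h
  · refine absurd ?_ h
    have := mul_mem hP hP
    change (⟨k, 0, 0⟩ : Pauli Q) * ⟨k, 0, 0⟩ ∈ S at this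
    rw [hsq, hk] at this
    exact this

theorem eq_of_vec_eq {S : Subgroup (Pauli Q)} (h : Pauli.neg ∉ S) {P R : Pauli Q}
    (hP : P ∈ S) (hR : R ∈ S) (e : P.vec = R.vec) : P = R := by
  have := eq_one_of_vec_eq_zero h (mul_mem hP (inv_mem hR)) (by simp [e, PVec.add_self])
  exact mul_inv_eq_one.1 this

/-- Over F₂ scalar multiplication adds nothing to addition, so generating sets of the group are
spanning sets of the space. -/
theorem rank_multiplicative_eq_finrank (W : Type*) [AddCommGroup W] [Module (ZMod 2) W] [Finite W] :
    Group.rank (Multiplicative W) = Module.finrank (ZMod 2) W := by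
  classical
  apply le_antisymm
  · obtain b := Module.finBasis (ZMod 2) W
    let s : Finset (Multiplicative W) := Finset.univ.image fun i => Multiplicative.ofAdd (b i)
    have hs : Subgroup.closure (s : Set (Multiplicative W)) = ⊤ := by
      rw [eq_top_iff]
      have h1 : Submodule.span (ZMod 2) (Set.range b) ≤ AddSubgroup.toZModSubmodule 2
          (AddSubgroup.toSubgroup.symm (Subgroup.closure (s : Set (Multiplicative W)))) := by
        rw [Submodule.span_le]
        rintro _ ⟨i, rfl⟩
        have hi : Multiplicative.ofAdd (b i) ∈ Subgroup.closure (s : Set (Multiplicative W)) :=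
          Subgroup.subset_closure
            (Finset.mem_image_of_mem (fun i => Multiplicative.ofAdd (b i)) (Finset.mem_univ i))
        exact hi
      rw [b.span_eq] at h1
      intro w _
      exact h1 (Submodule.mem_top : Multiplicative.toAdd w ∈ _)
    calc _ ≤ s.card := Group.rank_le hs
      _ ≤ (Finset.univ : Finset (Fin (Module.finrank (ZMod 2) W))).card := Finset.card_image_le
      _ = _ := by simp
  · obtain ⟨s, hs, hc⟩ := Group.rank_spec (Multiplicative W)
    rw [← hs]
    have h1 : Submodule.span (ZMod 2) ((s.image Multiplicative.toAdd : Finset W) : Set W) = ⊤ := by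
      rw [eq_top_iff]
      have h2 : Subgroup.closure (s : Set (Multiplicative W)) ≤ AddSubgroup.toSubgroup
          ((Submodule.span (ZMod 2)
            ((s.image Multiplicative.toAdd : Finset W) : Set W)).toAddSubgroup : AddSubgroup W) := by
        rw [Subgroup.closure_le]
        intro w hw
        have hi : Multiplicative.toAdd w ∈ Submodule.span (ZMod 2)
            ((s.image Multiplicative.toAdd : Finset W) : Set W) :=
          Submodule.subset_span (Finset.mem_image_of_mem Multiplicative.toAdd hw)
        exact hi
      rw [hc] at h2
      intro w _
      exact h2 (Subgroup.mem_top (Multiplicative.ofAdd w))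
    have h3 := finrank_span_finset_le_card (R := ZMod 2) (s.image Multiplicative.toAdd)
    rw [Set.finrank, h1, finrank_top] at h3
    exact h3.trans Finset.card_image_le

theorem rank_eq_finrank_vecs {S : Subgroup (Pauli Q)} (h : Pauli.neg ∉ S) :
    Group.rank S = Module.finrank (ZMod 2) (vecs S) := by
  rw [← rank_multiplicative_eq_finrank (vecs S)]
  refine Group.rank_congr (MulEquiv.ofBijective (MonoidHom.mk'
    (fun P : S => Multiplicative.ofAdd (⟨P.1.vec, vec_mem_vecs P.2⟩ : vecs S))
    fun _ _ => rfl) ⟨?_, ?_⟩)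
  · intro P R e
    have e' : P.1.vec = R.1.vec := congrArg Subtype.val e
    exact Subtype.ext (eq_of_vec_eq h P.2 R.2 e')
  · rintro ⟨_, P, hP, rfl⟩
    exact ⟨⟨P, hP⟩, rfl⟩

theorem isReversiblePair_measure {M : Set (Pauli Q)} {o : Pauli Q → Bool} {S : Subgroup (Pauli Q)}
    (h : Pauli.neg ∉ measure M o S)
    (hM : Submodule.span (ZMod 2) (Pauli.vec '' M) ≤ perp (Submodule.span (ZMod 2) (Pauli.vec '' M)))
    (hS : vecs S ≤ perp (vecs S))
    (hrev : Submodule.span (ZMod 2) (Pauli.vec '' M) ⊓ perp (vecs S) ≤ vecs S) :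
    IsReversiblePair S (measure M o S) := by
  have hiso := meas_isotropic hM hS
  have hk : ∀ s ∈ S, s.vec ∈ perp (vecs (measure M o S)) → s ∈ measure M o S := by
    intro s hs hc
    refine Subgroup.subset_closure (Or.inr ⟨hs, ?_⟩)
    rw [forall_commute_iff]
    rw [vecs_measure] at hc
    exact perp_anti (le_meas _ _) hc
  constructor
  · intro s hs hc
    refine hk s hs (mem_commutant.1 ?_)
    exact Subgroup.mem_centralizer_iff.2 fun r hr => (hc r hr).symm
  · intro s' hs' hc
    have h1 : s'.vec ∈ perp (vecs S) := mem_commutant.1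
      (Subgroup.mem_centralizer_iff.2 fun r hr => (hc r hr).eq)
    have h2 := vec_mem_vecs hs'
    -- The vector argument only provides an element of `S` equal to `s'` up to a phase. That element
    -- survives the measurement, and absence of -1 in the new group removes the phase.
    obtain ⟨s, hs, e⟩ := meas_inf_perp_le hS hrev ⟨by rwa [vecs_measure] at h2, h1⟩
    have h3 : s ∈ measure M o S := by
      refine hk s hs ?_
      rw [e]
      rw [vecs_measure] at h2 ⊢
      exact hiso h2
    rw [← eq_of_vec_eq h h3 hs' e]
    exact hs

end Symplectic

/-! ## Transfers of logical operators -/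

section Transfer

variable {Q : Type*} [Fintype Q]

theorem exists_represents {S : Subgroup (Pauli Q)} (a : Logical S) : ∃ P, Represents S P a := by
  obtain ⟨P, rfl⟩ := QuotientGroup.mk_surjective a
  exact ⟨P.1, P.2, rfl⟩

theorem Represents.eq {S : Subgroup (Pauli Q)} {P : Pauli Q} {a b : Logical S}
    (ha : Represents S P a) (hb : Represents S P b) : a = b := by
  obtain ⟨_, rfl⟩ := ha
  obtain ⟨_, rfl⟩ := hb
  rfl

theorem Represents.inv_mul_mem {S : Subgroup (Pauli Q)} {P R : Pauli Q} {a : Logical S}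
    (hP : Represents S P a) (hR : Represents S R a) : P⁻¹ * R ∈ S := by
  obtain ⟨_, rfl⟩ := hP
  obtain ⟨_, h⟩ := hR
  exact (QuotientGroup.eq.1 h.symm :)

theorem Represents.commute_iff {S : Subgroup (Pauli Q)} {P P' R : Pauli Q} {a : Logical S}
    (hP : Represents S P a) (hP' : Represents S P' a) (hR : R ∈ commutant S) :
    Commute P R ↔ Commute P' R := by
  have h : Commute (P⁻¹ * P') R := Subgroup.mem_centralizer_iff.1 hR _ (hP.inv_mul_mem hP')
  constructor
  · intro h1
    simpa using h1.mul_left h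
  · intro h1
    simpa using h1.mul_left h.inv_left

/-- The operators commuting with both groups map onto both logical groups, by `h1` and `h2`.
Reversibility says that these two maps have the same kernel, so the quotients agree. -/
theorem exists_isTransfer {S S' : Subgroup (Pauli Q)} (hS : S ≤ commutant S)
    (hS' : S' ≤ commutant S') (hrev : IsReversiblePair S S')
    (h1 : ∀ P ∈ commutant S, ∃ s ∈ S, s * P ∈ commutant S')
    (h2 : ∀ P ∈ commutant S', ∃ s ∈ S', s * P ∈ commutant S) :
    ∃ m : Logical S ≃* Logical S', IsTransfer m := by
  let f : ↥(commutant S ⊓ commutant S') →* Logical S :=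
    (QuotientGroup.mk' _).comp (Subgroup.inclusion inf_le_left)
  let f' : ↥(commutant S ⊓ commutant S') →* Logical S' :=
    (QuotientGroup.mk' _).comp (Subgroup.inclusion inf_le_right)
  have key : ∀ {S S' : Subgroup (Pauli Q)}, S ≤ commutant S → ∀ P (hP : P ∈ commutant S)
      (s : Pauli Q), s ∈ S → s * P ∈ commutant S' → ∃ h : s * P ∈ commutant S,
      (QuotientGroup.mk (⟨s * P, h⟩ : commutant S) : Logical S) = QuotientGroup.mk ⟨P, hP⟩ := by
    intro S S' hS P hP s hs _
    refine ⟨mul_mem (hS hs) hP, QuotientGroup.eq.2 ?_⟩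
    have hc : s * P = P * s := Subgroup.mem_centralizer_iff.1 hP s hs
    change (s * P)⁻¹ * P ∈ S
    rw [hc]
    simpa using hs
  have hf : Function.Surjective f := by
    intro a
    obtain ⟨⟨P, hP⟩, rfl⟩ := QuotientGroup.mk_surjective a
    obtain ⟨s, hs, hc⟩ := h1 P hP
    obtain ⟨h, e⟩ := key hS P hP s hs hc
    exact ⟨⟨s * P, h, hc⟩, e⟩
  have hf' : Function.Surjective f' := by
    intro a
    obtain ⟨⟨P, hP⟩, rfl⟩ := QuotientGroup.mk_surjective a
    obtain ⟨s, hs, hc⟩ := h2 P hP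
    obtain ⟨h, e⟩ := key hS' P hP s hs hc
    exact ⟨⟨s * P, hc, h⟩, e⟩
  have hker : f.ker = f'.ker := by
    ext P
    have e1 : P ∈ f.ker ↔ P.1 ∈ S := QuotientGroup.eq_one_iff _
    have e2 : P ∈ f'.ker ↔ P.1 ∈ S' := QuotientGroup.eq_one_iff _
    rw [e1, e2]
    exact ⟨fun h => hrev.1 _ h fun s hs => (Subgroup.mem_centralizer_iff.1 P.2.2 s hs).symm,
      fun h => hrev.2 _ h fun s hs => Subgroup.mem_centralizer_iff.1 P.2.1 s hs⟩
  let m : Logical S ≃* Logical S' := (QuotientGroup.quotientKerEquivOfSurjective f hf).symm.trans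
    ((QuotientGroup.quotientMulEquivOfEq hker).trans
      (QuotientGroup.quotientKerEquivOfSurjective f' hf'))
  have hm : ∀ P, m (f P) = f' P := by
    intro P
    have : (QuotientGroup.quotientKerEquivOfSurjective f hf).symm (f P) = QuotientGroup.mk P := by
      rw [MulEquiv.symm_apply_eq]
      rfl
    simp only [m, MulEquiv.trans_apply, this]
    rfl
  refine ⟨m, fun a => ?_, ?_⟩
  · obtain ⟨P, rfl⟩ := hf a
    exact ⟨P.1, ⟨P.2.1, rfl⟩, P.2.2⟩
  · rintro a P ⟨hP, rfl⟩ hc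
    exact ⟨hc, (hm ⟨P, hP, hc⟩).symm⟩

theorem exists_isTransfer_of_vecs {S S' : Subgroup (Pauli Q)} (hS : vecs S ≤ perp (vecs S))
    (hS' : vecs S' ≤ perp (vecs S')) (h1 : vecs S ⊓ perp (vecs S') ≤ vecs S')
    (h2 : vecs S' ⊓ perp (vecs S) ≤ vecs S) (hrev : IsReversiblePair S S') :
    ∃ m : Logical S ≃* Logical S', IsTransfer m := by
  refine exists_isTransfer (fun P hP => mem_commutant.2 (hS (vec_mem_vecs hP)))
    (fun P hP => mem_commutant.2 (hS' (vec_mem_vecs hP))) hrev ?_ ?_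
  · intro P hP
    obtain ⟨_, ⟨s, hs, rfl⟩, h⟩ := exists_shared hS h2 (mem_commutant.1 hP)
    exact ⟨s, hs, mem_commutant.2 h⟩
  · intro P hP
    obtain ⟨_, ⟨s, hs, rfl⟩, h⟩ := exists_shared hS' h1 (mem_commutant.1 hP)
    exact ⟨s, hs, mem_commutant.2 h⟩

theorem exists_isTransfer_withPhases {S S' : Subgroup (Pauli Q)} (hS : vecs S ≤ perp (vecs S))
    (hS' : vecs S' ≤ perp (vecs S')) (h1 : vecs S ⊓ perp (vecs S') ≤ vecs S')
    (h2 : vecs S' ⊓ perp (vecs S) ≤ vecs S) :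
    ∃ m : Logical (withPhases S) ≃* Logical (withPhases S'), IsTransfer m := by
  have e : ∀ {S S' : Subgroup (Pauli Q)}, vecs S ⊓ perp (vecs S') ≤ vecs S' →
      ∀ s ∈ withPhases S, s ∈ commutant (withPhases S') → s ∈ withPhases S' := by
    intro S S' h s hs hc
    rw [mem_commutant, vecs_withPhases] at hc
    exact mem_withPhases.2 (h ⟨mem_withPhases.1 hs, hc⟩)
  apply exists_isTransfer_of_vecs <;> try simp only [vecs_withPhases]
  · exact hS
  · exact hS'
  · exact h1
  · exact h2
  · exact ⟨fun s hs hc => e h1 s hs (Subgroup.mem_centralizer_iff.2 fun r hr => (hc r hr).symm.eq),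
      fun s hs hc => e h2 s hs (Subgroup.mem_centralizer_iff.2 fun r hr => (hc r hr).eq)⟩

theorem represents_withPhases_of_add_mem {S : Subgroup (Pauli Q)} (hS : vecs S ≤ perp (vecs S))
    {P P' : Pauli Q} {a : Logical (withPhases S)} (h : Represents (withPhases S) P a)
    (hadd : P.vec + P'.vec ∈ vecs S) : Represents (withPhases S) P' a := by
  obtain ⟨hP, rfl⟩ := h
  have hP' : P' ∈ commutant (withPhases S) := by
    rw [mem_commutant, vecs_withPhases] at hP ⊢
    have := add_mem hP (hS hadd)
    rwa [← add_assoc, PVec.add_self, zero_add] at this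
  refine ⟨hP', (QuotientGroup.eq.2 ?_).symm⟩
  exact mem_withPhases.2 hadd

/-- Following a class of logical operators through a transfer, along representatives that are
given as binary vectors. -/
theorem IsTransfer.represents {S S' : Subgroup (Pauli Q)} (hS : vecs S ≤ perp (vecs S))
    {m : Logical (withPhases S) ≃* Logical (withPhases S')} (hm : IsTransfer m) {P P' : Pauli Q}
    {a : Logical (withPhases S)} (h : Represents (withPhases S) P a)
    (hadd : P.vec + P'.vec ∈ vecs S) (hP' : P'.vec ∈ perp (vecs S')) :
    Represents (withPhases S') P' (m a) := by
  refine hm.2 a P' (represents_withPhases_of_add_mem hS h hadd) ?_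
  rw [mem_commutant, vecs_withPhases]
  exact hP'

/-- Commutation depends only on logical classes, so it can be tested on representatives shared by
both groups. -/
theorem IsTransfer.commute_iff {S S' : Subgroup (Pauli Q)} {m : Logical S ≃* Logical S'}
    (hm : IsTransfer m) {a b : Logical S} {P R P' R' : Pauli Q} (hP : Represents S P a)
    (hR : Represents S R b) (hP' : Represents S' P' (m a)) (hR' : Represents S' R' (m b)) :
    Commute P' R' ↔ Commute P R := by
  obtain ⟨P₁, h1, h1'⟩ := hm.1 a
  obtain ⟨R₁, h2, h2'⟩ := hm.1 b
  have h3 := hm.2 a P₁ h1 h1'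
  have h4 := hm.2 b R₁ h2 h2'
  rw [hP'.commute_iff h3 hR'.1, Commute.symm_iff, hR'.commute_iff h4 h3.1,
    hP.commute_iff h1 hR.1, Commute.symm_iff (a := P₁), hR.commute_iff h2 h1.1]

theorem identify_represents {S S' : Subgroup (Pauli Q)} (h : S = S') {P : Pauli Q}
    {a : Logical S} (ha : Represents S P a) : Represents S' P (identify h a) := by
  subst h
  exact ha

theorem represents_of_identify {S S' : Subgroup (Pauli Q)} (h : S = S') {P : Pauli Q}
    {a : Logical S} (ha : Represents S' P (identify h a)) : Represents S P a := by
  subst h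
  exact ha

/-- Shared representatives determine a transfer; this uniqueness is what makes period maps at
different times comparable. -/
theorem IsTransfer.eq {S S' : Subgroup (Pauli Q)} {m m' : Logical S ≃* Logical S'}
    (hm : IsTransfer m) (hm' : IsTransfer m') : m = m' := by
  ext a
  obtain ⟨P, h, h'⟩ := hm.1 a
  exact (hm.2 a P h h').eq (hm'.2 a P h h')

theorem IsTransfer.identify_apply {S₁ S₁' S₂ S₂' : Subgroup (Pauli Q)} (h : S₁ = S₂)
    (h' : S₁' = S₂') {m₁ : Logical S₁ ≃* Logical S₁'} {m₂ : Logical S₂ ≃* Logical S₂'}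
    (hm₁ : IsTransfer m₁) (hm₂ : IsTransfer m₂) (a : Logical S₁) :
    identify h' (m₁ a) = m₂ (identify h a) := by
  subst h
  subst h'
  rw [hm₁.eq hm₂]
  rfl

/-! ### Composites of transfers over a period -/

variable {K : ℕ → Subgroup (Pauli Q)} {m : ∀ t, Logical (K t) ≃* Logical (K (t + 1))}

theorem evolve_commute_iff (hm : ∀ t, IsTransfer (m t)) (s t : ℕ) {a b : Logical (K t)}
    {P R P' R' : Pauli Q} (hP : Represents (K t) P a) (hR : Represents (K t) R b)
    (hP' : Represents (K (t + s)) P' (evolve m s t a))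
    (hR' : Represents (K (t + s)) R' (evolve m s t b)) : Commute P' R' ↔ Commute P R := by
  induction s generalizing P' R' with
  | zero =>
    have hP'' : Represents (K t) P' a := hP'
    have hR'' : Represents (K t) R' b := hR'
    rw [hP''.commute_iff hP hR''.1, Commute.symm_iff, hR''.commute_iff hR hP.1, Commute.symm_iff]
  | succ s ih =>
    obtain ⟨P₁, h1⟩ := exists_represents (evolve m s t a)
    obtain ⟨R₁, h2⟩ := exists_represents (evolve m s t b)
    rw [← ih h1 h2]
    exact (hm (t + s)).commute_iff h1 h2 hP' hR'

theorem periodAut_commute_iff (hm : ∀ t, IsTransfer (m t)) {p : ℕ} (h : ∀ t, K (t + p) = K t)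
    (t : ℕ) {a b : Logical (K t)} {P R P' R' : Pauli Q} (hP : Represents (K t) P a)
    (hR : Represents (K t) R b) (hP' : Represents (K t) P' (periodAut m p h t a))
    (hR' : Represents (K t) R' (periodAut m p h t b)) : Commute P' R' ↔ Commute P R :=
  evolve_commute_iff hm p t hP hR (represents_of_identify (h t) hP')
    (represents_of_identify (h t) hR')

theorem represents_periodAut_three (h : ∀ t, K (t + 3) = K t) {t : ℕ} {a : Logical (K t)}
    {P : Pauli Q} (hP : Represents (K (t + 3)) P (m (t + 2) (m (t + 1) (m t a)))) :
    Represents (K t) P (periodAut m 3 h t a) :=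
  identify_represents (h t) hP

theorem represents_periodAut_six (h : ∀ t, K (t + 6) = K t) {t : ℕ} {a : Logical (K t)}
    {P : Pauli Q} (hP : Represents (K (t + 6)) P
      (m (t + 5) (m (t + 4) (m (t + 3) (m (t + 2) (m (t + 1) (m t a))))))) :
    Represents (K t) P (periodAut m 6 h t a) :=
  identify_represents (h t) hP

/-- Both sides are composites of four consecutive transfers; the transfers at times t and t + 3 join
equal groups and are therefore the same. Thus period maps at neighbouring times are conjugate. -/
theorem periodAut_three_succ (hm : ∀ t, IsTransfer (m t)) (h : ∀ t, K (t + 3) = K t) (t : ℕ)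
    (a : Logical (K t)) : periodAut m 3 h (t + 1) (m t a) = m t (periodAut m 3 h t a) :=
  (hm (t + 3)).identify_apply (h t) (h (t + 1)) (hm t) (m (t + 2) (m (t + 1) (m t a)))

theorem periodAut_six_succ (hm : ∀ t, IsTransfer (m t)) (h : ∀ t, K (t + 6) = K t) (t : ℕ)
    (a : Logical (K t)) : periodAut m 6 h (t + 1) (m t a) = m t (periodAut m 6 h t a) :=
  (hm (t + 6)).identify_apply (h t) (h (t + 1)) (hm t)
    (m (t + 5) (m (t + 4) (m (t + 3) (m (t + 2) (m (t + 1) (m t a))))))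

theorem periodAut_three_pow (hm : ∀ t, IsTransfer (m t)) (h : ∀ t, K (t + 3) = K t) (t k : ℕ)
    (a : Logical (K t)) :
    (periodAut m 3 h (t + 1) ^ k) (m t a) = m t ((periodAut m 3 h t ^ k) a) := by
  induction k generalizing a with
  | zero => rfl
  | succ k ih => rw [pow_succ, pow_succ, MulAut.mul_apply, MulAut.mul_apply,
      periodAut_three_succ hm, ih]

theorem orderOf_periodAut_three (hm : ∀ t, IsTransfer (m t)) (h : ∀ t, K (t + 3) = K t) (t : ℕ) :
    orderOf (periodAut m 3 h t) = orderOf (periodAut m 3 h 0) := by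
  induction t with
  | zero => rfl
  | succ t ih =>
    rw [← ih]
    refine orderOf_eq_orderOf_iff.2 fun k => ?_
    rw [MulEquiv.ext_iff, MulEquiv.ext_iff]
    constructor
    · intro hk a
      apply (m t).injective
      rw [← periodAut_three_pow hm, hk]
      rfl
    · intro hk b
      obtain ⟨a, rfl⟩ := (m t).surjective b
      rw [periodAut_three_pow hm, hk]
      rfl

theorem periodAut_six_eq_one (hm : ∀ t, IsTransfer (m t)) (h : ∀ t, K (t + 6) = K t)
    (h0 : periodAut m 6 h 0 = 1) (t : ℕ) : periodAut m 6 h t = 1 := by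
  induction t with
  | zero => exact h0
  | succ t ih =>
    ext b
    obtain ⟨a, rfl⟩ := (m t).surjective b
    rw [periodAut_six_succ hm, ih]
    rfl

/-! ## Logical groups as spaces of binary vectors -/

/-- The binary vectors of logical operators modulo those of stabilizers. -/
abbrev LogicalVec (W : Submodule (ZMod 2) (PVec Q)) : Type _ :=
  perp W ⧸ W.submoduleOf (perp W)

theorem exists_logicalEquiv {S : Subgroup (Pauli Q)} {W : Submodule (ZMod 2) (PVec Q)}
    (h : vecs S = W) : ∃ e : LogicalVec W ≃+ Additive (Logical (withPhases S)),
      ∀ (P : Pauli Q) (hP : P.vec ∈ perp W),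
        Represents (withPhases S) P (e (Submodule.Quotient.mk ⟨P.vec, hP⟩)).toMul := by
  subst h
  have hc : ∀ {P}, P ∈ commutant (withPhases S) ↔ P.vec ∈ perp (vecs S) := by
    intro P
    rw [mem_commutant, vecs_withPhases]
  let f : commutant (withPhases S) →* Multiplicative (LogicalVec (vecs S)) := MonoidHom.mk'
    (fun P => Multiplicative.ofAdd (Submodule.Quotient.mk ⟨P.1.vec, hc.1 P.2⟩)) fun _ _ => rfl
  have hf : Function.Surjective f := by
    intro a
    obtain ⟨⟨u, hu⟩, e⟩ := Submodule.Quotient.mk_surjective _ (Multiplicative.toAdd a)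
    exact ⟨⟨Pauli.ofVec u, hc.2 hu⟩, e⟩
  have hker : f.ker = (withPhases S).subgroupOf (commutant (withPhases S)) := by
    ext P
    rw [Subgroup.mem_subgroupOf, mem_withPhases]
    exact Submodule.Quotient.mk_eq_zero _
  let e : Multiplicative (LogicalVec (vecs S)) ≃* Logical (withPhases S) :=
    (QuotientGroup.quotientKerEquivOfSurjective f hf).symm.trans
      (QuotientGroup.quotientMulEquivOfEq hker)
  refine ⟨MulEquiv.toAdditiveRight e, fun P hP => ⟨hc.2 hP, ?_⟩⟩
  have : (QuotientGroup.quotientKerEquivOfSurjective f hf).symm (f ⟨P, hc.2 hP⟩) =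
      QuotientGroup.mk ⟨P, hc.2 hP⟩ := by
    rw [MulEquiv.symm_apply_eq]
    rfl
  change _ = QuotientGroup.quotientMulEquivOfEq hker
    ((QuotientGroup.quotientKerEquivOfSurjective f hf).symm (f ⟨P, hc.2 hP⟩))
  rw [this]
  rfl

end Transfer

/-! ## Binary functions and Pauli labels -/

/-- The standard bilinear form on binary functions. -/
def dotForm (ι : Type*) [Fintype ι] : LinearMap.BilinForm (ZMod 2) (ι → ZMod 2) :=
  dotProductBilin (ZMod 2) (ZMod 2)

section Dot

variable {ι : Type*} [Fintype ι]

theorem dotForm_apply (f g : ι → ZMod 2) : dotForm ι f g = f ⬝ᵥ g := rfl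

theorem dotForm_isRefl : (dotForm ι).IsRefl := fun f g h => by
  rw [dotForm_apply] at h ⊢
  rw [dotProduct_comm, h]

theorem dotForm_nondegenerate : (dotForm ι).Nondegenerate := by
  classical
  refine (LinearMap.IsRefl.nondegenerate_iff_separatingLeft dotForm_isRefl).2 fun f hf => ?_
  ext q
  simpa [dotForm_apply] using hf (Pi.single q 1)

/-- The functions orthogonal to `I`. -/
abbrev dotPerp (I : Submodule (ZMod 2) (ι → ZMod 2)) : Submodule (ZMod 2) (ι → ZMod 2) :=
  (dotForm ι).orthogonal I

theorem mem_dotPerp {I : Submodule (ZMod 2) (ι → ZMod 2)} {f : ι → ZMod 2} :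
    f ∈ dotPerp I ↔ ∀ g ∈ I, g ⬝ᵥ f = 0 := Iff.rfl

theorem dotPerp_dotPerp (I : Submodule (ZMod 2) (ι → ZMod 2)) : dotPerp (dotPerp I) = I :=
  LinearMap.BilinForm.orthogonal_orthogonal dotForm_nondegenerate dotForm_isRefl I

theorem dotPerp_anti {I J : Submodule (ZMod 2) (ι → ZMod 2)} (h : I ≤ J) :
    dotPerp J ≤ dotPerp I := LinearMap.BilinForm.orthogonal_le h

theorem indicator_pair_dotProduct {a b : ι} (h : a ≠ b) (f : ι → ZMod 2) :
    ({a, b} : Set ι).indicator 1 ⬝ᵥ f = f a + f b := by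
  classical
  have : ({a, b} : Set ι).indicator (1 : ι → ZMod 2) = Pi.single a 1 + Pi.single b 1 := by
    funext q
    by_cases h1 : q = a
    · subst h1; simp [h]
    · by_cases h2 : q = b
      · subst h2; simp [h1]
      · simp [h1, h2]
  rw [this, add_dotProduct]
  simp

theorem finrank_self_dotPerp {I : Submodule (ZMod 2) (ι → ZMod 2)} (h : dotPerp I = I) :
    2 * Module.finrank (ZMod 2) I = Fintype.card ι := by
  have h1 := LinearMap.BilinForm.finrank_orthogonal (dotForm_nondegenerate (ι := ι)) I
  rw [show (dotForm ι).orthogonal I = I from h, Module.finrank_fintype_fun_eq_card] at h1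
  have := Submodule.finrank_le I
  rw [Module.finrank_fintype_fun_eq_card] at this
  lia

end Dot

theorem finrank_map_add_finrank_inf_ker {E F : Type*} [AddCommGroup E] [Module (ZMod 2) E]
    [AddCommGroup F] [Module (ZMod 2) F] [FiniteDimensional (ZMod 2) E] (f : E →ₗ[ZMod 2] F)
    (I : Submodule (ZMod 2) E) : Module.finrank (ZMod 2) (I.map f) +
      Module.finrank (ZMod 2) ↥(I ⊓ LinearMap.ker f) = Module.finrank (ZMod 2) I := by
  rw [← LinearMap.finrank_range_add_finrank_ker (f.domRestrict I), LinearMap.range_domRestrict,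
    LinearMap.ker_domRestrict]
  congr 1
  rw [← Submodule.map_comap_subtype]
  exact (LinearEquiv.finrank_eq
    (Submodule.equivMapOfInjective I.subtype I.injective_subtype _)).symm

section Labels

variable {Q : Type*}

/-- The binary vector of the operator that acts with the Pauli matrix of the given label on the
qubits where `f` is `1`. -/
def labelVec : PauliLabel → (Q → ZMod 2) →ₗ[ZMod 2] PVec Q
  | .x => LinearMap.inl _ _ _
  | .y => LinearMap.inl _ _ _ + LinearMap.inr _ _ _
  | .z => LinearMap.inr _ _ _

theorem labelVec_x (f : Q → ZMod 2) : labelVec .x f = (f, 0) := rfl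

theorem labelVec_y (f : Q → ZMod 2) : labelVec .y f = (f, f) := by
  simp [labelVec]

theorem labelVec_z (f : Q → ZMod 2) : labelVec .z f = (0, f) := rfl

theorem vec_on (A : Set Q) (p : PauliLabel) : (Pauli.on A p).vec = labelVec p (A.indicator 1) := by
  cases p
  · rfl
  · rw [labelVec_y]; rfl
  · rfl

/-- Modulo phases the product of two different Pauli matrices is the third. This is how multiplying
by a check changes the label of an operator below. -/
theorem labelVec_add {p q r : PauliLabel} (hpq : p ≠ q) (hqr : q ≠ r) (hpr : p ≠ r)
    (f : Q → ZMod 2) : labelVec p f + labelVec q f = labelVec r f := by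
  have h2 : f + f = 0 := by ext q; exact CharTwo.add_self_eq_zero _
  cases p <;> cases q <;> cases r <;> first | contradiction | simp [labelVec_x, labelVec_y, labelVec_z, h2]

variable [Fintype Q]

theorem symp_labelVec_self (p : PauliLabel) (f g : Q → ZMod 2) :
    symp Q (labelVec p f) (labelVec p g) = 0 := by
  cases p <;> simp [symp_apply, labelVec_x, labelVec_y, labelVec_z, CharTwo.add_self_eq_zero]

theorem symp_labelVec {p q : PauliLabel} (h : p ≠ q) (f g : Q → ZMod 2) :
    symp Q (labelVec p f) (labelVec q g) = f ⬝ᵥ g := by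
  cases p <;> cases q <;> first | contradiction | simp [symp_apply, labelVec_x, labelVec_y, labelVec_z]

theorem map_labelVec_isotropic (p : PauliLabel) (I : Submodule (ZMod 2) (Q → ZMod 2)) :
    I.map (labelVec p) ≤ perp (I.map (labelVec p)) := by
  rintro _ ⟨f, _, rfl⟩ _ ⟨g, _, rfl⟩
  exact symp_labelVec_self p g f

theorem labelVec_mem_perp_map {p q : PauliLabel} (h : p ≠ q) {I : Submodule (ZMod 2) (Q → ZMod 2)}
    {f : Q → ZMod 2} : labelVec q f ∈ perp (I.map (labelVec p)) ↔ f ∈ dotPerp I := by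
  constructor
  · intro hf g hg
    rw [dotForm_apply, ← symp_labelVec h]
    exact hf _ ⟨g, hg, rfl⟩
  · rintro hf _ ⟨g, hg, rfl⟩
    rw [symp_labelVec h]
    exact hf g hg

theorem labelVec_mem_perp_map_self (p : PauliLabel) {I : Submodule (ZMod 2) (Q → ZMod 2)}
    {f : Q → ZMod 2} : labelVec p f ∈ perp (I.map (labelVec p)) := by
  rintro _ ⟨g, _, rfl⟩
  exact symp_labelVec_self p g f

end Labels

/-! ## Rotations of the colours -/

/-- A cyclic permutation of the three colours. -/
structure IsRotation (n : Color → Color) : Prop where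
  cube : ∀ c, n (n (n c)) = c
  ne : ∀ c, n c ≠ c

namespace IsRotation

theorem next : IsRotation Color.next :=
  ⟨by rintro (_ | _ | _) <;> rfl, by rintro (_ | _ | _) <;> decide⟩

variable {n : Color → Color}

theorem ne_twice (hn : IsRotation n) (c : Color) : n (n c) ≠ c := fun h =>
  hn.ne c ((congrArg n h).symm.trans (hn.cube c))

theorem twice (hn : IsRotation n) : IsRotation fun c => n (n c) :=
  ⟨fun c => by rw [hn.cube, hn.cube], hn.ne_twice⟩

theorem bijective (hn : IsRotation n) : Function.Bijective n :=
  ⟨fun c d h => by rw [← hn.cube c, h, hn.cube], fun c => ⟨_, hn.cube c⟩⟩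

theorem eq_or (hn : IsRotation n) (c d : Color) : d = c ∨ d = n c ∨ d = n (n c) := by
  have key : ∀ c₁ c₂ c₃ d : Color, c₁ ≠ c₂ → c₁ ≠ c₃ → c₂ ≠ c₃ → d = c₁ ∨ d = c₂ ∨ d = c₃ := by decide
  exact key _ _ _ _ (hn.ne c).symm (hn.ne_twice c).symm (hn.ne (n c)).symm

theorem sum_eq (hn : IsRotation n) {A : Type*} [AddCommMonoid A] (F : Color → A) (c : Color) :
    ∑ d, F d = F c + F (n c) + F (n (n c)) := by
  have : (Finset.univ : Finset Color) = {c, n c, n (n c)} := by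
    ext d
    simpa using hn.eq_or c d
  rw [this, Finset.sum_insert, Finset.sum_insert, Finset.sum_singleton, add_assoc]
  · simpa using (hn.ne (n c)).symm
  · simpa using ⟨(hn.ne c).symm, (hn.ne_twice c).symm⟩

end IsRotation

theorem sum_color {A : Type*} [AddCommMonoid A] (F : Color → A) :
    ∑ d, F d = F .r + F .g + F .b := by
  rw [IsRotation.next.sum_eq F .r, add_right_comm]
  rfl

/-! ## Binary functions on the ruby lattice -/

section Lattice

variable {V : Type*}

/-- The sum of a function over the corners of each triangle. -/
def triSum : (V × Color → ZMod 2) →ₗ[ZMod 2] (V → ZMod 2) where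
  toFun f v := ∑ c, f (v, c)
  map_add' f g := by ext v; simp [Finset.sum_add_distrib]
  map_smul' a f := by ext v; simp [Finset.mul_sum]

theorem triSum_apply (f : V × Color → ZMod 2) (v : V) : triSum f v = ∑ c, f (v, c) := rfl

/-- The function that is constant on each triangle with given value. -/
def triConst : (V → ZMod 2) →ₗ[ZMod 2] (V × Color → ZMod 2) where
  toFun b q := b q.1
  map_add' _ _ := rfl
  map_smul' _ _ := rfl

@[simp] theorem triConst_apply (b : V → ZMod 2) (v : V) (c : Color) : triConst b (v, c) = b v := rfl

theorem triSum_triConst (b : V → ZMod 2) : triSum (triConst b) = b := by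
  ext v
  rw [triSum_apply, sum_color]
  simp only [triConst_apply]
  rw [CharTwo.add_self_eq_zero, zero_add]

/-- The functions with even weight on every triangle. -/
abbrev triEven (V : Type*) : Submodule (ZMod 2) (V × Color → ZMod 2) := LinearMap.ker triSum

theorem mem_triEven {f : V × Color → ZMod 2} : f ∈ triEven V ↔ ∀ v, ∑ c, f (v, c) = 0 :=
  funext_iff

/-- Relabelling the corners of the triangles. -/
def rot (n : Color → Color) : (V × Color → ZMod 2) →ₗ[ZMod 2] (V × Color → ZMod 2) where
  toFun f q := f (q.1, n q.2)
  map_add' _ _ := rfl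
  map_smul' _ _ := rfl

@[simp] theorem rot_apply (n : Color → Color) (f : V × Color → ZMod 2) (v : V) (c : Color) :
    rot n f (v, c) = f (v, n c) := rfl

theorem triSum_rot {n : Color → Color} (hn : IsRotation n) (f : V × Color → ZMod 2) :
    triSum (rot n f) = triSum f := by
  ext v
  exact hn.bijective.sum_comp fun c => f (v, c)

theorem triConst_triSum {n : Color → Color} (hn : IsRotation n) (f : V × Color → ZMod 2) :
    triConst (triSum f) = f + rot n f + rot n (rot n f) := by
  ext ⟨v, c⟩
  exact hn.sum_eq (fun c => f (v, c)) c

/-- The function supported on the corners of colour `c`, with given values. -/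
def corner (c : Color) (b : V → ZMod 2) (q : V × Color) : ZMod 2 := if q.2 = c then b q.1 else 0

/-- The chain of edges that separate plaquettes with different values. -/
def bd : (V × Color → ZMod 2) →ₗ[ZMod 2] (V × Color → ZMod 2) := triConst ∘ₗ triSum + LinearMap.id

theorem bd_apply (a : V × Color → ZMod 2) (v : V) (c : Color) :
    bd a (v, c) = (∑ d, a (v, d)) + a (v, c) := rfl

/-- An edge of colour c has the plaquettes of the other two colours beside it. -/
theorem bd_eq {n : Color → Color} (hn : IsRotation n) (a : V × Color → ZMod 2) (v : V) (c : Color) :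
    bd a (v, c) = a (v, n c) + a (v, n (n c)) := by
  rw [bd_apply, hn.sum_eq _ c]
  linear_combination CharTwo.add_self_eq_zero (a (v, c))

theorem bd_mem_triEven (a : V × Color → ZMod 2) : bd a ∈ triEven V := by
  rw [LinearMap.mem_ker, bd, LinearMap.add_apply, map_add, LinearMap.comp_apply, triSum_triConst]
  ext v
  exact CharTwo.add_self_eq_zero _

variable [Fintype V]

theorem dot_eq_sum (f g : V × Color → ZMod 2) : f ⬝ᵥ g = ∑ v, ∑ c, f (v, c) * g (v, c) :=
  Fintype.sum_prod_type _

theorem triConst_dot (b : V → ZMod 2) (f : V × Color → ZMod 2) :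
    triConst b ⬝ᵥ f = b ⬝ᵥ triSum f := by
  rw [dot_eq_sum]
  simp only [dotProduct, triSum_apply, triConst_apply, Finset.mul_sum]

theorem rot_dot {n : Color → Color} (hn : IsRotation n) (f g : V × Color → ZMod 2) :
    rot n f ⬝ᵥ g = f ⬝ᵥ rot n (rot n g) := by
  rw [dot_eq_sum, dot_eq_sum]
  refine Finset.sum_congr rfl fun v _ => ?_
  rw [← hn.bijective.sum_comp fun c => f (v, c) * rot n (rot n g) (v, c)]
  simp only [rot_apply, hn.cube]

theorem dotPerp_range_triConst :
    dotPerp (LinearMap.range (triConst (V := V))) = triEven V := by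
  ext f
  rw [mem_dotPerp]
  constructor
  · intro h
    classical
    ext v
    have := h _ ⟨Pi.single v 1, rfl⟩
    rw [triConst_dot] at this
    simpa using this
  · rintro h _ ⟨b, rfl⟩
    rw [triConst_dot, LinearMap.mem_ker.1 h, dotProduct_zero]

theorem dotPerp_triEven : dotPerp (triEven V) = LinearMap.range (triConst (V := V)) := by
  rw [← dotPerp_range_triConst, dotPerp_dotPerp]

theorem span_pairs_triangle : Submodule.span (ZMod 2)
    {f | ∃ (v : V) (c d : Color), c ≠ d ∧ f = ({(v, c), (v, d)} : Set (V × Color)).indicator 1} =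
      triEven V := by
  have hne : ∀ {v : V} {c d : Color}, c ≠ d → (v, c) ≠ (v, d) := fun h e => h (Prod.ext_iff.1 e).2
  apply le_antisymm
  · rw [Submodule.span_le]
    rintro _ ⟨v, c, d, h, rfl⟩
    rw [SetLike.mem_coe, ← dotPerp_range_triConst, mem_dotPerp]
    rintro _ ⟨b, rfl⟩
    rw [dotProduct_comm, indicator_pair_dotProduct (hne h)]
    exact CharTwo.add_self_eq_zero _
  -- Dually, a function orthogonal to every pair has equal values on the corners of each triangle.
  · rw [← dotPerp_range_triConst, ← dotPerp_dotPerp (Submodule.span _ _)]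
    refine dotPerp_anti fun f hf => ⟨fun v => f (v, .r), ?_⟩
    ext ⟨v, c⟩
    by_cases h : Color.r = c
    · subst h; rfl
    · have := hf _ (Submodule.subset_span ⟨v, _, _, h, rfl⟩)
      rw [dotForm_apply, indicator_pair_dotProduct (hne h)] at this
      exact CharTwo.add_eq_zero.1 this

/-! ### Functions invariant along edges, plaquette functions and closed chains -/

namespace Tiling

variable (T : Tiling V)

-- Moving along an edge flips the bipartition, so the tiling has no loops; the two qubits of an edge
-- check are thus distinct.
omit [Fintype V] in
theorem sigma_ne (c : Color) (v : V) : T.σ c v ≠ v := by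
  obtain ⟨ε, h⟩ := T.orientable
  intro e
  have := h c v
  rw [e] at this
  cases h' : ε v <;> simp [h'] at this

/-- The functions that, on the corners of colour `d`, are invariant along the edges of
colour `k d`. -/
def edgeInv (k : Color → Color) : Submodule (ZMod 2) (V × Color → ZMod 2) where
  carrier := {f | ∀ v d, f (T.σ (k d) v, d) = f (v, d)}
  zero_mem' _ _ := rfl
  add_mem' hf hg v d := by rw [Pi.add_apply, Pi.add_apply, hf, hg]
  smul_mem' a f hf v d := by rw [Pi.smul_apply, Pi.smul_apply, hf]

/-- The functions that are constant on every plaquette, when the corners of colour `d` are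
identified with the corners of the plaquettes of colour `d`. -/
def plaqInv : Submodule (ZMod 2) (V × Color → ZMod 2) where
  carrier := {f | ∀ v c d, c ≠ d → f (T.σ c v, d) = f (v, d)}
  zero_mem' _ _ _ _ := rfl
  add_mem' hf hg v c d h := by rw [Pi.add_apply, Pi.add_apply, hf v c d h, hg v c d h]
  smul_mem' a f hf v c d h := by rw [Pi.smul_apply, Pi.smul_apply, hf v c d h]

/-- The closed chains, as functions on the ruby lattice. -/
def cyc : Submodule (ZMod 2) (V × Color → ZMod 2) := T.edgeInv id ⊓ triEven V

omit [Fintype V] in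
theorem pair_ne (c d : Color) (v : V) : (v, d) ≠ (T.σ c v, d) := fun h =>
  T.sigma_ne c v (Prod.ext_iff.1 h).1.symm

/-- The qubits are paired by a fixed-point-free involution under which the summand is invariant, so
the sum cancels mod 2. -/
theorem dot_edgeInv {k : Color → Color} {f g : V × Color → ZMod 2} (hf : f ∈ T.edgeInv k)
    (hg : g ∈ T.edgeInv k) : f ⬝ᵥ g = 0 := by
  refine Finset.sum_involution (fun q _ => (T.σ (k q.2) q.1, q.2)) ?_ ?_ ?_ ?_
  · rintro ⟨v, d⟩ _
    dsimp only
    rw [hf, hg, CharTwo.add_self_eq_zero]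
  · rintro ⟨v, d⟩ _ _ e
    exact T.pair_ne _ _ _ e.symm
  · simp
  · rintro ⟨v, d⟩ _
    simp [T.invol]

omit [Fintype V] in
theorem pair_mem_edgeInv (k : Color → Color) (v : V) (d : Color) :
    ({(v, d), (T.σ (k d) v, d)} : Set (V × Color)).indicator 1 ∈ T.edgeInv k := by
  intro w e
  have : (T.σ (k e) w, e) ∈ ({(v, d), (T.σ (k d) v, d)} : Set (V × Color)) ↔
      (w, e) ∈ ({(v, d), (T.σ (k d) v, d)} : Set (V × Color)) := by
    simp only [Set.mem_insert_iff, Set.mem_singleton_iff, Prod.mk.injEq]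
    constructor
    · rintro (⟨rfl, rfl⟩ | ⟨h, rfl⟩)
      · exact Or.inr ⟨(T.invol _ _).symm, rfl⟩
      · exact Or.inl ⟨(T.σ (k e)).injective h, rfl⟩
    · rintro (⟨rfl, rfl⟩ | ⟨rfl, rfl⟩)
      · exact Or.inr ⟨rfl, rfl⟩
      · exact Or.inl ⟨T.invol _ _, rfl⟩
  classical
  simp only [Set.indicator_apply, this, Pi.one_apply]

theorem dotPerp_pairs (k : Color → Color) : dotPerp (Submodule.span (ZMod 2)
    {f | ∃ v d, f = ({(v, d), (T.σ (k d) v, d)} : Set (V × Color)).indicator 1}) ≤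
      T.edgeInv k := by
  intro f hf v d
  have := hf _ (Submodule.subset_span ⟨v, d, rfl⟩)
  rw [dotForm_apply, indicator_pair_dotProduct (T.pair_ne _ _ _)] at this
  exact (CharTwo.add_eq_zero.1 this).symm

/-- Functions orthogonal to all pairs are edge-invariant, and edge-invariant functions are mutually
orthogonal. Taking double complements proves that the pairs span. -/
theorem span_pairs_edge (k : Color → Color) : Submodule.span (ZMod 2)
    {f | ∃ v d, f = ({(v, d), (T.σ (k d) v, d)} : Set (V × Color)).indicator 1} =
      T.edgeInv k := by
  apply le_antisymm
  · rw [Submodule.span_le]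
    rintro _ ⟨v, d, rfl⟩
    exact T.pair_mem_edgeInv k v d
  · rw [← dotPerp_dotPerp (Submodule.span _ _)]
    exact fun f hf g hg => T.dot_edgeInv (T.dotPerp_pairs k hg) hf

theorem dotPerp_edgeInv (k : Color → Color) : dotPerp (T.edgeInv k) = T.edgeInv k := by
  apply le_antisymm
  · nth_rw 1 [← T.span_pairs_edge k]
    exact T.dotPerp_pairs k
  · exact fun f hf g hg => T.dot_edgeInv hg hf

variable {T}

omit [Fintype V]

theorem rot_mem_edgeInv {k : Color → Color} {f : V × Color → ZMod 2} (hf : f ∈ T.edgeInv id) :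
    rot k f ∈ T.edgeInv k := fun v d => hf v (k d)

theorem rot_mem_edgeInv_of_plaqInv {k l : Color → Color} {a : V × Color → ZMod 2}
    (ha : a ∈ T.plaqInv) (h : ∀ c, l c ≠ k c) : rot k a ∈ T.edgeInv l :=
  fun v d => ha v _ _ (h d)

theorem mem_edgeInv_of_plaqInv {l : Color → Color} {a : V × Color → ZMod 2}
    (ha : a ∈ T.plaqInv) (h : ∀ c, l c ≠ c) : a ∈ T.edgeInv l :=
  fun v d => ha v _ _ (h d)

theorem corner_mem_edgeInv {k : Color → Color} {c : Color} {b : V → ZMod 2}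
    (h : ∀ v, b (T.σ (k c) v) = b v) : corner c b ∈ T.edgeInv k := by
  intro v d
  by_cases hd : d = c
  · subst hd; simp [corner, h]
  · simp [corner, hd]

theorem bd_mem_cyc {a : V × Color → ZMod 2} (ha : a ∈ T.plaqInv) : bd a ∈ T.cyc := by
  refine ⟨fun v c => ?_, bd_mem_triEven a⟩
  have hn := IsRotation.next
  rw [bd_eq hn, bd_eq hn, id, ha _ _ _ (hn.ne c).symm, ha _ _ _ (hn.ne_twice c).symm]

/-- At a vertex of a closed chain the three edge values sum to zero, so any two determine the third.
-/
theorem cyc_add {h : V × Color → ZMod 2} (hh : h ∈ T.cyc) {n : Color → Color} (hn : IsRotation n)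
    (v : V) (c : Color) : h (v, n c) + h (v, n (n c)) = h (v, c) := by
  have := mem_triEven.1 hh.2 v
  rw [hn.sum_eq _ c, add_assoc] at this
  exact (CharTwo.add_eq_zero.1 this).symm

variable [Fintype V]

theorem dotPerp_cyc : dotPerp T.cyc = T.edgeInv id ⊔ LinearMap.range (triConst (V := V)) := by
  rw [← dotPerp_dotPerp (T.edgeInv id ⊔ LinearMap.range (triConst (V := V)))]
  refine congrArg dotPerp (le_antisymm ?_ (le_inf ?_ ?_))
  · intro f hf g hg
    obtain ⟨a, ha, b, hb, rfl⟩ := Submodule.mem_sup.1 hg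
    rw [map_add, LinearMap.add_apply, dotForm_apply, dotForm_apply, T.dot_edgeInv ha hf.1]
    have := dotPerp_triEven (V := V) ▸ hb
    rw [zero_add, dotProduct_comm]
    exact this f hf.2
  · exact (dotPerp_anti le_sup_left).trans (T.dotPerp_edgeInv id).le
  · exact (dotPerp_anti le_sup_right).trans dotPerp_range_triConst.le

/-- Poincaré duality: the intersection form on homology is non-degenerate. -/
theorem exists_bd_eq {n : Color → Color} (hn : IsRotation n) {h : V × Color → ZMod 2}
    (hh : h ∈ T.cyc) (H : ∀ g ∈ T.cyc, g ⬝ᵥ rot n h = 0) : ∃ a ∈ T.plaqInv, bd a = h := by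
  have h1 : rot n h ∈ dotPerp T.cyc := H
  rw [dotPerp_cyc] at h1
  -- Membership in the complement of the closed chains gives a function s of the vertices such that
  -- h, shifted by s, is invariant along the relevant edges. This shifted function is the required
  -- plaquette potential; s cancels in `bd`, where two corners are added.
  obtain ⟨e, he, _, ⟨s, rfl⟩, h2⟩ := Submodule.mem_sup.1 h1
  have h3 : ∀ v c, h (v, n c) = e (v, c) + s v := fun v c => (congrFun h2 (v, c)).symm
  have key : ∀ v c, h (T.σ c v, n c) + s (T.σ c v) = h (v, n c) + s v := by
    intro v c
    have := he v c
    rw [id] at this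
    rw [h3, h3, this]
    linear_combination CharTwo.add_self_eq_zero (s (T.σ c v)) - CharTwo.add_self_eq_zero (s v)
  have h4 := fun v c => CharTwo.add_self_eq_zero (h (v, c))
  refine ⟨h + triConst s, ?_, ?_⟩
  · intro v c d hcd
    have hc := hh.1 v c
    rw [id] at hc
    change h (T.σ c v, d) + s (T.σ c v) = h (v, d) + s v
    rcases hn.eq_or c d with rfl | rfl | rfl
    · exact absurd rfl hcd
    · exact key v c
    · have e1 := cyc_add hh hn (T.σ c v) c
      have e2 := cyc_add hh hn v c
      linear_combination key v c - h4 (T.σ c v) (n c) + e1 - e2 + hc + h4 v (n c)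
  · ext ⟨v, c⟩
    rw [bd_eq hn]
    change h (v, n c) + s v + (h (v, n (n c)) + s v) = _
    linear_combination cyc_add hh hn v c + CharTwo.add_self_eq_zero (s v)

end Tiling

end Lattice

/-! ## Counting plaquettes -/

namespace Tiling

variable {V : Type*} (T : Tiling V)

theorem eq_of_mem_moves {A : Type*} {C : Set Color} {F : V → A}
    (hF : ∀ c ∈ C, ∀ v, F (T.σ c v) = F v) {f : Equiv.Perm V} (hf : f ∈ T.moves C) (v : V) :
    F (f v) = F v := by
  induction hf using Subgroup.closure_induction generalizing v with
  | mem x hx =>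
    obtain ⟨c, hc, rfl⟩ := hx
    exact hF c hc v
  | one => rfl
  | mul x y _ _ hx hy => rw [Equiv.Perm.mul_apply, hx, hy]
  | inv x _ hx => rw [← hx (x⁻¹ v), ← Equiv.Perm.mul_apply, mul_inv_cancel, Equiv.Perm.one_apply]

theorem eq_of_forall_sigma {A : Type*} {F : V → A} (hF : ∀ c v, F (T.σ c v) = F v) (v w : V) :
    F v = F w := by
  obtain ⟨f, hf, rfl⟩ := T.connected v w
  rw [← Set.image_univ] at hf
  exact (T.eq_of_mem_moves (C := Set.univ) (fun c _ => hF c) hf v).symm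

/-- The functions of the vertices that are invariant along edges with colours in `C`. -/
def vertexInv (C : Set Color) : Submodule (ZMod 2) (V → ZMod 2) where
  carrier := {b | ∀ c ∈ C, ∀ v, b (T.σ c v) = b v}
  zero_mem' _ _ _ := rfl
  add_mem' hf hg c hc v := by rw [Pi.add_apply, Pi.add_apply, hf c hc, hg c hc]
  smul_mem' a f hf c hc v := by rw [Pi.smul_apply, Pi.smul_apply, hf c hc]

theorem orbit_eq (C : Set Color) (c : Color) (hc : c ∈ C) (v : V) :
    (Quotient.mk _ (T.σ c v) : MulAction.orbitRel.Quotient (T.moves C) V) = Quotient.mk _ v :=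
  Quotient.sound ⟨⟨T.σ c, Subgroup.subset_closure ⟨c, hc, rfl⟩⟩, rfl⟩

/-- Invariant functions are functions of the components. -/
def vertexInvEquiv (C : Set Color) : T.vertexInv C ≃ₗ[ZMod 2]
    (MulAction.orbitRel.Quotient (T.moves C) V → ZMod 2) where
  toFun b := Quotient.lift b.1 (by
    rintro v w ⟨⟨f, hf⟩, rfl⟩
    exact T.eq_of_mem_moves b.2 hf w)
  invFun F := ⟨fun v => F (Quotient.mk _ v), fun c hc v => congrArg F (T.orbit_eq C c hc v)⟩
  left_inv b := rfl
  right_inv F := by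
    ext q
    obtain ⟨v, rfl⟩ := Quotient.exists_rep q
    rfl
  map_add' b b' := by
    ext q
    obtain ⟨v, rfl⟩ := Quotient.exists_rep q
    rfl
  map_smul' a b := by
    ext q
    obtain ⟨v, rfl⟩ := Quotient.exists_rep q
    rfl

theorem finrank_vertexInv [Finite V] (C : Set Color) :
    Module.finrank (ZMod 2) (T.vertexInv C) = T.numComponents C := by
  classical
  have := Fintype.ofFinite (MulAction.orbitRel.Quotient (T.moves C) V)
  rw [(T.vertexInvEquiv C).finrank_eq, Module.finrank_fintype_fun_eq_card, numComponents,
    Nat.card_eq_fintype_card]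

theorem finrank_of_corners [Finite V] {I : Submodule (ZMod 2) (V × Color → ZMod 2)}
    {C : Color → Set Color} (h : ∀ f, f ∈ I ↔ ∀ d, (fun v => f (v, d)) ∈ T.vertexInv (C d)) :
    Module.finrank (ZMod 2) I = ∑ d, T.numComponents (C d) := by
  let e : I ≃ₗ[ZMod 2] (Π d, T.vertexInv (C d)) :=
    { toFun := fun f d => ⟨fun v => f.1 (v, d), (h f.1).1 f.2 d⟩
      invFun := fun F => ⟨fun q => (F q.2).1 q.1, (h _).2 fun d => (F d).2⟩
      left_inv := fun f => rfl
      right_inv := fun F => rfl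
      map_add' := fun f g => rfl
      map_smul' := fun a f => rfl }
  rw [e.finrank_eq, Module.finrank_pi_fintype]
  simp only [finrank_vertexInv]

theorem finrank_plaqInv [Finite V] :
    Module.finrank (ZMod 2) T.plaqInv = ∑ d, T.numComponents {d}ᶜ :=
  T.finrank_of_corners fun _ => ⟨fun hf d c hc v => hf v c d hc, fun hf v c d h => hf d c h v⟩

theorem finrank_edgeInv [Finite V] :
    Module.finrank (ZMod 2) (T.edgeInv id) = ∑ d, T.numComponents {d} :=
  T.finrank_of_corners fun f => ⟨by
    rintro hf d _ rfl v
    exact hf v _, fun hf v d => hf d d rfl v⟩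

/-- The corner `c` of the plaquette of colour `c` at `v`. -/
noncomputable def plaqCorner (c : Color) (v : V) : V × Color → ZMod 2 :=
  {q : V × Color | q.1 ∈ T.plaquette c v ∧ q.2 = c}.indicator 1

theorem sigma_mem_plaquette {c d : Color} (h : d ≠ c) (v w : V) :
    T.σ d w ∈ T.plaquette c v ↔ w ∈ T.plaquette c v := by
  have hs : T.σ d ∈ T.moves {c}ᶜ := Subgroup.subset_closure ⟨d, h, rfl⟩
  constructor
  · rintro ⟨f, hf, e⟩
    exact ⟨T.σ d * f, mul_mem hs hf, by rw [Equiv.Perm.mul_apply, e, T.invol]⟩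
  · rintro ⟨f, hf, rfl⟩
    exact ⟨T.σ d * f, mul_mem hs hf, rfl⟩

theorem plaqCorner_mem (c : Color) (v : V) : T.plaqCorner c v ∈ T.plaqInv := by
  classical
  intro w d e h
  simp only [plaqCorner, Set.indicator_apply, Set.mem_ofPred_eq, Pi.one_apply]
  by_cases he : e = c
  · subst he
    simp only [T.sigma_mem_plaquette h]
  · simp [he]

theorem span_plaqCorner [Finite V] :
    Submodule.span (ZMod 2) {f | ∃ c v, f = T.plaqCorner c v} = T.plaqInv := by
  classical
  apply le_antisymm
  · rw [Submodule.span_le]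
    rintro _ ⟨c, v, rfl⟩
    exact T.plaqCorner_mem c v
  · intro f hf
    have := fun d : Color => Fintype.ofFinite (MulAction.orbitRel.Quotient (T.moves {d}ᶜ) V)
    -- Expansion over plaquettes: each one is a component of the graph without colour d, and its
    -- coefficient is the value at a chosen vertex.
    have e : f = ∑ d, ∑ q : MulAction.orbitRel.Quotient (T.moves {d}ᶜ) V,
        f (q.out, d) • T.plaqCorner d q.out := by
      ext ⟨w, d⟩
      rw [Finset.sum_apply, Finset.sum_eq_single d]
      · rw [Finset.sum_apply, Finset.sum_eq_single (Quotient.mk _ w)]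
        · obtain ⟨⟨g, hg⟩, h⟩ : (Quotient.mk _ w :
            MulAction.orbitRel.Quotient (T.moves {d}ᶜ) V).out ∈
              MulAction.orbit (T.moves {d}ᶜ) w := Quotient.mk_out (s := MulAction.orbitRel _ _) w
          have h' : g w = _ := h
          have hw : w ∈ T.plaquette d (Quotient.mk _ w :
            MulAction.orbitRel.Quotient (T.moves {d}ᶜ) V).out :=
            ⟨g⁻¹, inv_mem hg, by
              rw [← h', ← Equiv.Perm.mul_apply, inv_mul_cancel, Equiv.Perm.one_apply]⟩
          rw [Pi.smul_apply, plaqCorner, Set.indicator_of_mem (by exact ⟨hw, rfl⟩), ← h',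
            T.eq_of_mem_moves (F := fun v => f (v, d)) (fun c hc v => hf v c d hc) hg w]
          simp
        · intro q _ hq
          rw [Pi.smul_apply, plaqCorner, Set.indicator_of_notMem, smul_zero]
          intro hw
          obtain ⟨⟨g, hg, h⟩, _⟩ : w ∈ T.plaquette d q.out ∧ d = d := hw
          apply hq
          rw [← Quotient.out_eq q]
          have hw' : w ∈ MulAction.orbit (T.moves {d}ᶜ) q.out := ⟨⟨g, hg⟩, h⟩
          exact (Quotient.sound (s := MulAction.orbitRel (T.moves {d}ᶜ) V) hw').symm
        · simp
      · intro e _ he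
        rw [Finset.sum_apply]
        refine Finset.sum_eq_zero fun q _ => ?_
        rw [Pi.smul_apply, plaqCorner, Set.indicator_of_notMem, smul_zero]
        rintro ⟨_, h⟩
        exact he h.symm
      · simp
    rw [e]
    exact sum_mem fun d _ => sum_mem fun q _ =>
      Submodule.smul_mem _ _ (Submodule.subset_span ⟨d, _, rfl⟩)

/-- The relations between the plaquettes of a closed connected surface. -/
theorem plaqInv_inf_triEven : T.plaqInv ⊓ triEven V = Submodule.map
    (LinearMap.funLeft (ZMod 2) (ZMod 2) (Prod.snd : V × Color → Color))
      (LinearMap.ker (∑ d, LinearMap.proj d : (Color → ZMod 2) →ₗ[ZMod 2] ZMod 2)) := by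
  obtain ⟨v₀⟩ := T.nonempty
  have hn := IsRotation.next
  ext a
  constructor
  · rintro ⟨h1, h2⟩
    -- Across an edge of colour c the values of the other two colours do not change; parity at both
    -- ends then forces the third value to agree too. Connectedness makes all three constant.
    have hc : ∀ v d, a (v, d) = a (v₀, d) := by
      intro v d
      refine T.eq_of_forall_sigma (F := fun v => a (v, d)) (fun c v => ?_) v v₀
      by_cases h : c = d
      · subst h
        have e1 := mem_triEven.1 h2 (T.σ c v)
        have e2 := mem_triEven.1 h2 v
        rw [hn.sum_eq _ c] at e1 e2
        have e3 := h1 v c _ (hn.ne c).symm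
        have e4 := h1 v c _ (hn.ne_twice c).symm
        linear_combination e1 - e2 - e3 - e4
      · exact h1 v c d h
    refine ⟨fun d => a (v₀, d), ?_, ?_⟩
    · have := mem_triEven.1 h2 v₀
      simpa [LinearMap.sum_apply] using this
    · ext ⟨v, d⟩
      exact (hc v d).symm
  · rintro ⟨α, h, rfl⟩
    refine ⟨fun v c d _ => rfl, mem_triEven.2 fun v => ?_⟩
    simpa [LinearMap.sum_apply] using h

/-- The relations are three constants, one per colour, with sum zero: a space of dimension 2. -/
theorem finrank_plaqInv_inf_triEven :
    Module.finrank (ZMod 2) ↥(T.plaqInv ⊓ triEven V) = 2 := by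
  obtain ⟨v₀⟩ := T.nonempty
  have hinj : Function.Injective
      (LinearMap.funLeft (ZMod 2) (ZMod 2) (Prod.snd : V × Color → Color)) :=
    LinearMap.funLeft_injective_of_surjective _ _ _ fun c => ⟨(v₀, c), rfl⟩
  rw [plaqInv_inf_triEven, ← (Submodule.equivMapOfInjective _ hinj _).finrank_eq]
  have h := LinearMap.finrank_range_add_finrank_ker
    (∑ d, LinearMap.proj d : (Color → ZMod 2) →ₗ[ZMod 2] ZMod 2)
  rw [LinearMap.range_eq_top.2, finrank_top, Module.finrank_fintype_fun_eq_card,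
    Module.finrank_self] at h
  · have : Fintype.card Color = 3 := rfl
    lia
  · intro x
    refine ⟨Pi.single .r x, ?_⟩
    simp [LinearMap.sum_apply]

/-- The `X`-parts of the stabilizers of the encoded colour code. -/
def codeX : Submodule (ZMod 2) (V × Color → ZMod 2) := T.plaqInv.map (triConst ∘ₗ triSum)

/-- The `Z`-parts of the stabilizers of the encoded colour code. -/
def codeZ : Submodule (ZMod 2) (V × Color → ZMod 2) := triEven V ⊔ T.plaqInv

/-- The vectors of the stabilizers of the encoded colour code. -/
def code : Submodule (ZMod 2) (PVec (V × Color)) := T.codeX.prod T.codeZ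

/-! ### Dimensions of the colour code and of the closed chains -/

variable [Fintype V]

theorem two_mul_sum_numComponents : 2 * ∑ d, T.numComponents {d} = 3 * Fintype.card V := by
  rw [← finrank_edgeInv, finrank_self_dotPerp (T.dotPerp_edgeInv id), Fintype.card_prod, mul_comm]
  rfl

/-- With F plaquettes, the X part has dimension F - 2 and the Z part 2|V| + F - 2. Since there are
3|V|/2 edges, the Euler characteristic turns the sum into 3|V| - 4g. -/
theorem finrank_code {g : ℕ} (hg : T.eulerChar = 2 - 2 * (g : ℤ)) :
    Module.finrank (ZMod 2) T.code + 4 * g = Fintype.card (V × Color) := by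
  have h1 : Module.finrank (ZMod 2) T.code =
      Module.finrank (ZMod 2) T.codeX + Module.finrank (ZMod 2) T.codeZ := by
    rw [← Module.finrank_prod]
    let e : T.code ≃ₗ[ZMod 2] T.codeX × T.codeZ :=
      { toFun := fun u => (⟨u.1.1, u.2.1⟩, ⟨u.1.2, u.2.2⟩)
        invFun := fun p => ⟨(p.1.1, p.2.1), p.1.2, p.2.2⟩
        left_inv := fun u => rfl
        right_inv := fun p => rfl
        map_add' := fun u v => rfl
        map_smul' := fun a u => rfl }
    exact e.finrank_eq
  have h2 := finrank_map_add_finrank_inf_ker triSum T.plaqInv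
  rw [finrank_plaqInv_inf_triEven] at h2
  have h3 : Module.finrank (ZMod 2) T.codeX = Module.finrank (ZMod 2) (T.plaqInv.map triSum) := by
    rw [codeX, Submodule.map_comp]
    have hinj : Function.Injective (triConst (V := V)) := fun b b' h => by
      rw [← triSum_triConst b, h, triSum_triConst]
    exact (Submodule.equivMapOfInjective _ hinj _).finrank_eq.symm
  have h4 := Submodule.finrank_sup_add_finrank_inf_eq (triEven V) T.plaqInv
  rw [inf_comm, finrank_plaqInv_inf_triEven] at h4
  change Module.finrank (ZMod 2) T.codeZ + 2 = _ at h4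
  have h5 := LinearMap.finrank_range_add_finrank_ker (triSum (V := V))
  rw [LinearMap.range_eq_top.2 fun b => ⟨_, triSum_triConst b⟩, finrank_top,
    Module.finrank_fintype_fun_eq_card, Module.finrank_fintype_fun_eq_card, Fintype.card_prod] at h5
  have h6 := T.finrank_plaqInv
  have h7 := T.two_mul_sum_numComponents
  have h8 : Fintype.card Color = 3 := rfl
  rw [h8] at h5
  rw [Fintype.card_prod, h8]
  rw [eulerChar, Nat.card_eq_fintype_card] at hg
  rw [sum_color] at h6 h7
  lia

/-- With E edges and F plaquettes, closed chains have dimension at least E - |V| + 1 and boundaries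
at most F - 1. Only this inequality is needed: the string operators later force equality. -/
theorem le_finrank_cyc {g : ℕ} (hg : T.eulerChar = 2 - 2 * (g : ℤ)) :
    2 * g + Module.finrank (ZMod 2) (T.plaqInv.map bd) ≤ Module.finrank (ZMod 2) T.cyc := by
  have h1 := finrank_map_add_finrank_inf_ker triSum (T.edgeInv id)
  change _ + Module.finrank (ZMod 2) T.cyc = _ at h1
  have h2 : Module.finrank (ZMod 2) ((T.edgeInv id).map triSum) + 1 ≤ Fintype.card V := by
    let l : (V → ZMod 2) →ₗ[ZMod 2] ZMod 2 := ∑ v, LinearMap.proj v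
    have hl : (T.edgeInv id).map triSum ≤ LinearMap.ker l := by
      rintro _ ⟨f, hf, rfl⟩
      -- Every edge has two ends, so the vertex parities of any chain sum to zero; this is
      -- orthogonality to the constant function.
      have h := T.dot_edgeInv hf (g := 1) (fun _ _ => rfl)
      rw [dot_eq_sum] at h
      simpa [l, LinearMap.sum_apply, triSum_apply] using h
    have h3 := LinearMap.finrank_range_add_finrank_ker l
    rw [LinearMap.range_eq_top.2, finrank_top, Module.finrank_fintype_fun_eq_card,
      Module.finrank_self] at h3
    · have := Submodule.finrank_mono hl
      lia
    · classical
      obtain ⟨v₀⟩ := T.nonempty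
      intro x
      refine ⟨Pi.single v₀ x, ?_⟩
      simp [l, LinearMap.sum_apply]
  have h3 := finrank_map_add_finrank_inf_ker bd T.plaqInv
  have h4 : 1 ≤ Module.finrank (ZMod 2) ↥(T.plaqInv ⊓ LinearMap.ker (bd (V := V))) := by
    obtain ⟨v₀⟩ := T.nonempty
    rw [Submodule.one_le_finrank_iff, Submodule.ne_bot_iff]
    -- The sum of all plaquettes has no boundary because the surface is closed.
    refine ⟨1, ⟨fun _ _ _ _ => rfl, ?_⟩, fun h => one_ne_zero (congrFun h (v₀, .r))⟩
    ext ⟨v, c⟩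
    rw [bd_eq IsRotation.next]
    exact CharTwo.add_self_eq_zero _
  have h6 := T.finrank_plaqInv
  have h5 := T.finrank_edgeInv
  have h7 := T.two_mul_sum_numComponents
  rw [eulerChar, Nat.card_eq_fintype_card] at hg
  rw [sum_color] at h5 h6 h7
  lia

end Tiling

/-! ## The measurement rounds -/

/-- A rotation of the colours and two Pauli labels such that the checks with label `A` lie, in the
plaquettes of colour `d`, along the edges of colour `n d`, and those with label `B` along the edges
of colour `n (n d)`. -/
structure IsLayout (n : Color → Color) (A B : PauliLabel) : Prop where
  rotation : IsRotation n
  left : A ≠ .z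
  right : B ≠ .z
  ne : A ≠ B

theorem IsLayout.xy : IsLayout Color.next .x .y :=
  ⟨IsRotation.next, nofun, nofun, nofun⟩

theorem IsLayout.yx : IsLayout (fun c => c.next.next) .y .x :=
  ⟨IsRotation.next.twice, nofun, nofun, nofun⟩

namespace Tiling

variable {V : Type*} (T : Tiling V)

/-- The span of the vectors of the checks on the triangles. -/
def triChecks (V : Type*) : Submodule (ZMod 2) (PVec (V × Color)) := (triEven V).map (labelVec .z)

/-- The span of the vectors of the checks with label `p` that lie, in the plaquettes of colour
`d`, along the edges of colour `k d`. -/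
def edgeChecks (p : PauliLabel) (k : Color → Color) : Submodule (ZMod 2) (PVec (V × Color)) :=
  (T.edgeInv k).map (labelVec p)

theorem span_checksZ [Fintype V] :
    Submodule.span (ZMod 2) (Pauli.vec '' (checksZ (V := V))) = triChecks V := by
  rw [triChecks, ← span_pairs_triangle, Submodule.map_span]
  congr 1
  ext u
  constructor
  · rintro ⟨_, ⟨v, c, d, h, rfl⟩, rfl⟩
    exact ⟨_, ⟨v, c, d, h, rfl⟩, (vec_on _ _).symm⟩
  · rintro ⟨_, ⟨v, c, d, h, rfl⟩, rfl⟩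
    exact ⟨_, ⟨v, c, d, h, rfl⟩, vec_on _ _⟩

theorem span_checks [Fintype V] (p : PauliLabel) (k : Color → Color) : Submodule.span (ZMod 2)
    (Pauli.vec '' {P | ∃ v d, P = Pauli.on {(v, d), (T.σ (k d) v, d)} p}) = T.edgeChecks p k := by
  rw [edgeChecks, ← span_pairs_edge, Submodule.map_span]
  congr 1
  ext u
  constructor
  · rintro ⟨_, ⟨v, d, rfl⟩, rfl⟩
    exact ⟨_, ⟨v, d, rfl⟩, (vec_on _ _).symm⟩
  · rintro ⟨_, ⟨v, d, rfl⟩, rfl⟩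
    exact ⟨_, ⟨v, d, rfl⟩, vec_on _ _⟩

theorem span_checksX [Fintype V] :
    Submodule.span (ZMod 2) (Pauli.vec '' T.checksX) = T.edgeChecks .x Color.next :=
  T.span_checks .x Color.next

theorem span_checksY [Fintype V] :
    Submodule.span (ZMod 2) (Pauli.vec '' T.checksY) = T.edgeChecks .y fun c => c.next.next :=
  T.span_checks .y fun c => c.next.next

theorem indicator_plaquette_eq (c : Color) (v : V) :
    {q : V × Color | q.1 ∈ T.plaquette c v}.indicator 1 =
      triConst (triSum (T.plaqCorner c v)) := by
  classical
  ext ⟨w, d⟩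
  rw [triConst_apply, triSum_apply, Finset.sum_eq_single c]
  · simp [plaqCorner, Set.indicator_apply]
  · intro e _ he
    simp [plaqCorner, he]
  · simp

theorem span_colorCodeGenerators [Fintype V] :
    Submodule.span (ZMod 2) (Pauli.vec '' T.colorCodeGenerators) = T.code := by
  have e1 : Pauli.vec '' {P | ∃ c v, P = Pauli.on {q : V × Color | q.1 ∈ T.plaquette c v} .x} =
      labelVec .x '' ((triConst ∘ₗ triSum) '' {f | ∃ c v, f = T.plaqCorner c v}) := by
    ext u
    constructor
    · rintro ⟨_, ⟨c, v, rfl⟩, rfl⟩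
      exact ⟨_, ⟨_, ⟨c, v, rfl⟩, rfl⟩, by rw [vec_on, indicator_plaquette_eq]; rfl⟩
    · rintro ⟨_, ⟨_, ⟨c, v, rfl⟩, rfl⟩, rfl⟩
      exact ⟨_, ⟨c, v, rfl⟩, by rw [vec_on, indicator_plaquette_eq]; rfl⟩
  have e2 : Pauli.vec '' {P | ∃ c v, P =
      Pauli.on {q : V × Color | q.1 ∈ T.plaquette c v ∧ q.2 = c} .z} =
        labelVec .z '' {f | ∃ c v, f = T.plaqCorner c v} := by
    ext u
    constructor
    · rintro ⟨_, ⟨c, v, rfl⟩, rfl⟩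
      exact ⟨_, ⟨c, v, rfl⟩, (vec_on _ _).symm⟩
    · rintro ⟨_, ⟨c, v, rfl⟩, rfl⟩
      exact ⟨_, ⟨c, v, rfl⟩, vec_on _ _⟩
  rw [colorCodeGenerators, Set.image_union, Set.image_union, Submodule.span_union,
    Submodule.span_union, span_checksZ, e1, e2, Submodule.span_image, Submodule.span_image,
    Submodule.span_image, span_plaqCorner]
  apply le_antisymm
  · refine sup_le (sup_le ?_ ?_) ?_
    · rintro _ ⟨f, hf, rfl⟩
      exact ⟨zero_mem _, Submodule.mem_sup_left hf⟩
    · rintro _ ⟨f, hf, rfl⟩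
      exact ⟨hf, zero_mem _⟩
    · rintro _ ⟨f, hf, rfl⟩
      exact ⟨zero_mem _, Submodule.mem_sup_right hf⟩
  · rintro ⟨x, z⟩ ⟨hx, hz⟩
    obtain ⟨t, ht, a, ha, e⟩ := Submodule.mem_sup.1 hz
    have : (x, z) = labelVec .z t + labelVec .x x + labelVec .z a := by
      rw [labelVec_z, labelVec_x, labelVec_z]
      simpa using e.symm
    rw [this]
    exact add_mem (Submodule.mem_sup_left (add_mem (Submodule.mem_sup_left ⟨t, ht, rfl⟩)
      (Submodule.mem_sup_right ⟨x, hx, rfl⟩))) (Submodule.mem_sup_right ⟨a, ha, rfl⟩)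

variable {T}

/-- An encoded plaquette on whole triangles differs from the one on single corners by `bd a`, which
is even on triangles and thus a product of ZZ checks. -/
theorem codeX_le_codeZ : T.codeX ≤ T.codeZ := by
  rintro _ ⟨a, ha, rfl⟩
  have : (triConst ∘ₗ triSum) a = bd a + a := by
    change _ = triConst (triSum a) + a + a
    rw [add_assoc, show a + a = 0 from funext fun q => CharTwo.add_self_eq_zero _, add_zero]
    rfl
  rw [this]
  exact Submodule.add_mem_sup (bd_mem_triEven a) ha

theorem labelVec_z_mem_code {f : V × Color → ZMod 2} (h : f ∈ T.codeZ) :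
    labelVec .z f ∈ T.code := ⟨zero_mem _, h⟩

/-- The colour code treats the labels alike: by `codeX_le_codeZ`, every X stabilizer also occurs
with labels y and z. -/
theorem labelVec_mem_code (p : PauliLabel) {f : V × Color → ZMod 2} (h : f ∈ T.codeX) :
    labelVec p f ∈ T.code := by
  have := codeX_le_codeZ h
  cases p
  · exact ⟨h, zero_mem _⟩
  · rw [labelVec_y]
    exact ⟨h, this⟩
  · exact labelVec_z_mem_code this

theorem triChecks_le_code : triChecks V ≤ T.code := by
  rintro _ ⟨f, hf, rfl⟩
  exact labelVec_z_mem_code (Submodule.mem_sup_left hf)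

variable [Fintype V]

theorem labelVec_mem_perp_edgeChecks {p q : PauliLabel} {k : Color → Color}
    {f : V × Color → ZMod 2} (hf : f ∈ T.edgeInv k) : labelVec p f ∈ perp (T.edgeChecks q k) := by
  by_cases h : q = p
  · subst h
    exact labelVec_mem_perp_map_self _
  · exact (labelVec_mem_perp_map h).2 (by rwa [dotPerp_edgeInv])

theorem labelVec_self_mem_perp_edgeChecks {p : PauliLabel} {k : Color → Color}
    {f : V × Color → ZMod 2} : labelVec p f ∈ perp (T.edgeChecks p k) :=
  labelVec_mem_perp_map_self _

theorem mem_edgeInv_of_mem_perp {p q : PauliLabel} {k : Color → Color} (h : q ≠ p)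
    {f : V × Color → ZMod 2} (hf : labelVec p f ∈ perp (T.edgeChecks q k)) : f ∈ T.edgeInv k := by
  have := (labelVec_mem_perp_map h).1 hf
  rwa [dotPerp_edgeInv] at this

theorem labelVec_mem_perp_triChecks (p : PauliLabel) (b : V → ZMod 2) :
    labelVec p (triConst b) ∈ perp (triChecks V) := by
  by_cases h : PauliLabel.z = p
  · subst h
    exact labelVec_mem_perp_map_self _
  · exact (labelVec_mem_perp_map h).2 (by rw [dotPerp_triEven]; exact ⟨b, rfl⟩)

theorem triChecks_isotropic : triChecks V ≤ perp (triChecks V) := map_labelVec_isotropic _ _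

theorem edgeChecks_isotropic (p : PauliLabel) (k : Color → Color) :
    T.edgeChecks p k ≤ perp (T.edgeChecks p k) := map_labelVec_isotropic _ _

section Rounds

variable {n : Color → Color} {A B : PauliLabel} (L : IsLayout n A B)

/-- The group after the three rounds of checks with labels `A`, `B`, `Z`. -/
abbrev cycle (T : Tiling V) (n : Color → Color) (A B : PauliLabel)
    (W : Submodule (ZMod 2) (PVec (V × Color))) : Submodule (ZMod 2) (PVec (V × Color)) :=
  meas (triChecks V) (meas (T.edgeChecks B fun c => n (n c)) (meas (T.edgeChecks A n) W))

include L

/-- In the second round a closed chain gives a stabilizer with label `B`. -/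
theorem chain_mem {g : V × Color → ZMod 2} (hg : g ∈ T.cyc) : labelVec B (rot n g) ∈
    meas (T.edgeChecks B fun c => n (n c)) (meas (T.edgeChecks A n) (triChecks V)) := by
  have hr : rot n g ∈ T.edgeInv n := rot_mem_edgeInv hg.1
  refine mem_meas ?_ labelVec_self_mem_perp_edgeChecks
  rw [← labelVec_add L.left.symm L.ne L.right.symm]
  refine add_mem (mem_meas ⟨_, ?_, rfl⟩ (labelVec_mem_perp_edgeChecks hr)) (le_meas _ _ ⟨_, hr, rfl⟩)
  rw [SetLike.mem_coe, LinearMap.mem_ker, triSum_rot L.rotation]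
  exact hg.2

/-- A plaquette function is invariant along both kinds of edges around its plaquette. It is
therefore an A check commuting with the B checks and also a B check; their product has label Z. -/
theorem plaq_mem {a : V × Color → ZMod 2} (ha : a ∈ T.plaqInv) (p : PauliLabel) : labelVec p a ∈
    meas (T.edgeChecks B fun c => n (n c)) (meas (T.edgeChecks A n) (triChecks V)) := by
  have h1 := mem_edgeInv_of_plaqInv ha L.rotation.ne
  have h2 := mem_edgeInv_of_plaqInv ha L.rotation.ne_twice
  have hA : labelVec A a ∈
      meas (T.edgeChecks B fun c => n (n c)) (meas (T.edgeChecks A n) (triChecks V)) :=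
    mem_meas (le_meas _ _ ⟨_, h1, rfl⟩) (labelVec_mem_perp_edgeChecks h2)
  have hB : labelVec B a ∈
      meas (T.edgeChecks B fun c => n (n c)) (meas (T.edgeChecks A n) (triChecks V)) :=
    le_meas _ _ ⟨_, h2, rfl⟩
  by_cases hpA : p = A
  · rwa [hpA]
  by_cases hpB : p = B
  · rwa [hpB]
  rw [← labelVec_add L.ne (Ne.symm hpB) (Ne.symm hpA)]
  exact add_mem hA hB

/-- The Z stabilizers are ZZ checks and surviving plaquettes. A stabilizer with label B on whole
triangles splits into the surviving chain of a boundary, shifted by `rot n`, and a B check; it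
survives the last round because it is constant on triangles. -/
theorem code_le_cycle : T.code ≤ T.cycle n A B (triChecks V) := by
  have hn := L.rotation
  have hz : ∀ f ∈ T.codeZ, labelVec .z f ∈ T.cycle n A B (triChecks V) := by
    intro f hf
    obtain ⟨t, ht, a, ha, rfl⟩ := Submodule.mem_sup.1 hf
    rw [map_add]
    have h1 : labelVec .z a ∈ perp (triChecks V) := labelVec_mem_perp_map_self _
    have h2 : labelVec .z t ∈ triChecks V := ⟨t, ht, rfl⟩
    exact add_mem (le_meas _ _ h2) (mem_meas (plaq_mem L ha .z) h1)
  have hB : ∀ f ∈ T.codeX, labelVec B f ∈ T.cycle n A B (triChecks V) := by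
    rintro _ ⟨a, ha, rfl⟩
    rw [LinearMap.comp_apply]
    refine mem_meas ?_ (labelVec_mem_perp_triChecks B (triSum a))
    have e : triConst (triSum a) = rot n (bd a) + rot n a := by
      ext ⟨v, c⟩
      rw [Pi.add_apply, rot_apply, rot_apply, bd_eq hn, hn.cube]
      exact (hn.sum_eq (fun c => a (v, c)) c).trans (by ring)
    rw [e, map_add]
    exact add_mem (chain_mem L (bd_mem_cyc ha))
      (le_meas _ _ ⟨_, rot_mem_edgeInv_of_plaqInv ha fun c => hn.ne (n c), rfl⟩)
  have hx : ∀ f ∈ T.codeX, labelVec .x f ∈ T.cycle n A B (triChecks V) := by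
    intro f hf
    by_cases h : B = .x
    · rw [← h]
      exact hB f hf
    · rw [← labelVec_add L.right (by nofun) h]
      exact add_mem (hB f hf) (hz f (codeX_le_codeZ hf))
  rintro ⟨x, z⟩ ⟨h1, h2⟩
  have : ((x, z) : PVec (V × Color)) = labelVec .x x + labelVec .z z := by
    rw [labelVec_x, labelVec_z]
    simp
  rw [this]
  exact add_mem (hx x h1) (hz z h2)

/-- Commuting with the ZZ checks makes an A check constant on triangles. Its invariance at the three
corners then becomes invariance along all three colours of edges, which puts it in the code. -/
theorem first_round : T.edgeChecks A n ⊓ perp T.code ≤ T.code := by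
  have hn := L.rotation
  rintro _ ⟨⟨f, hf, rfl⟩, h⟩
  have h1 := (labelVec_mem_perp_map L.left.symm).1 (perp_anti triChecks_le_code h)
  rw [dotPerp_triEven] at h1
  obtain ⟨b, rfl⟩ := h1
  have hb : ∀ c v, b (T.σ c v) = b v := by
    intro c v
    have := hf v (n (n c))
    rwa [hn.cube] at this
  refine labelVec_mem_code _ ⟨triConst b, fun v c d _ => hb c v, ?_⟩
  rw [LinearMap.comp_apply, triSum_triConst]

/-- A product of B checks commuting with the A checks is invariant along both kinds of edges, hence
a plaquette. It is the product of a surviving Z plaquette of the code and an A check. -/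
theorem second_round : (T.edgeChecks B fun c => n (n c)) ⊓ perp (meas (T.edgeChecks A n) T.code) ≤
    meas (T.edgeChecks A n) T.code := by
  rintro _ ⟨⟨f, hf, rfl⟩, h⟩
  have h1 := mem_edgeInv_of_mem_perp L.ne (perp_anti (le_meas _ _) h)
  have hp : f ∈ T.plaqInv := by
    intro v c d hcd
    rcases L.rotation.eq_or d c with rfl | rfl | rfl
    · exact absurd rfl hcd
    · exact h1 v d
    · exact hf v d
  rw [← labelVec_add L.left.symm L.ne L.right.symm]
  exact add_mem (mem_meas (labelVec_z_mem_code (Submodule.mem_sup_right hp))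
    (labelVec_mem_perp_edgeChecks h1)) (le_meas _ _ ⟨_, h1, rfl⟩)

/-- This is the one round where topology enters. Orthogonality to the B-labelled chains makes all
intersection numbers vanish, leaving only boundaries, which are combinations of plaquette
stabilizers and checks. -/
theorem third_round : triChecks V ⊓
    perp (meas (T.edgeChecks B fun c => n (n c)) (meas (T.edgeChecks A n) T.code)) ≤
      meas (T.edgeChecks B fun c => n (n c)) (meas (T.edgeChecks A n) T.code) := by
  have hn := L.rotation
  have hmono := meas_mono (T.edgeChecks B fun c => n (n c))
    (meas_mono (T.edgeChecks A n) (triChecks_le_code (T := T)))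
  rintro _ ⟨⟨f, hf, rfl⟩, h⟩
  have h1 := mem_edgeInv_of_mem_perp L.right (perp_anti (le_meas _ _) h)
  have h2 : rot n f ∈ T.cyc := by
    refine ⟨fun v c => ?_, ?_⟩
    · have := h1 v (n c)
      dsimp only at this
      rwa [hn.cube] at this
    · rw [SetLike.mem_coe, LinearMap.mem_ker, triSum_rot hn]
      exact hf
  obtain ⟨a, ha, e⟩ := exists_bd_eq hn h2 (by
    intro g hg
    have := h _ (hmono (chain_mem L hg))
    rw [symp_labelVec L.right, rot_dot hn] at this
    exact this)
  have ef : f = a + rot n a := by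
    ext ⟨v, c⟩
    have := congrFun e (v, n (n c))
    rw [bd_eq hn, rot_apply, hn.cube] at this
    exact this.symm
  have r1 : rot n a ∈ T.edgeInv fun c => n (n c) :=
    rot_mem_edgeInv_of_plaqInv ha fun c => hn.ne (n c)
  have r2 : rot n (rot n a) ∈ T.edgeInv n :=
    rot_mem_edgeInv_of_plaqInv (k := fun c => n (n c)) ha fun c => (hn.ne (n c)).symm
  -- Expanding B as A plus Z in the last term shows this mixed operator to be in the code. The
  -- invariance of the shifted functions lets it survive both rounds. It supplies the part of Z(rot
  -- n a) that is not a B check.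
  have hq : labelVec A (rot n a + a) + labelVec B (rot n (rot n a)) ∈
      meas (T.edgeChecks B fun c => n (n c)) (meas (T.edgeChecks A n) T.code) := by
    refine mem_meas (mem_meas ?_ ?_) ?_
    · have e2 : labelVec A (rot n a + a) + labelVec B (rot n (rot n a)) =
          labelVec A (triConst (triSum a)) + labelVec .z (rot n (rot n a) + a) + labelVec .z a := by
        have e3 := labelVec_add L.left.symm L.ne L.right.symm (rot n (rot n a))
        have e4 := PVec.add_self (labelVec .z a)
        rw [← e3, triConst_triSum hn]
        simp only [map_add]
        linear_combination (exp := 1) -e4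
      rw [e2]
      refine add_mem (add_mem (labelVec_mem_code _ ⟨a, ha, rfl⟩) (labelVec_z_mem_code
        (Submodule.mem_sup_left ?_))) (labelVec_z_mem_code (Submodule.mem_sup_right ha))
      rw [LinearMap.mem_ker, map_add, triSum_rot hn, triSum_rot hn]
      exact funext fun v => CharTwo.add_self_eq_zero _
    · exact add_mem labelVec_self_mem_perp_edgeChecks (labelVec_mem_perp_edgeChecks r2)
    · exact add_mem (labelVec_mem_perp_edgeChecks
        (add_mem r1 (mem_edgeInv_of_plaqInv ha hn.ne_twice))) labelVec_self_mem_perp_edgeChecks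
  have hc := hmono (chain_mem L (bd_mem_cyc ha))
  have hz := hmono (plaq_mem L ha .z)
  have hB : labelVec B (rot n a) ∈
      meas (T.edgeChecks B fun c => n (n c)) (meas (T.edgeChecks A n) T.code) :=
    le_meas _ _ ⟨_, r1, rfl⟩
  have hB' := hmono (plaq_mem L ha B)
  have hA' := hmono (plaq_mem L ha A)
  have ec : rot n (bd a) = rot n (rot n a) + a := by
    ext ⟨v, c⟩
    rw [rot_apply, bd_eq hn, hn.cube]
    rfl
  rw [ef, map_add, ← labelVec_add L.ne L.right L.left (rot n a)]
  refine add_mem hz (add_mem ?_ hB)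
  have e5 : labelVec A (rot n a) = labelVec A (rot n a + a) + labelVec B (rot n (rot n a)) +
      labelVec B (rot n (bd a)) + labelVec A a + labelVec B a := by
    rw [ec]
    simp only [map_add]
    linear_combination (exp := 1) -PVec.add_self (labelVec A a) - PVec.add_self (labelVec B a) -
      PVec.add_self (labelVec B (rot n (rot n a)))
  rw [e5]
  exact add_mem (add_mem (add_mem hq hc) hA') hB'

/-- Measurements of commuting checks preserve isotropy, and the code sits inside the group that one
cycle produces from the ZZ checks. No direct check of commutation is needed. -/
theorem code_isotropic : T.code ≤ perp T.code := by
  have h : T.cycle n A B (triChecks V) ≤ perp (T.cycle n A B (triChecks V)) :=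
    meas_isotropic triChecks_isotropic (meas_isotropic (edgeChecks_isotropic _ _)
      (meas_isotropic (edgeChecks_isotropic _ _) triChecks_isotropic))
  exact (code_le_cycle L).trans (h.trans (perp_anti (code_le_cycle L)))

end Rounds

end Tiling

/-! ### Invariance of the colour code by comparison of ranks -/

theorem finrank_meas {Q : Type*} [Fintype Q] {M W : Submodule (ZMod 2) (PVec Q)} (hM : M ≤ perp M)
    (hW : W ≤ perp W) (h : M ⊓ perp W ≤ W) :
    Module.finrank (ZMod 2) (meas M W) = Module.finrank (ZMod 2) W :=
  (finrank_le_of_reversible hW (meas_isotropic hM hW) inf_perp_meas_le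
    (meas_inf_perp_le hW h)).symm

namespace Tiling

variable {V : Type*} {T : Tiling V} [Fintype V] {n : Color → Color} {A B : PauliLabel}
  (L : IsLayout n A B)

include L

theorem finrank_cycle : Module.finrank (ZMod 2) (T.cycle n A B T.code) =
    Module.finrank (ZMod 2) T.code := by
  have h1 := meas_isotropic (T.edgeChecks_isotropic A n) (code_isotropic (T := T) L)
  have h2 := meas_isotropic (T.edgeChecks_isotropic B fun c => n (n c)) h1
  rw [cycle, finrank_meas triChecks_isotropic h2 (third_round L),
    finrank_meas (edgeChecks_isotropic _ _) h1 (second_round L),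
    finrank_meas (edgeChecks_isotropic _ _) (code_isotropic L) (first_round L)]

omit L in
theorem cycle_triChecks_le : T.cycle n A B (triChecks V) ≤ T.cycle n A B T.code :=
  meas_mono _ (meas_mono _ (meas_mono _ triChecks_le_code))

/-- The code is contained in its image under the cycle, and reversibility of the rounds gives both
the same rank. -/
theorem cycle_code : T.cycle n A B T.code = T.code :=
  (Submodule.eq_of_le_of_finrank_eq ((code_le_cycle L).trans cycle_triChecks_le)
    (finrank_cycle L).symm).symm

theorem cycle_triChecks : T.cycle n A B (triChecks V) = T.code :=
  le_antisymm (cycle_triChecks_le.trans (cycle_code L).le) (code_le_cycle L)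

end Tiling

/-! ## String operators and homology -/

namespace Tiling

variable {V : Type*} {T : Tiling V}

/-- The vertices at the ends of the edges of colour `c` in a chain, as a function that is constant
on triangles. -/
def col (c : Color) : (V × Color → ZMod 2) →ₗ[ZMod 2] (V × Color → ZMod 2) where
  toFun h q := h (q.1, c)
  map_add' _ _ := rfl
  map_smul' _ _ := rfl

theorem col_eq (c : Color) (h : V × Color → ZMod 2) : col c h = triConst fun v => h (v, c) := rfl

theorem col_add_col {n : Color → Color} (hn : IsRotation n) {h : V × Color → ZMod 2}
    (hh : h ∈ T.cyc) (c : Color) : col (n c) h + col (n (n c)) h = col c h :=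
  funext fun q => cyc_add hh hn q.1 c

/-- Chains as functions on the ruby lattice. -/
def chain : (V → Color → ZMod 2) ≃ₗ[ZMod 2] (V × Color → ZMod 2) :=
  (LinearEquiv.curry (ZMod 2) (ZMod 2) V Color).symm

@[simp] theorem chain_apply (γ : V → Color → ZMod 2) (v : V) (c : Color) :
    chain γ (v, c) = γ v c := rfl

theorem map_chain_cycles : T.cycles.map (chain (V := V)).toLinearMap = T.cyc := by
  ext h
  constructor
  · rintro ⟨γ, hγ, rfl⟩
    exact ⟨fun v d => hγ.1 v d, mem_triEven.2 fun v => (sum_color _).trans (hγ.2 v)⟩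
  · intro hh
    exact ⟨fun v c => h (v, c), ⟨fun v c => hh.1 v c, fun v =>
      (sum_color fun c => h (v, c)).symm.trans (mem_triEven.1 hh.2 v)⟩, rfl⟩

theorem chain_mem_cyc (γ : T.cycles) : chain γ.1 ∈ T.cyc := by
  rw [← map_chain_cycles]
  exact ⟨γ.1, γ.2, rfl⟩

theorem map_chain_boundaries [Finite V] :
    T.boundaries.map (chain (V := V)).toLinearMap = T.plaqInv.map bd := by
  classical
  have key : ∀ c v, chain (T.plaquetteBoundary c v) = bd (T.plaqCorner c v) := by
    intro c v
    ext ⟨w, d⟩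
    rw [bd_apply, Finset.sum_eq_single c]
    · simp only [chain_apply, plaquetteBoundary, plaqCorner, Set.indicator_apply,
        Set.mem_ofPred_eq, Pi.one_apply]
      by_cases h : w ∈ T.plaquette c v <;> by_cases h' : d = c <;>
        simp [h, h', CharTwo.add_self_eq_zero]
    · intro e _ he
      simp [plaqCorner, he]
    · simp
  rw [boundaries, ← span_plaqCorner, Submodule.map_span, Submodule.map_span]
  congr 1
  ext h
  constructor
  · rintro ⟨_, ⟨c, v, rfl⟩, rfl⟩
    exact ⟨_, ⟨c, v, rfl⟩, (key c v).symm⟩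
  · rintro ⟨_, ⟨c, v, rfl⟩, rfl⟩
    exact ⟨_, ⟨c, v, rfl⟩, key c v⟩

theorem chain_mem_map_bd_iff [Finite V] {γ : V → Color → ZMod 2} :
    chain γ ∈ T.plaqInv.map bd ↔ γ ∈ T.boundaries := by
  rw [← map_chain_boundaries]
  exact ⟨fun ⟨δ, hδ, e⟩ => chain.injective e ▸ hδ, fun h => ⟨γ, h, rfl⟩⟩

theorem vec_stringOp (γ : T.cycles) (c : Color) (p : PauliLabel) :
    (T.stringOp γ c p).vec = labelVec p (col c (chain γ.1)) := by
  classical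
  rw [stringOp, vec_on]
  congr 1
  ext ⟨v, d⟩
  have h2 : ∀ a : ZMod 2, (if a = 1 then 1 else 0) = a := by decide
  simp only [Set.indicator_apply, Set.mem_ofPred_eq, Pi.one_apply]
  exact h2 _

/-- A string around a plaquette of another colour is an encoded plaquette stabilizer, while
plaquettes of colour c have no edges of that colour; hence the witness erases colour c. -/
theorem col_bd_mem_codeX {a : V × Color → ZMod 2} (ha : a ∈ T.plaqInv) (c : Color) :
    col c (bd a) ∈ T.codeX := by
  classical
  refine ⟨fun q => if q.2 = c then 0 else a q, fun v d e h => ?_, ?_⟩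
  · dsimp only
    rw [ha v d e h]
  · have hn := IsRotation.next
    ext ⟨v, d⟩
    rw [col_eq, triConst_apply, bd_eq hn, LinearMap.comp_apply, triConst_apply, triSum_apply,
      hn.sum_eq _ c]
    simp [hn.ne, hn.ne_twice]

/-! ### Intersection numbers and the logical group of the colour code -/

variable [Fintype V]

theorem sum_mul_eq_zero (c : Color) {f g : V → ZMod 2} (hf : ∀ v, f (T.σ c v) = f v)
    (hg : ∀ v, g (T.σ c v) = g v) : ∑ v, f v * g v = 0 := by
  refine Finset.sum_involution (fun v _ => T.σ c v) ?_ ?_ ?_ ?_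
  · intro v _
    rw [hf, hg, CharTwo.add_self_eq_zero]
  · intro v _ _
    exact T.sigma_ne c v
  · simp
  · intro v _
    exact T.invol c v

theorem sum_cyc_mul_cyc {g h : V × Color → ZMod 2} (hg : g ∈ T.cyc) (hh : h ∈ T.cyc) (c : Color) :
    ∑ v, g (v, c) * h (v, c) = 0 :=
  sum_mul_eq_zero c (fun v => hg.1 v c) (fun v => hh.1 v c)

/-- The intersection form can be computed from the edges of two colours. -/
theorem dot_rot_eq {n : Color → Color} (hn : IsRotation n) {g h : V × Color → ZMod 2}
    (hg : g ∈ T.cyc) (hh : h ∈ T.cyc) (c : Color) :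
    g ⬝ᵥ rot n h = ∑ v, g (v, c) * h (v, n c) := by
  -- Products of equal colours cancel along edges, so the summands for the three colours have the
  -- same sum over the vertices. Three equal terms mod 2 amount to one.
  have key : ∀ c, ∑ v, g (v, n (n c)) * h (v, c) = ∑ v, g (v, c) * h (v, n c) := by
    intro c
    have h1 := sum_cyc_mul_cyc hg hh (n (n c))
    have h2 := sum_cyc_mul_cyc hg hh (n c)
    have e : ∀ v, g (v, n (n c)) * h (v, c) = g (v, c) * h (v, n c) +
        g (v, n (n c)) * h (v, n (n c)) + g (v, n c) * h (v, n c) := by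
      intro v
      rw [← cyc_add hh hn v c, ← cyc_add hg hn v c]
      linear_combination -CharTwo.add_self_eq_zero (g (v, n c) * h (v, n c))
    simp only [e, Finset.sum_add_distrib, h1, h2, add_zero]
  rw [dot_eq_sum, Finset.sum_comm, hn.sum_eq _ c]
  simp only [rot_apply]
  have k1 := key c
  have k2 := key (n c)
  rw [hn.cube] at k2 ⊢
  rw [k1, ← k2]
  rw [add_assoc, CharTwo.add_self_eq_zero, add_zero]

theorem symp_string {p q : PauliLabel} (hpq : p ≠ q) (c d : Color) (g h : V × Color → ZMod 2) :
    symp (V × Color) (labelVec p (col c g)) (labelVec q (col d h)) = ∑ v, g (v, c) * h (v, d) := by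
  rw [symp_labelVec hpq, col_eq, triConst_dot, col_eq, triSum_triConst]
  rfl

theorem labelVec_mem_perp_code (p : PauliLabel) {b : V → ZMod 2}
    (hb : ∀ a ∈ T.plaqInv, b ⬝ᵥ triSum a = 0) : labelVec p (triConst b) ∈ perp T.code := by
  have hX : ∀ f ∈ T.codeX, f ⬝ᵥ triConst b = 0 := by
    rintro _ ⟨a, ha, rfl⟩
    rw [dotProduct_comm, triConst_dot, LinearMap.comp_apply, triSum_triConst, hb a ha]
  have hZ : ∀ f ∈ T.codeZ, f ⬝ᵥ triConst b = 0 := by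
    intro f hf
    obtain ⟨t, ht, a, ha, rfl⟩ := Submodule.mem_sup.1 hf
    rw [dotProduct_comm, triConst_dot, map_add, LinearMap.mem_ker.1 ht, zero_add, hb a ha]
  rintro ⟨x, z⟩ ⟨h1, h2⟩
  cases p
  · simp [symp_apply, labelVec_x, hZ z h2]
  · simp [symp_apply, labelVec_y, hX x h1, hZ z h2]
  · simp [symp_apply, labelVec_z, hX x h1]

/-- A string meets every plaquette evenly. Its edges of colour c either lie around the plaquette and
contribute both ends, or end at a plaquette of colour c; in the latter case the chain relation
rewrites them in the colours around it. -/
theorem string_mem_perp_code (p : PauliLabel) (c : Color) {h : V × Color → ZMod 2}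
    (hh : h ∈ T.cyc) : labelVec p (col c h) ∈ perp T.code := by
  rw [col_eq]
  refine labelVec_mem_perp_code p (b := fun v => h (v, c)) fun a ha => ?_
  have hn := IsRotation.next
  have hs : ∀ d, ∑ v, h (v, c) * a (v, d) = 0 := by
    intro d
    by_cases hd : c = d
    · subst hd
      have h1 : ∑ v, h (v, c.next) * a (v, c) = 0 := sum_mul_eq_zero c.next
        (fun v => hh.1 v _) (fun v => ha v _ _ (hn.ne c))
      have h2 : ∑ v, h (v, c.next.next) * a (v, c) = 0 := sum_mul_eq_zero c.next.next
        (fun v => hh.1 v _) (fun v => ha v _ _ (hn.ne_twice c))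
      simp only [← cyc_add hh hn _ c, add_mul, Finset.sum_add_distrib, h1, h2, add_zero]
    · exact sum_mul_eq_zero c (fun v => hh.1 v c) (fun v => ha v c d hd)
  simp only [dotProduct, triSum_apply, Finset.mul_sum]
  rw [Finset.sum_comm]
  exact Finset.sum_eq_zero fun d _ => hs d

/-- The vectors of the string operators with colour `c` and label `p`. -/
noncomputable def stringVec (T : Tiling V) (c : Color) (p : PauliLabel) :
    T.cycles →ₗ[ZMod 2] perp T.code where
  toFun γ := ⟨labelVec p (col c (chain γ.1)), string_mem_perp_code p c (chain_mem_cyc γ)⟩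
  map_add' γ δ := Subtype.ext (by simp only [Submodule.coe_add, map_add])
  map_smul' a γ := Subtype.ext (by simp only [Submodule.coe_smul, map_smul, RingHom.id_apply])

theorem stringVec_boundary (c : Color) (p : PauliLabel) : T.boundaries.submoduleOf T.cycles ≤
    (T.code.submoduleOf (perp T.code)).comap (T.stringVec c p) := by
  intro γ hγ
  obtain ⟨a, ha, e⟩ := chain_mem_map_bd_iff.2 (Submodule.mem_comap.1 hγ)
  change labelVec p (col c (chain γ.1)) ∈ T.code
  rw [show chain γ.1 = bd a from e.symm]
  exact labelVec_mem_code p (col_bd_mem_codeX ha c)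

/-- The class of the string operators with colour `c` and label `p`, as a function of the homology
class of the chain. -/
noncomputable def stringClass (T : Tiling V) (c : Color) (p : PauliLabel) :
    T.Homology →ₗ[ZMod 2] LogicalVec T.code :=
  Submodule.mapQ (T.boundaries.submoduleOf T.cycles) (T.code.submoduleOf (perp T.code))
    (T.stringVec c p) (stringVec_boundary c p)

theorem stringClass_mk (c : Color) (p : PauliLabel) (γ : T.cycles) :
    T.stringClass c p (T.homologyClass γ) = Submodule.Quotient.mk
      ⟨labelVec p (col c (chain γ.1)), string_mem_perp_code p c (chain_mem_cyc γ)⟩ := rfl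

/-- The logical operators of four homology classes. -/
noncomputable def stringMap (T : Tiling V) :
    ((T.Homology × T.Homology) × (T.Homology × T.Homology)) →ₗ[ZMod 2] LogicalVec T.code :=
  ((T.stringClass .r .x).coprod (T.stringClass .b .z)).coprod
    ((T.stringClass .b .x).coprod (T.stringClass .r .z))

theorem mem_boundaries_of_inter {n : Color → Color} (hn : IsRotation n) {γ : T.cycles} (c : Color)
    (h : ∀ g ∈ T.cyc, ∑ v, g (v, c) * chain γ.1 (v, n c) = 0) : γ.1 ∈ T.boundaries := by
  rw [← chain_mem_map_bd_iff]
  refine exists_bd_eq hn (chain_mem_cyc γ) fun g hg => ?_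
  rw [dot_rot_eq hn hg (chain_mem_cyc γ) c]
  exact h g hg

/-- Each unknown class is isolated by one test string. Equal labels commute, and so do different
labels of the same colour; in each test, the sole surviving term is the intersection number with one
of the four chains. -/
theorem stringMap_injective : Function.Injective T.stringMap := by
  rw [injective_iff_map_eq_zero]
  rintro ⟨⟨η₁, η₂⟩, η₃, η₄⟩ h0
  obtain ⟨γ₁, rfl⟩ := Submodule.Quotient.mk_surjective _ η₁
  obtain ⟨γ₂, rfl⟩ := Submodule.Quotient.mk_surjective _ η₂
  obtain ⟨γ₃, rfl⟩ := Submodule.Quotient.mk_surjective _ η₃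
  obtain ⟨γ₄, rfl⟩ := Submodule.Quotient.mk_surjective _ η₄
  have h1 : labelVec .x (col .r (chain γ₁.1)) + labelVec .z (col .b (chain γ₂.1)) +
      (labelVec .x (col .b (chain γ₃.1)) + labelVec .z (col .r (chain γ₄.1))) ∈ T.code :=
    (Submodule.Quotient.mk_eq_zero (T.code.submoduleOf (perp T.code))).1 h0
  have hz : ∀ g ∈ T.cyc, ∀ c p, symp (V × Color) (labelVec p (col c g))
      (labelVec .x (col .r (chain γ₁.1)) + labelVec .z (col .b (chain γ₂.1)) +
      (labelVec .x (col .b (chain γ₃.1)) + labelVec .z (col .r (chain γ₄.1)))) = 0 :=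
    fun g hg c p => by rw [symp_comm]; exact string_mem_perp_code p c hg _ h1
  have hxz : PauliLabel.x ≠ .z := nofun
  simp only [map_add] at hz
  have nx := IsRotation.next
  have b1 : γ₁.1 ∈ T.boundaries := by
    refine mem_boundaries_of_inter nx.twice .b fun g hg => ?_
    have := hz g hg .b .z
    rw [symp_string hxz.symm, symp_labelVec_self, symp_string hxz.symm, symp_labelVec_self,
      sum_cyc_mul_cyc hg (chain_mem_cyc γ₃)] at this
    simp only [add_zero] at this
    exact this
  have b2 : γ₂.1 ∈ T.boundaries := by
    refine mem_boundaries_of_inter nx .r fun g hg => ?_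
    have := hz g hg .r .x
    rw [symp_string hxz, symp_labelVec_self, symp_string hxz, symp_labelVec_self,
      sum_cyc_mul_cyc hg (chain_mem_cyc γ₄)] at this
    simp only [zero_add, add_zero] at this
    exact this
  have b3 : γ₃.1 ∈ T.boundaries := by
    refine mem_boundaries_of_inter nx .r fun g hg => ?_
    have := hz g hg .r .z
    rw [symp_string hxz.symm, symp_labelVec_self, symp_string hxz.symm, symp_labelVec_self,
      sum_cyc_mul_cyc hg (chain_mem_cyc γ₁)] at this
    simp only [zero_add, add_zero] at this
    exact this
  have b4 : γ₄.1 ∈ T.boundaries := by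
    refine mem_boundaries_of_inter nx.twice .b fun g hg => ?_
    have := hz g hg .b .x
    rw [symp_string hxz, symp_labelVec_self, symp_string hxz, symp_labelVec_self,
      sum_cyc_mul_cyc hg (chain_mem_cyc γ₂)] at this
    simp only [zero_add, add_zero] at this
    exact this
  have hq : ∀ γ : T.cycles, γ.1 ∈ T.boundaries → (Submodule.Quotient.mk γ : T.Homology) = 0 :=
    fun γ h => (Submodule.Quotient.mk_eq_zero _).2 h
  rw [hq _ b1, hq _ b2, hq _ b3, hq _ b4]
  rfl

theorem two_mul_le_finrank_homology {g : ℕ} (hg : T.eulerChar = 2 - 2 * (g : ℤ)) :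
    2 * g ≤ Module.finrank (ZMod 2) T.Homology := by
  have h1 := T.le_finrank_cyc hg
  rw [← map_chain_cycles, ← map_chain_boundaries, LinearEquiv.finrank_map_eq,
    LinearEquiv.finrank_map_eq] at h1
  have h2 := Submodule.finrank_quotient_add_finrank (T.boundaries.submoduleOf T.cycles)
  have h3 : Module.finrank (ZMod 2) (T.boundaries.submoduleOf T.cycles) ≤
      Module.finrank (ZMod 2) T.boundaries := by
    rw [(Submodule.equivMapOfInjective _ T.cycles.injective_subtype _).finrank_eq]
    refine Submodule.finrank_mono ?_
    rintro _ ⟨γ, hγ, rfl⟩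
    exact hγ
  lia

theorem finrank_logicalVec {g : ℕ} (hg : T.eulerChar = 2 - 2 * (g : ℤ)) :
    Module.finrank (ZMod 2) (LogicalVec T.code) = 8 * g := by
  have h1 := Submodule.finrank_quotient_add_finrank (T.code.submoduleOf (perp T.code))
  rw [(Submodule.submoduleOfEquivOfLe (code_isotropic (T := T) IsLayout.xy)).finrank_eq] at h1
  have h2 := T.finrank_code hg
  have h3 := finrank_perp T.code
  lia

/-- Injectivity gives 4 dim H ≤ 8g, while dim H ≥ 2g. Thus dimensions agree and the injection is
onto. -/
theorem stringMap_bijective {g : ℕ} (hg : T.eulerChar = 2 - 2 * (g : ℤ)) :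
    Function.Bijective T.stringMap := by
  refine ⟨stringMap_injective, ?_⟩
  have h1 := LinearMap.finrank_le_finrank_of_injective (stringMap_injective (T := T))
  have h2 := two_mul_le_finrank_homology hg
  have h3 : Module.finrank (ZMod 2) ((T.Homology × T.Homology) × (T.Homology × T.Homology)) =
      Module.finrank (ZMod 2) (LogicalVec T.code) := by
    rw [finrank_logicalVec hg] at h1 ⊢
    simp only [Module.finrank_prod] at h1 ⊢
    lia
  exact (LinearMap.injective_iff_surjective_of_finrank_eq_finrank h3).1 stringMap_injective

/-- Four homology classes, one for each of the anyons `(e, 1)`, `(m, 1)`, `(1, e)`, `(1, m)`. -/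
noncomputable def anyonEquiv (T : Tiling V) : T.Homology ⊗[ZMod 2] Anyon ≃ₗ[ZMod 2]
    (T.Homology × T.Homology) × (T.Homology × T.Homology) :=
  (TensorProduct.prodRight (ZMod 2) (ZMod 2) T.Homology ToricAnyon ToricAnyon).trans <|
    LinearEquiv.prodCongr
      ((TensorProduct.prodRight (ZMod 2) (ZMod 2) T.Homology (ZMod 2) (ZMod 2)).trans <|
        LinearEquiv.prodCongr (TensorProduct.rid _ _) (TensorProduct.rid _ _))
      ((TensorProduct.prodRight (ZMod 2) (ZMod 2) T.Homology (ZMod 2) (ZMod 2)).trans <|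
        LinearEquiv.prodCongr (TensorProduct.rid _ _) (TensorProduct.rid _ _))

omit [Fintype V] in
theorem anyonEquiv_tmul (η : T.Homology) (a : Anyon) : T.anyonEquiv (η ⊗ₜ a) =
    ((a.1.1 • η, a.1.2 • η), (a.2.1 • η, a.2.2 • η)) := by
  simp [anyonEquiv]

/-- The boson table obeys the fusion rules y = x + z in labels and g = r + b in colours. String
classes obey the same rules, the latter by closedness of the chain. -/
theorem stringMap_boson (γ : T.cycles) (c : Color) (p : PauliLabel) :
    T.stringMap (T.anyonEquiv (T.homologyClass γ ⊗ₜ boson c p)) =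
      T.stringClass c p (T.homologyClass γ) := by
  have hxz : ∀ f : V × Color → ZMod 2, labelVec .y f = labelVec .x f + labelVec .z f :=
    fun f => (labelVec_add (p := .x) (q := .z) (r := .y) nofun nofun nofun f).symm
  have hg : col .g (chain γ.1) = col .r (chain γ.1) + col .b (chain γ.1) := by
    exact (col_add_col IsRotation.next (chain_mem_cyc γ) .g).symm
  have hy : ∀ c, T.stringClass c .y (T.homologyClass γ) = T.stringClass c .x (T.homologyClass γ) +
      T.stringClass c .z (T.homologyClass γ) := by
    intro c
    simp only [stringClass_mk, ← Submodule.Quotient.mk_add, hxz]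
    rfl
  have hc : ∀ p, T.stringClass .g p (T.homologyClass γ) = T.stringClass .r p (T.homologyClass γ) +
      T.stringClass .b p (T.homologyClass γ) := by
    intro p
    simp only [stringClass_mk, ← Submodule.Quotient.mk_add, hg, map_add]
    rfl
  rw [anyonEquiv_tmul]
  cases c <;> cases p <;>
    simp only [boson, stringMap, LinearMap.coprod_apply, zero_smul, one_smul, map_zero, zero_add,
      add_zero, hy, hc] <;> abel

end Tiling

/-! ## The automorphism of the anyons -/

/-- The automorphism of the colour code anyons that one period implements. -/
def anyonAut : Anyon ≃+ Anyon where
  -- The columns of this linear map are the images of (e,1), (m,1), (1,e), (1,m), namely bz, gy, gz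
  -- and by.
  toFun a := ((a.1.2, a.1.1 + a.1.2 + a.2.1 + a.2.2), (a.1.2 + a.2.2, a.1.2 + a.2.1))
  invFun a := ((a.1.1 + a.1.2 + a.2.1 + a.2.2, a.1.1), (a.1.1 + a.2.2, a.1.1 + a.2.1))
  left_inv := by decide
  right_inv := by decide
  map_add' := by decide

theorem anyonAut_spin (a : Anyon) : Anyon.spin (anyonAut a) = Anyon.spin a := by
  revert a
  decide

theorem anyonAut_cube (a : Anyon) : anyonAut (anyonAut (anyonAut a)) = a := by
  revert a
  decide

theorem orderOf_anyonAut : orderOf anyonAut.toEquiv = 3 := by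
  have : Fact (Nat.Prime 3) := ⟨Nat.prime_three⟩
  refine orderOf_eq_prime (Equiv.ext anyonAut_cube) fun h => ?_
  have := congrArg (fun e : Equiv.Perm Anyon => (e ((1, 0), (0, 0))).1.1) h
  revert this
  decide

theorem anyonAut_boson (c : Color) (p : PauliLabel) :
    anyonAut (boson c p) = boson c.next p.next := by
  cases c <;> cases p <;> decide

theorem anyon_induction {p : Anyon → Prop} (h0 : p 0) (hadd : ∀ a b, p a → p b → p (a + b))
    (h1 : p (boson .r .x)) (h2 : p (boson .b .z)) (h3 : p (boson .b .x)) (h4 : p (boson .r .z))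
    (a : Anyon) : p a := by
  have hz : ∀ x : ZMod 2, x = 0 ∨ x = 1 := by decide
  obtain ⟨⟨e₁, m₁⟩, e₂, m₂⟩ := a
  have e : (((e₁, m₁), (e₂, m₂)) : Anyon) =
      (((e₁, 0), (0, 0)) : Anyon) + (((0, m₁), (0, 0)) : Anyon) +
        ((((0, 0), (e₂, 0)) : Anyon) + (((0, 0), (0, m₂)) : Anyon)) := by
    simp
  rw [e]
  refine hadd _ _ (hadd _ _ ?_ ?_) (hadd _ _ ?_ ?_)
  · rcases hz e₁ with rfl | rfl
    exacts [h0, h1]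
  · rcases hz m₁ with rfl | rfl
    exacts [h0, h2]
  · rcases hz e₂ with rfl | rfl
    exacts [h0, h3]
  · rcases hz m₂ with rfl | rfl
    exacts [h0, h4]

/-! ## Strings through one cycle of measurements -/

namespace Tiling

variable {V : Type*} [Fintype V] {T : Tiling V}

theorem exists_stringEquiv {g : ℕ} (hg : T.eulerChar = 2 - 2 * (g : ℤ))
    {S : Subgroup (Pauli (V × Color))} (hS : vecs S = T.code) :
    ∃ Φ : (T.Homology ⊗[ZMod 2] Anyon) ≃+ Additive (Logical (withPhases S)), ∀ γ c p,
      Represents (withPhases S) (T.stringOp γ c p)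
        (Φ (T.homologyClass γ ⊗ₜ[ZMod 2] boson c p)).toMul := by
  obtain ⟨e, he⟩ := exists_logicalEquiv hS
  refine ⟨(T.anyonEquiv.toAddEquiv.trans
    (AddEquiv.ofBijective T.stringMap.toAddMonoidHom (stringMap_bijective hg))).trans e, ?_⟩
  intro γ c p
  have h1 : (T.stringOp γ c p).vec ∈ perp T.code := by
    rw [vec_stringOp]
    exact string_mem_perp_code p c (chain_mem_cyc γ)
  have h2 := he (T.stringOp γ c p) h1
  have h3 : T.stringMap (T.anyonEquiv (T.homologyClass γ ⊗ₜ boson c p)) =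
      Submodule.Quotient.mk ⟨(T.stringOp γ c p).vec, h1⟩ := by
    rw [stringMap_boson, stringClass_mk]
    simp only [vec_stringOp]
  rw [← h3] at h2
  exact h2

section Loop

variable {n : Color → Color} {A B : PauliLabel} (L : IsLayout n A B)
  {S₀ S₁ S₂ S₃ : Subgroup (Pauli (V × Color))} (h₀ : vecs S₀ = T.code)
  (h₁ : vecs S₁ = meas (T.edgeChecks A n) (vecs S₀))
  (h₂ : vecs S₂ = meas (T.edgeChecks B fun c => n (n c)) (vecs S₁))
  (h₃ : vecs S₃ = meas (triChecks V) (vecs S₂))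
  {m₀ : Logical (withPhases S₀) ≃* Logical (withPhases S₁)}
  {m₁ : Logical (withPhases S₁) ≃* Logical (withPhases S₂)}
  {m₂ : Logical (withPhases S₂) ≃* Logical (withPhases S₃)}
  (t₀ : IsTransfer m₀) (t₁ : IsTransfer m₁) (t₂ : IsTransfer m₂)
  {a : Logical (withPhases S₀)} {P R : Pauli (V × Color)} {h : V × Color → ZMod 2} (c : Color)

include L h₀ h₁ h₂ h₃ t₀ t₁ t₂

/-- Within each group the representative may be changed by a stabilizer; it passes a round if it
also commutes with the checks. `u₀`, `u₁` and `u₂` are the operators passing the A, B and Z rounds.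
-/
theorem loop_vec (ha : Represents (withPhases S₀) P a) {u₀ u₁ u₂ : PVec (V × Color)}
    (e₀ : P.vec + u₀ ∈ T.code) (c₀ : u₀ ∈ perp (T.edgeChecks A n))
    (e₁ : u₀ + u₁ ∈ meas (T.edgeChecks A n) T.code)
    (c₁ : u₁ ∈ perp (T.edgeChecks B fun c => n (n c)))
    (e₂ : u₁ + u₂ ∈ meas (T.edgeChecks B fun c => n (n c)) (meas (T.edgeChecks A n) T.code))
    (c₂ : u₂ ∈ perp (triChecks V)) (e₃ : u₂ + R.vec ∈ T.code) :
    Represents (withPhases S₃) R (m₂ (m₁ (m₀ a))) := by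
  have i₀ := code_isotropic (T := T) L
  have i₁ := meas_isotropic (T.edgeChecks_isotropic A n) i₀
  have i₂ := meas_isotropic (T.edgeChecks_isotropic B fun c => n (n c)) i₁
  have hadd : ∀ {W : Submodule (ZMod 2) (PVec (V × Color))} {u v : PVec (V × Color)},
      W ≤ perp W → u ∈ perp W → u + v ∈ W → v ∈ perp W := by
    intro W u v hW hu huv
    have := add_mem hu (hW huv)
    rwa [← add_assoc, PVec.add_self, zero_add] at this
  rw [h₀] at h₁
  rw [h₁] at h₂
  rw [h₂] at h₃
  have h₃' : vecs S₃ = T.code := h₃.trans (cycle_code L)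
  have hP : P.vec ∈ perp T.code := by
    have := ha.1
    rwa [mem_commutant, vecs_withPhases, h₀] at this
  have p₀ : u₀ ∈ perp (meas (T.edgeChecks A n) T.code) := perp_le_perp_meas (hadd i₀ hP e₀) c₀
  have p₁ := perp_le_perp_meas (hadd i₁ p₀ e₁) c₁
  have p₂ := perp_le_perp_meas (hadd i₂ p₁ e₂) c₂
  have r₁ := t₀.represents (by rwa [h₀]) (P' := Pauli.ofVec u₀) ha (by rwa [h₀]) (by rwa [h₁])
  have r₂ := t₁.represents (by rwa [h₁]) (P' := Pauli.ofVec u₁) r₁ (by rwa [h₁]) (by rwa [h₂])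
  have r₃ := t₂.represents (by rwa [h₂]) (P' := Pauli.ofVec u₂) r₂ (by rwa [h₂]) (by rwa [h₃])
  exact represents_withPhases_of_add_mem (by rwa [h₃']) r₃ (by rwa [h₃'])

/-- One cycle takes strings of colour `c` and label `A` to strings of colour `n c` and label `Z`. -/
theorem loop_left (hh : h ∈ T.cyc) (ha : Represents (withPhases S₀) P a)
    (hP : P.vec = labelVec A (col c h)) (hR : R.vec = labelVec .z (col (n c) h)) :
    Represents (withPhases S₃) R (m₂ (m₁ (m₀ a))) := by
  have hn := L.rotation
  -- A checks move the string to two corners of every triangle, with values that make it commute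
  -- with the B checks. Multiplication by the B check of f changes A into Z, and ZZ checks then
  -- spread it as colour `n c`, by triangle parity.
  let f : V × Color → ZMod 2 := corner c (fun v => h (v, n (n c))) + corner (n c) fun v => h (v, c)
  have hf : f ∈ T.edgeInv fun c => n (n c) :=
    add_mem (corner_mem_edgeInv fun v => hh.1 v _)
      (corner_mem_edgeInv fun v => by rw [hn.cube]; exact hh.1 v c)
  have hv := fun v => cyc_add hh hn v c
  have h2 := fun v c => CharTwo.add_self_eq_zero (h (v, c))
  have ne1 := hn.ne c
  have ne2 := hn.ne_twice c
  have ne3 := hn.ne (n c)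
  refine loop_vec L h₀ h₁ h₂ h₃ t₀ t₁ t₂ ha (u₀ := labelVec A (col c h)) (u₁ := labelVec A f)
    (u₂ := labelVec .z f) ?_ labelVec_self_mem_perp_edgeChecks ?_ (labelVec_mem_perp_edgeChecks hf)
    ?_ (labelVec_mem_perp_map_self _) ?_
  · rw [hP, PVec.add_self]
    exact zero_mem _
  · rw [← map_add]
    refine le_meas _ _ ⟨_, ?_, rfl⟩
    have e : col c h + f = corner c (fun v => h (v, n c)) + corner (n (n c)) fun v => h (v, c) := by
      ext ⟨v, d⟩
      rcases hn.eq_or c d with rfl | rfl | rfl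
      · simp only [Pi.add_apply, col_eq, triConst_apply, f, corner, ne1.symm, ne2.symm, if_true,
          if_false]
        linear_combination h2 v (n (n d)) - hv v
      · simp only [Pi.add_apply, col_eq, triConst_apply, f, corner, ne1, ne3.symm, if_true,
          if_false]
        linear_combination h2 v c
      · simp only [Pi.add_apply, col_eq, triConst_apply, f, corner, ne2, ne3, if_true, if_false]
        ring
    rw [e]
    exact add_mem (corner_mem_edgeInv fun v => hh.1 v _)
      (corner_mem_edgeInv fun v => by rw [hn.cube]; exact hh.1 v c)
  · rw [labelVec_add L.left L.right.symm L.ne]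
    exact le_meas _ _ ⟨f, hf, rfl⟩
  · rw [hR, ← map_add]
    refine labelVec_z_mem_code (Submodule.mem_sup_left (mem_triEven.2 fun v => ?_))
    rw [hn.sum_eq _ c]
    simp only [Pi.add_apply, col_eq, triConst_apply, f, corner, ne1, ne2, ne3, ne1.symm, if_true,
      if_false]
    linear_combination hv v + h2 v (n c) + h2 v c

/-- One cycle takes strings of colour `c` and label `Z` to strings of colour `n c` and label `B`. -/
theorem loop_z (hh : h ∈ T.cyc) (ha : Represents (withPhases S₀) P a)
    (hP : P.vec = labelVec .z (col c h)) (hR : R.vec = labelVec B (col (n c) h)) :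
    Represents (withPhases S₃) R (m₂ (m₁ (m₀ a))) := by
  have hn := L.rotation
  -- ZZ checks concentrate the string on the corner where A checks run along edges of colour c. It
  -- is then itself of A-check shape, so it commutes with those checks and multiplying by A turns Z
  -- into B.
  let f : V × Color → ZMod 2 := corner (n (n c)) fun v => h (v, c)
  have hf : f ∈ T.edgeInv n := corner_mem_edgeInv fun v => by rw [hn.cube]; exact hh.1 v c
  have hv := fun v => cyc_add hh hn v c
  have h2 := fun v c => CharTwo.add_self_eq_zero (h (v, c))
  have ne1 := hn.ne c
  have ne2 := hn.ne_twice c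
  have ne3 := hn.ne (n c)
  have hc : labelVec B (col (n c) h) ∈ perp (triChecks V) := by
    rw [col_eq]
    exact labelVec_mem_perp_triChecks B _
  refine loop_vec L h₀ h₁ h₂ h₃ t₀ t₁ t₂ ha (u₀ := labelVec .z f) (u₁ := labelVec B f)
    (u₂ := labelVec B (col (n c) h)) ?_ (labelVec_mem_perp_edgeChecks hf) ?_
    labelVec_self_mem_perp_edgeChecks ?_ hc ?_
  · rw [hP, ← map_add]
    refine labelVec_z_mem_code (Submodule.mem_sup_left (mem_triEven.2 fun v => ?_))
    rw [hn.sum_eq _ c]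
    simp only [Pi.add_apply, col_eq, triConst_apply, f, corner, ne2.symm, ne3.symm, if_true,
      if_false]
    linear_combination 2 * h2 v c
  · rw [labelVec_add L.right.symm L.ne.symm L.left.symm]
    exact le_meas _ _ ⟨f, hf, rfl⟩
  · rw [← map_add]
    -- The passage to whole triangles costs the B-labelled chain of h, a stabilizer of the second
    -- round, and B checks on two corners.
    have e : f + col (n c) h =
        rot n h + (corner (n c) (fun v => h (v, c)) + corner (n (n c)) fun v => h (v, n c)) := by
      ext ⟨v, d⟩
      rcases hn.eq_or c d with rfl | rfl | rfl
      · simp only [Pi.add_apply, col_eq, triConst_apply, f, corner, ne1.symm, ne2.symm, if_false,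
          rot_apply]
        ring
      · simp only [Pi.add_apply, col_eq, triConst_apply, f, corner, ne3.symm, if_true, if_false,
          rot_apply]
        linear_combination hv v - h2 v (n (n c))
      · simp only [Pi.add_apply, col_eq, triConst_apply, f, corner, ne3, if_true, if_false,
          rot_apply, hn.cube]
        ring
    rw [e, map_add]
    refine add_mem (meas_mono _ (meas_mono _ triChecks_le_code) (chain_mem L hh))
      (le_meas _ _ ⟨_, add_mem ?_ ?_, rfl⟩)
    · exact corner_mem_edgeInv fun v => by rw [hn.cube]; exact hh.1 v c
    · exact corner_mem_edgeInv fun v => by rw [hn.cube]; exact hh.1 v _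
  · rw [hR, PVec.add_self]
    exact zero_mem _

end Loop

end Tiling

/-! ## Periodic schedules -/

section Schedule

variable {Q : Type*} [Fintype Q]

/-- The span of the vectors of a set of checks. -/
abbrev checkSpan (M : Set (Pauli Q)) : Submodule (ZMod 2) (PVec Q) :=
  Submodule.span (ZMod 2) (Pauli.vec '' M)

variable {M : ℕ → Set (Pauli Q)} {o : ℕ → Pauli Q → Bool}

theorem vecs_isg_succ (t : ℕ) :
    vecs (isg M o (t + 1)) = meas (checkSpan (M t)) (vecs (isg M o t)) := vecs_measure _ _ _

theorem vecs_isg_isotropic (hM : ∀ t, checkSpan (M t) ≤ perp (checkSpan (M t))) (t : ℕ) :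
    vecs (isg M o t) ≤ perp (vecs (isg M o t)) := by
  induction t with
  | zero =>
    rw [isg, vecs_bot]
    exact bot_le
  | succ t ih =>
    rw [vecs_isg_succ]
    exact meas_isotropic (hM t) ih

theorem vecs_groupAt_add {p : ℕ} (hp : ∀ t, M (t + p) = M t)
    (h : vecs (groupAt M o p) = vecs (groupAt M o 0)) (t : ℕ) :
    vecs (groupAt M o (t + p)) = vecs (groupAt M o t) := by
  induction t with
  | zero => rwa [zero_add]
  | succ t ih =>
    have e : M (t + p + 4) = M (t + 4) := by rw [add_right_comm, hp]
    have h1 := vecs_isg_succ (M := M) (o := o) (t + p + 4)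
    have h2 := vecs_isg_succ (M := M) (o := o) (t + 4)
    rw [e, ih, ← h2] at h1
    rw [groupAt, show t + 1 + p + 4 = t + p + 4 + 1 by ring, h1]

/-- The rounds from time `0` on are reversible. -/
def Reversible (M : ℕ → Set (Pauli Q)) (o : ℕ → Pauli Q → Bool) (t : ℕ) : Prop :=
  checkSpan (M (t + 4)) ⊓ perp (vecs (groupAt M o t)) ≤ vecs (groupAt M o t)

/-- Reversibility depends only on the checks and the vectors of the group, both periodic, so one
period suffices. -/
theorem reversible_of_lt {p : ℕ} (hp : ∀ t, M (t + p) = M t)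
    (h : vecs (groupAt M o p) = vecs (groupAt M o 0)) (hlt : ∀ t < p, Reversible M o t) (h0 : 0 < p)
    (t : ℕ) : Reversible M o t := by
  induction t using Nat.strong_induction_on with
  | _ t ih =>
    by_cases ht : t < p
    · exact hlt t ht
    · obtain ⟨s, rfl⟩ := Nat.exists_eq_add_of_le' (not_lt.1 ht)
      have := ih s (by lia)
      unfold Reversible at this ⊢
      rwa [vecs_groupAt_add hp h, add_right_comm, hp]

theorem finrank_groupAt (hM : ∀ t, checkSpan (M t) ≤ perp (checkSpan (M t)))
    (hr : ∀ t, Reversible M o t) (t : ℕ) : Module.finrank (ZMod 2) (vecs (groupAt M o t)) =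
      Module.finrank (ZMod 2) (vecs (groupAt M o 0)) := by
  induction t with
  | zero => rfl
  | succ t ih =>
    rw [← ih]
    have := finrank_meas (hM (t + 4)) (vecs_isg_isotropic (o := o) hM (t + 4)) (hr t)
    rwa [← vecs_isg_succ, add_right_comm] at this

theorem isReversiblePair_groupAt (ho : Possible M o)
    (hM : ∀ t, checkSpan (M t) ≤ perp (checkSpan (M t))) (hr : ∀ t, Reversible M o t) (t : ℕ) :
    IsReversiblePair (groupAt M o t) (groupAt M o (t + 1)) := by
  have e : t + 1 + 4 = t + 4 + 1 := by ring
  rw [groupAt, groupAt, e]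
  refine isReversiblePair_measure ?_ (hM _) (vecs_isg_isotropic hM _) (hr t)
  exact ho (t + 4 + 1)

theorem vecs_groupAt_succ (t : ℕ) :
    vecs (groupAt M o (t + 1)) = meas (checkSpan (M (t + 4))) (vecs (groupAt M o t)) := by
  rw [groupAt, add_right_comm, vecs_isg_succ]

theorem exists_isTransfer_groupAt (ho : Possible M o)
    (hM : ∀ t, checkSpan (M t) ≤ perp (checkSpan (M t))) (hr : ∀ t, Reversible M o t) (t : ℕ) :
    (∃ m : Logical (groupAt M o t) ≃* Logical (groupAt M o (t + 1)), IsTransfer m) ∧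
      ∃ m : Logical (signlessAt M o t) ≃* Logical (signlessAt M o (t + 1)), IsTransfer m := by
  have i1 : vecs (groupAt M o t) ≤ perp (vecs (groupAt M o t)) := vecs_isg_isotropic hM _
  have i2 : vecs (groupAt M o (t + 1)) ≤ perp (vecs (groupAt M o (t + 1))) :=
    vecs_isg_isotropic hM _
  have r1 : vecs (groupAt M o t) ⊓ perp (vecs (groupAt M o (t + 1))) ≤
      vecs (groupAt M o (t + 1)) := by
    rw [vecs_groupAt_succ]
    exact inf_perp_meas_le
  have r2 : vecs (groupAt M o (t + 1)) ⊓ perp (vecs (groupAt M o t)) ≤ vecs (groupAt M o t) := by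
    rw [vecs_groupAt_succ]
    exact meas_inf_perp_le i1 (hr t)
  exact ⟨exists_isTransfer_of_vecs i1 i2 r1 r2 (isReversiblePair_groupAt ho hM hr t),
    exists_isTransfer_withPhases i1 i2 r1 r2⟩

end Schedule

namespace Tiling

variable {V : Type*} [Fintype V] {T : Tiling V}

/-! ## The two schedules -/

theorem checkSpan_schedule_isotropic (t : ℕ) :
    checkSpan (T.schedule t) ≤ perp (checkSpan (T.schedule t)) := by
  unfold schedule
  split
  · rw [checkSpan, span_checksZ]
    exact triChecks_isotropic
  · rw [checkSpan, span_checksX]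
    exact edgeChecks_isotropic _ _
  · rw [checkSpan, span_checksY]
    exact edgeChecks_isotropic _ _

theorem checkSpan_rewindingSchedule_isotropic (t : ℕ) :
    checkSpan (T.rewindingSchedule t) ≤ perp (checkSpan (T.rewindingSchedule t)) := by
  unfold rewindingSchedule
  split <;> simp only [checkSpan, span_checksZ, span_checksX, span_checksY] <;>
    first | exact triChecks_isotropic | exact edgeChecks_isotropic _ _

omit [Fintype V] in
theorem schedule_add (t : ℕ) : T.schedule (t + 3) = T.schedule t := by
  simp only [schedule, Nat.add_mod_right]

omit [Fintype V] in
theorem rewindingSchedule_add (t : ℕ) : T.rewindingSchedule (t + 6) = T.rewindingSchedule t := by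
  simp only [rewindingSchedule, Nat.add_mod_right]

/-- This matches the reversed layout, whose second rotation is `next` four times, that is, `next`.
-/
theorem span_checksX' : checkSpan T.checksX =
    T.edgeChecks .x fun c => (fun c : Color => c.next.next) ((fun c : Color => c.next.next) c) := by
  have : (fun c : Color => c.next.next.next.next) = Color.next := by
    funext c
    cases c <;> rfl
  rw [checkSpan, span_checksX]
  exact congrArg _ this.symm

variable {M : ℕ → Set (Pauli (V × Color))} {o : ℕ → Pauli (V × Color) → Bool}

/-- The first ZZ round on the trivial group gives only the ZZ checks; the three rounds XX, YY, ZZ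
then create the full code. -/
theorem vecs_groupAt_zero (h0 : M 0 = checksZ) (h1 : M 1 = T.checksX) (h2 : M 2 = T.checksY)
    (h3 : M 3 = checksZ) : vecs (groupAt M o 0) = T.code := by
  have e1 : vecs (isg M o 1) = triChecks V := by
    rw [vecs_isg_succ, h0, checkSpan, span_checksZ, isg, vecs_bot, meas, bot_inf_eq, sup_bot_eq]
  rw [groupAt, vecs_isg_succ, vecs_isg_succ, vecs_isg_succ, e1]
  simp only [h1, h2, h3, checkSpan, span_checksX, span_checksY, span_checksZ]
  exact cycle_triChecks IsLayout.xy

section Cycle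

variable {n : Color → Color} {A B : PauliLabel} (L : IsLayout n A B) {t : ℕ}
  (h : vecs (groupAt M o t) = T.code) (h0 : checkSpan (M (t + 4)) = T.edgeChecks A n)
  (h1 : checkSpan (M (t + 1 + 4)) = T.edgeChecks B fun c => n (n c))
  (h2 : checkSpan (M (t + 2 + 4)) = triChecks V)

include L h h0 h1 h2

theorem vecs_groupAt_cycle : vecs (groupAt M o (t + 3)) = T.code := by
  rw [vecs_groupAt_succ, vecs_groupAt_succ, vecs_groupAt_succ, h, h0, h1, h2]
  exact cycle_code L

theorem reversible_cycle : Reversible M o t ∧ Reversible M o (t + 1) ∧ Reversible M o (t + 2) := by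
  refine ⟨?_, ?_, ?_⟩
  · rw [Reversible, h0, h]
    exact first_round L
  · rw [Reversible, h1, vecs_groupAt_succ, h, h0]
    exact second_round L
  · rw [Reversible, h2, vecs_groupAt_succ, vecs_groupAt_succ, h, h0, h1]
    exact third_round L

end Cycle

theorem rank_groupAt {g : ℕ} (hg : T.eulerChar = 2 - 2 * (g : ℤ)) (ho : Possible M o)
    (hM : ∀ t, checkSpan (M t) ≤ perp (checkSpan (M t))) (hr : ∀ t, Reversible M o t)
    (h0 : vecs (groupAt M o 0) = T.code) (t : ℕ) :
    Group.rank (groupAt M o t) + 4 * g = Fintype.card (V × Color) := by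
  rw [rank_eq_finrank_vecs (ho (t + 4)), finrank_groupAt hM hr, h0, T.finrank_code hg]

section Automorphisms

variable {S : Subgroup (Pauli (V × Color))}
  {Φ : (T.Homology ⊗[ZMod 2] Anyon) ≃+ Additive (Logical S)}
  (hΦ : ∀ γ c p, Represents S (T.stringOp γ c p)
    (Φ (T.homologyClass γ ⊗ₜ[ZMod 2] boson c p)).toMul) {f : MulAut (Logical S)}

include hΦ

/-- An automorphism of the logical group that acts on the string operators of the `x` and `z`
bosons by the cyclic shifts of colours and labels comes from the automorphism of the anyons. -/
theorem apply_tmul_eq_anyonAut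
    (hx : ∀ γ c a, Represents S (T.stringOp γ c .x) a → Represents S (T.stringOp γ c.next .z) (f a))
    (hz : ∀ γ c a, Represents S (T.stringOp γ c .z) a → Represents S (T.stringOp γ c.next .y) (f a))
    (η : T.Homology) (a : Anyon) :
    f (Φ (η ⊗ₜ[ZMod 2] a)).toMul = (Φ (η ⊗ₜ[ZMod 2] anyonAut a)).toMul := by
  obtain ⟨γ, rfl⟩ : ∃ γ, T.homologyClass γ = η := Submodule.Quotient.mk_surjective _ η
  have hx' : ∀ c, f (Φ (T.homologyClass γ ⊗ₜ[ZMod 2] boson c .x)).toMul =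
      (Φ (T.homologyClass γ ⊗ₜ[ZMod 2] anyonAut (boson c .x))).toMul := fun c => by
    rw [anyonAut_boson]
    exact (hx γ c _ (hΦ γ c .x)).eq (hΦ γ c.next .z)
  have hz' : ∀ c, f (Φ (T.homologyClass γ ⊗ₜ[ZMod 2] boson c .z)).toMul =
      (Φ (T.homologyClass γ ⊗ₜ[ZMod 2] anyonAut (boson c .z))).toMul := fun c => by
    rw [anyonAut_boson]
    exact (hz γ c _ (hΦ γ c .z)).eq (hΦ γ c.next .y)
  refine anyon_induction (p := fun a => f (Φ (T.homologyClass γ ⊗ₜ[ZMod 2] a)).toMul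
    = (Φ (T.homologyClass γ ⊗ₜ[ZMod 2] anyonAut a)).toMul) ?_ ?_ (hx' _) (hz' _) (hx' _) (hz' _) a
  · simp
  · intro a b ha hb
    simp only [map_add, TensorProduct.tmul_add, toMul_add, map_mul, ha, hb]

/-- An automorphism of the logical group that fixes the string operators of the `y` and `z` bosons
is trivial. -/
theorem eq_one_of_represents
    (hy : ∀ γ c a, Represents S (T.stringOp γ c .y) a → Represents S (T.stringOp γ c .y) (f a))
    (hz : ∀ γ c a, Represents S (T.stringOp γ c .z) a → Represents S (T.stringOp γ c .z) (f a)) :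
    f = 1 := by
  refine MulEquiv.ext fun b => ?_
  obtain ⟨x, hx⟩ := Φ.surjective (Additive.ofMul b)
  obtain rfl : b = (Φ x).toMul := (congrArg Additive.toMul hx).symm
  clear hx
  rw [MulAut.one_apply]
  induction x using TensorProduct.induction_on with
  | zero => simp
  | add x y hx hy => simp only [map_add, toMul_add, map_mul, hx, hy]
  | tmul η a =>
    obtain ⟨γ, rfl⟩ : ∃ γ, T.homologyClass γ = η := Submodule.Quotient.mk_surjective _ η
    have hy' : ∀ c, f (Φ (T.homologyClass γ ⊗ₜ[ZMod 2] boson c .y)).toMul =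
        (Φ (T.homologyClass γ ⊗ₜ[ZMod 2] boson c .y)).toMul := fun c =>
      (hy γ c _ (hΦ γ c .y)).eq (hΦ γ c .y)
    have hz' : ∀ c, f (Φ (T.homologyClass γ ⊗ₜ[ZMod 2] boson c .z)).toMul =
        (Φ (T.homologyClass γ ⊗ₜ[ZMod 2] boson c .z)).toMul := fun c =>
      (hz γ c _ (hΦ γ c .z)).eq (hΦ γ c .z)
    have hadd : ∀ a b : Anyon, f (Φ (T.homologyClass γ ⊗ₜ[ZMod 2] a)).toMul =
        (Φ (T.homologyClass γ ⊗ₜ[ZMod 2] a)).toMul →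
        f (Φ (T.homologyClass γ ⊗ₜ[ZMod 2] b)).toMul =
        (Φ (T.homologyClass γ ⊗ₜ[ZMod 2] b)).toMul →
        f (Φ (T.homologyClass γ ⊗ₜ[ZMod 2] (a + b))).toMul =
        (Φ (T.homologyClass γ ⊗ₜ[ZMod 2] (a + b))).toMul := by
      intro a b ha hb
      simp only [map_add, TensorProduct.tmul_add, toMul_add, map_mul, ha, hb]
    have hx' : ∀ c, f (Φ (T.homologyClass γ ⊗ₜ[ZMod 2] boson c .x)).toMul =
        (Φ (T.homologyClass γ ⊗ₜ[ZMod 2] boson c .x)).toMul := by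
      intro c
      have e : boson c .x = boson c .y + boson c .z := by cases c <;> decide
      rw [e]
      exact hadd _ _ (hy' c) (hz' c)
    exact anyon_induction (p := fun a => f
      (Φ (T.homologyClass γ ⊗ₜ[ZMod 2] a)).toMul = (Φ (T.homologyClass γ ⊗ₜ[ZMod 2] a)).toMul)
      (by simp) hadd (hx' _) (hz' _) (hx' _) (hz' _) a

-- The cube is trivial on pure tensors and hence everywhere. For positive genus homology is nonzero,
-- and the map moves the rx string of a nonzero class to its bz string.
omit hΦ in
theorem orderOf_eq_three {g : ℕ} (hg : T.eulerChar = 2 - 2 * (g : ℤ)) (hg1 : 1 ≤ g)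
    (key : ∀ η a, f (Φ (η ⊗ₜ[ZMod 2] a)).toMul = (Φ (η ⊗ₜ[ZMod 2] anyonAut a)).toMul) :
    orderOf f = 3 := by
  have : Fact (Nat.Prime 3) := ⟨Nat.prime_three⟩
  refine orderOf_eq_prime (MulEquiv.ext fun b => ?_) fun h1 => ?_
  · obtain ⟨x, hx⟩ := Φ.surjective (Additive.ofMul b)
    obtain rfl : b = (Φ x).toMul := (congrArg Additive.toMul hx).symm
    clear hx
    rw [pow_succ, pow_two, MulAut.mul_apply, MulAut.mul_apply, MulAut.one_apply]
    induction x using TensorProduct.induction_on with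
    | zero => simp
    | tmul η a => rw [key, key, key, anyonAut_cube]
    | add x y hx hy =>
      simp only [map_add, toMul_add, map_mul]
      rw [hx, hy]
  · have hpos : 0 < Module.finrank (ZMod 2) T.Homology := by
      have := two_mul_le_finrank_homology hg
      lia
    have := Module.nontrivial_of_finrank_pos hpos
    obtain ⟨η, hη⟩ := exists_ne (0 : T.Homology)
    have h2 := key η (boson .r .x)
    rw [h1, MulAut.one_apply, anyonAut_boson] at h2
    have h3 := congrArg T.anyonEquiv (Φ.injective (Additive.toMul.injective h2))
    rw [anyonEquiv_tmul, anyonEquiv_tmul] at h3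
    have h4 := congrArg (fun x => x.1.1) h3
    simp [boson, Color.next, PauliLabel.next, hη] at h4

end Automorphisms

section Periods

variable {K G : ℕ → Subgroup (Pauli (V × Color))} (hK : ∀ t, K t = withPhases (G t))
  {m : ∀ t, Logical (K t) ≃* Logical (K (t + 1))}
  (hm : ∀ t, IsTransfer (m t)) {C : ℕ → Submodule (ZMod 2) (PVec (V × Color))}
  (hG : ∀ t, vecs (G (t + 1)) = meas (C t) (vecs (G t))) {t : ℕ} (h : vecs (G t) = T.code)

include hK hm hG h

/-- Three rounds with the layout of the period-3 schedule act on the string operators by the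
automorphism of the anyons. -/
theorem periodAut_three_tmul (h0 : C t = T.edgeChecks .x Color.next)
    (h1 : C (t + 1) = T.edgeChecks .y fun c => c.next.next) (h2 : C (t + 2) = triChecks V)
    (hp : ∀ t, K (t + 3) = K t)
    {Φ : (T.Homology ⊗[ZMod 2] Anyon) ≃+ Additive (Logical (K t))}
    (hΦ : ∀ γ c p, Represents (K t) (T.stringOp γ c p)
      (Φ (T.homologyClass γ ⊗ₜ[ZMod 2] boson c p)).toMul) (η : T.Homology) (a : Anyon) :
    periodAut m 3 hp t (Φ (η ⊗ₜ[ZMod 2] a)).toMul =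
      (Φ (η ⊗ₜ[ZMod 2] anyonAut a)).toMul := by
  obtain rfl : K = fun t => withPhases (G t) := funext hK
  have e0 : vecs (G (t + 1)) = meas (C t) (vecs (G t)) := hG _
  rw [h0] at e0
  have e1 : vecs (G (t + 2)) = meas (C (t + 1)) (vecs (G (t + 1))) := hG _
  rw [h1] at e1
  have e2 : vecs (G (t + 3)) = meas (C (t + 2)) (vecs (G (t + 2))) := hG _
  rw [h2] at e2
  have hx : ∀ γ c a, Represents (withPhases (G t)) (T.stringOp γ c .x) a →
      Represents (withPhases (G t)) (T.stringOp γ c.next .z)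
        (periodAut (K := fun t => withPhases (G t)) m 3 hp t a) := by
    intro γ c a ha
    have r := loop_left (R := T.stringOp γ c.next .z) IsLayout.xy h e0 e1 e2 (hm t) (hm (t + 1))
      (hm (t + 2)) c (chain_mem_cyc γ) ha (vec_stringOp _ _ _) (vec_stringOp _ _ _)
    exact represents_periodAut_three (K := fun t => withPhases (G t)) hp r
  have hz : ∀ γ c a, Represents (withPhases (G t)) (T.stringOp γ c .z) a →
      Represents (withPhases (G t)) (T.stringOp γ c.next .y)
        (periodAut (K := fun t => withPhases (G t)) m 3 hp t a) := by
    intro γ c a ha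
    have r := loop_z (R := T.stringOp γ c.next .y) IsLayout.xy h e0 e1 e2 (hm t) (hm (t + 1))
      (hm (t + 2)) c (chain_mem_cyc γ) ha (vec_stringOp _ _ _) (vec_stringOp _ _ _)
    exact represents_periodAut_three (K := fun t => withPhases (G t)) hp r
  exact apply_tmul_eq_anyonAut (f := periodAut (K := fun t => withPhases (G t)) m 3 hp t) hΦ hx hz
    η a

/-- Three rounds followed by three rounds with the layout reversed act trivially. -/
theorem periodAut_six_of_reversed {g : ℕ} (hg : T.eulerChar = 2 - 2 * (g : ℤ))
    (h0 : C t = T.edgeChecks .y fun c => c.next.next)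
    (h1 : C (t + 1) = T.edgeChecks .x
      fun c => (fun c : Color => c.next.next) ((fun c : Color => c.next.next) c))
    (h2 : C (t + 2) = triChecks V) (h3 : C (t + 3) = T.edgeChecks .x Color.next)
    (h4 : C (t + 4) = T.edgeChecks .y fun c => c.next.next) (h5 : C (t + 5) = triChecks V)
    (hp : ∀ t, K (t + 6) = K t) :
    periodAut m 6 hp t = 1 := by
  obtain rfl : K = fun t => withPhases (G t) := funext hK
  have e0 : vecs (G (t + 1)) = meas (C t) (vecs (G t)) := hG _
  rw [h0] at e0
  have e1 : vecs (G (t + 2)) = meas (C (t + 1)) (vecs (G (t + 1))) := hG _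
  rw [h1] at e1
  have e2 : vecs (G (t + 3)) = meas (C (t + 2)) (vecs (G (t + 2))) := hG _
  rw [h2] at e2
  have e3 : vecs (G (t + 4)) = meas (C (t + 3)) (vecs (G (t + 3))) := hG _
  rw [h3] at e3
  have e4 : vecs (G (t + 5)) = meas (C (t + 4)) (vecs (G (t + 4))) := hG _
  rw [h4] at e4
  have e5 : vecs (G (t + 6)) = meas (C (t + 5)) (vecs (G (t + 5))) := hG _
  rw [h5] at e5
  have h' : vecs (G (t + 3)) = T.code := by
    have e := cycle_code (T := T) IsLayout.yx
    rw [e2, e1, e0, h]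
    exact e
  obtain ⟨Φ, hΦ⟩ := exists_stringEquiv hg h
  have hn : ∀ c : Color, c.next.next.next = c := IsRotation.next.cube
  have hy : ∀ γ c a, Represents (withPhases (G t)) (T.stringOp γ c .y) a →
      Represents (withPhases (G t)) (T.stringOp γ c .y)
        (periodAut (K := fun t => withPhases (G t)) m 6 hp t a) := by
    intro γ c a ha
    -- The reversed half sends y to z and the colour to `n² c`; the forward half sends z back to y
    -- and shifts the colour by `n`, closing the loop since n³ = id. The z bosons similarly pass
    -- through x.
    have r := loop_left (R := T.stringOp γ c.next.next .z) IsLayout.yx h e0 e1 e2 (hm t)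
      (hm (t + 1)) (hm (t + 2)) c (chain_mem_cyc γ) ha (vec_stringOp _ _ _) (vec_stringOp _ _ _)
    have r' := loop_z (R := T.stringOp γ c .y) IsLayout.xy h' e3 e4 e5 (hm (t + 3)) (hm (t + 4))
      (hm (t + 5)) c.next.next (chain_mem_cyc γ) r (vec_stringOp _ _ _)
      (by rw [hn, vec_stringOp])
    exact represents_periodAut_six (K := fun t => withPhases (G t)) hp r'
  have hz : ∀ γ c a, Represents (withPhases (G t)) (T.stringOp γ c .z) a →
      Represents (withPhases (G t)) (T.stringOp γ c .z)
        (periodAut (K := fun t => withPhases (G t)) m 6 hp t a) := by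
    intro γ c a ha
    have r := loop_z (R := T.stringOp γ c.next.next .x) IsLayout.yx h e0 e1 e2 (hm t)
      (hm (t + 1)) (hm (t + 2)) c (chain_mem_cyc γ) ha (vec_stringOp _ _ _) (vec_stringOp _ _ _)
    have r' := loop_left (R := T.stringOp γ c .z) IsLayout.xy h' e3 e4 e5 (hm (t + 3))
      (hm (t + 4)) (hm (t + 5)) c.next.next (chain_mem_cyc γ) r (vec_stringOp _ _ _)
      (by rw [hn, vec_stringOp])
    exact represents_periodAut_six (K := fun t => withPhases (G t)) hp r'
  exact eq_one_of_represents (f := periodAut (K := fun t => withPhases (G t)) m 6 hp t) hΦ hy hz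

end Periods

end Tiling

end XYZRuby

/-! ### Assembly of the two schedules -/

theorem mainTheorem7 {V : Type*} [Fintype V] (T : Tiling V) (g : ℕ)
    (hg : T.eulerChar = 2 - 2 * (g : ℤ)) :
    ∃ φ : Anyon ≃+ Anyon,
      -- `φ` is the order-3 automorphism `rx → bz → gy`, `gz → ry → bx`, `gx → rz → by`
      (∀ a, Anyon.spin (φ a) = Anyon.spin a) ∧
      orderOf φ.toEquiv = 3 ∧
      (∀ c p, φ (boson c p) = boson c.next p.next) ∧
      -- the period-3 schedule
      (∀ o, Possible T.schedule o →
        (∀ t, Group.rank (groupAt T.schedule o t) + 4 * g = Fintype.card (V × Color)) ∧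
        (∀ t, IsReversiblePair (groupAt T.schedule o t) (groupAt T.schedule o (t + 1))) ∧
        (∀ t, ∃ m : Logical (groupAt T.schedule o t) ≃* Logical (groupAt T.schedule o (t + 1)),
          IsTransfer m) ∧
        signlessAt T.schedule o 0 = withPhases (Subgroup.closure T.colorCodeGenerators) ∧
        ∃ (h : ∀ t, signlessAt T.schedule o (t + 3) = signlessAt T.schedule o t)
          (m : ∀ t, Logical (signlessAt T.schedule o t) ≃*
            Logical (signlessAt T.schedule o (t + 1)))
          (Φ : (T.Homology ⊗[ZMod 2] Anyon) ≃+ Additive (Logical (signlessAt T.schedule o 0))),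
          (∀ t, IsTransfer (m t)) ∧
          (∀ γ c p, Represents (signlessAt T.schedule o 0) (T.stringOp γ c p)
            (Φ (T.homologyClass γ ⊗ₜ[ZMod 2] boson c p)).toMul) ∧
          (∀ η a, periodAut m 3 h 0 (Φ (η ⊗ₜ[ZMod 2] a)).toMul =
            (Φ (η ⊗ₜ[ZMod 2] φ a)).toMul) ∧
          (1 ≤ g → ∀ t, orderOf (periodAut m 3 h t) = 3) ∧
          (∀ t a b P R P' R',
            Represents (signlessAt T.schedule o t) P a →
            Represents (signlessAt T.schedule o t) R b →
            Represents (signlessAt T.schedule o t) P' (periodAut m 3 h t a) →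
            Represents (signlessAt T.schedule o t) R' (periodAut m 3 h t b) →
            (Commute P' R' ↔ Commute P R))) ∧
      -- the rewinding period-6 schedule
      (∀ o, Possible T.rewindingSchedule o →
        (∀ t, Group.rank (groupAt T.rewindingSchedule o t) + 4 * g = Fintype.card (V × Color)) ∧
        (∀ t, IsReversiblePair (groupAt T.rewindingSchedule o t)
          (groupAt T.rewindingSchedule o (t + 1))) ∧
        (∀ t, ∃ m : Logical (groupAt T.rewindingSchedule o t) ≃*
            Logical (groupAt T.rewindingSchedule o (t + 1)), IsTransfer m) ∧
        ∃ (h : ∀ t, signlessAt T.rewindingSchedule o (t + 6) = signlessAt T.rewindingSchedule o t)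
          (m : ∀ t, Logical (signlessAt T.rewindingSchedule o t) ≃*
            Logical (signlessAt T.rewindingSchedule o (t + 1))),
          (∀ t, IsTransfer (m t)) ∧
          ∀ t, periodAut m 6 h t = 1) := by
  refine ⟨anyonAut, anyonAut_spin, orderOf_anyonAut, anyonAut_boson, fun o ho => ?_, fun o ho => ?_⟩
  · have h0 : vecs (groupAt T.schedule o 0) = T.code := Tiling.vecs_groupAt_zero rfl rfl rfl rfl
    have hM := Tiling.checkSpan_schedule_isotropic (T := T)
    have hp : vecs (groupAt T.schedule o 3) = T.code := Tiling.vecs_groupAt_cycle IsLayout.xy h0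
      T.span_checksX T.span_checksY Tiling.span_checksZ
    have hr : ∀ t, Reversible T.schedule o t := by
      refine reversible_of_lt Tiling.schedule_add (hp.trans h0.symm) (fun t ht => ?_) three_pos
      obtain ⟨r0, r1, r2⟩ := Tiling.reversible_cycle IsLayout.xy h0 T.span_checksX T.span_checksY
        Tiling.span_checksZ
      interval_cases t
      exacts [r0, r1, r2]
    have ht := exists_isTransfer_groupAt ho hM hr
    refine ⟨Tiling.rank_groupAt hg ho hM hr h0, isReversiblePair_groupAt ho hM hr,
      fun t => (ht t).1, ?_, ?_⟩
    · rw [signlessAt, withPhases_eq_iff, vecs_closure, Tiling.span_colorCodeGenerators, h0]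
    · choose m hm using fun t => (ht t).2
      obtain ⟨Φ, hΦ⟩ := Tiling.exists_stringEquiv hg h0
      have h : ∀ t, signlessAt T.schedule o (t + 3) = signlessAt T.schedule o t := fun t =>
        withPhases_eq_iff.2 (vecs_groupAt_add Tiling.schedule_add (hp.trans h0.symm) t)
      have key := Tiling.periodAut_three_tmul (K := signlessAt T.schedule o)
        (G := groupAt T.schedule o) (C := fun t => checkSpan (T.schedule (t + 4))) (fun _ => rfl)
        hm vecs_groupAt_succ h0 T.span_checksX T.span_checksY Tiling.span_checksZ h hΦ
      exact ⟨h, m, Φ, hm, hΦ, key, fun hg1 t =>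
        (orderOf_periodAut_three (K := signlessAt T.schedule o) hm h t).trans
          (Tiling.orderOf_eq_three hg hg1 key),
        fun t a b P R P' R' hP hR hP' hR' => periodAut_commute_iff hm h t hP hR hP' hR'⟩
  · have h0 : vecs (groupAt T.rewindingSchedule o 0) = T.code :=
      Tiling.vecs_groupAt_zero rfl rfl rfl rfl
    have hM := Tiling.checkSpan_rewindingSchedule_isotropic (T := T)
    -- From time 0 the checks run YY, XX, ZZ, XX, YY, ZZ: one reversed and one forward cycle, each
    -- returning to the code.
    have h3 : vecs (groupAt T.rewindingSchedule o 3) = T.code := Tiling.vecs_groupAt_cycle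
      IsLayout.yx h0 T.span_checksY Tiling.span_checksX' Tiling.span_checksZ
    have hp : vecs (groupAt T.rewindingSchedule o 6) = T.code := Tiling.vecs_groupAt_cycle
      IsLayout.xy h3 T.span_checksX T.span_checksY Tiling.span_checksZ
    have hr : ∀ t, Reversible T.rewindingSchedule o t := by
      refine reversible_of_lt Tiling.rewindingSchedule_add (hp.trans h0.symm) (fun t ht => ?_)
        (by norm_num)
      obtain ⟨r0, r1, r2⟩ := Tiling.reversible_cycle IsLayout.yx h0 T.span_checksY
        Tiling.span_checksX' Tiling.span_checksZ
      obtain ⟨r3, r4, r5⟩ := Tiling.reversible_cycle IsLayout.xy h3 T.span_checksX T.span_checksY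
        Tiling.span_checksZ
      interval_cases t
      exacts [r0, r1, r2, r3, r4, r5]
    have ht := exists_isTransfer_groupAt ho hM hr
    choose m hm using fun t => (ht t).2
    have h : ∀ t, signlessAt T.rewindingSchedule o (t + 6) = signlessAt T.rewindingSchedule o t :=
      fun t => withPhases_eq_iff.2
        (vecs_groupAt_add Tiling.rewindingSchedule_add (hp.trans h0.symm) t)
    exact ⟨Tiling.rank_groupAt hg ho hM hr h0, isReversiblePair_groupAt ho hM hr,
      fun t => (ht t).1, h, m, hm,
      periodAut_six_eq_one hm h (Tiling.periodAut_six_of_reversed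
        (K := signlessAt T.rewindingSchedule o) (G := groupAt T.rewindingSchedule o)
        (C := fun t => checkSpan (T.rewindingSchedule (t + 4))) (fun _ => rfl) hm
        vecs_groupAt_succ h0 hg T.span_checksY
        Tiling.span_checksX' Tiling.span_checksZ T.span_checksX T.span_checksY
        Tiling.span_checksZ h)⟩
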